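/- Let $K$ be an infinite field. A closed subvariety of a finite-dimensional $K$-vector space is the set of common zeros (over $K$) of a set of polynomials with coefficients in $K$. If $\dim V=p+n$ with $p,n\in\mathbb Z_{\ge 0}$, a *Hodge dual* is a linear map $\star:\bigwedge^pV\to\bigwedge^nV^*$ given by $\star(\omega)(\omega')=\psi(\omega\wedge\omega')$ for some linear isomorphism $\psi:\bigwedge^{p+n}V\to K$; here $\bigwedge^nV^*$ is identified with $(\bigwedge^nV)^*$ via $(x_1\wedge\dots\wedge x_n)(v_1\wedge\dots\wedge v_n)=\det(x_i(v_j))$. A *Plücker variety* $X$ over $K$ assigns to every $p\in\mathbb Z_{\ge0}$ and every finite-dimensional $K$-vector space $V$ a closed subvariety $X_p(V)\subseteq\bigwedge^pV$ such that 1. $\bigwedge^p\varphi$ maps $X_p(V)$ into $X_p(W)$ for every linear map $\varphi:V\to W$; 2. every Hodge dual $\star:\bigwedge^pV\to\bigwedge^nV^*$ maps $X_p(V)$ into $X_n(V^*)$. It is *bounded* if $X_2(V)\ne\bigwedge^2V$ for some finite-dimensional $V$. **Theorem 1.1.** For every bounded Plücker variety $X$ there exist $p_0\in\mathbb Z_{\ge0}$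 and a finite-dimensional vector space $V_0$ such that, for every set $S$ of polynomials on $\bigwedge^{p_0}V_0$ whose set of common zeros is $X_{p_0}(V_0)$ (for instance, all polynomials vanishing on $X_{p_0}(V_0)$), the following holds for all $p\in\mathbb Z_{\ge0}$ and all finite-dimensional $V$: the set $X_p(V)$ is exactly the set of common zeros in $\bigwedge^pV$ of the polynomials $f\circ L$, where $f\in S$ and $L:\bigwedge^pV\to\bigwedge^{p_0}V_0$ is a composition of a finite sequence of maps each of which is either $\bigwedge^q\varphi$ for a linear map $\varphi$ of finite-dimensional vector spaces and some $q\in\mathbb Z_{\ge0}$, or a Hodge dual. In particular, there is a $d\in\mathbb Z_{\ge0}$, depending only on $X$, such that for all $p\in\mathbb Z_{\ge0}$ and all finite-dimensional $V$ the set $X_p(V)$ is the set of common zeros of polynomials of degree at most $d$ on $\bigwedge^pV$. -/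

import Mathlib

universe u

noncomputable section

/-! ### Polynomials on a vector space and Zariski-closed sets -/

/-- Polynomials on the vector space `W`, written as polynomial expressions in linear forms on `W`.
Each linear form is a variable; choosing a basis of `W`, these give exactly the polynomial
functions in the coordinates, with the usual notion of degree at most `d`. -/
abbrev PolyOn (K : Type u) [Field K] (W : Type u) [AddCommGroup W] [Module K W] : Type u :=
  MvPolynomial (Module.Dual K W) K

namespace PolyOn

variable {K : Type u} [Field K]
variable {W : Type u} [AddCommGroup W] [Module K W]
variable {W' : Type u} [AddCommGroup W'] [Module K W']

/-- The value of a polynomial at a point `w`: substitute `ℓ w` for every linear form `ℓ`. -/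
def evalAt (w : W) (f : PolyOn K W) : K :=
  MvPolynomial.eval (fun ℓ : Module.Dual K W => ℓ w) f

/-- The pullback of a polynomial on `W'` along a linear map `L : W → W'`. -/
def pullback (L : W →ₗ[K] W') (f : PolyOn K W') : PolyOn K W :=
  MvPolynomial.rename (fun ℓ : Module.Dual K W' => ℓ ∘ₗ L) f

theorem evalAt_pullback (L : W →ₗ[K] W') (f : PolyOn K W') (w : W) :
    evalAt w (pullback L f) = evalAt (L w) f := by
  simp only [evalAt, pullback, MvPolynomial.eval_rename]
  rfl

/-- The common zero set in `W` of a set of polynomials. -/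
def zeroLocus (S : Set (PolyOn K W)) : Set W :=
  {w | ∀ f ∈ S, evalAt w f = 0}

end PolyOn

/-- A subset of a vector space is Zariski-closed if it is the zero set of some polynomials. -/
def IsZariskiClosed (K : Type u) [Field K] {W : Type u} [AddCommGroup W] [Module K W]
    (Z : Set W) : Prop :=
  ∃ S : Set (PolyOn K W), Z = PolyOn.zeroLocus S

/-! ### Wedge products and Hodge duals -/

section Hodge

variable {K : Type u} [Field K] {V : Type u} [AddCommGroup V] [Module K V]

/-- The wedge product `⋀^p V × ⋀^n V → ⋀^(p+n) V`: multiplication in the exterior algebra. -/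
def wedge {p n : ℕ} (ω : ⋀[K]^p V) (ω' : ⋀[K]^n V) : ⋀[K]^(p + n) V :=
  ⟨(ω : ExteriorAlgebra K V) * (ω' : ExteriorAlgebra K V),
    SetLike.mul_mem_graded ω.2 ω'.2⟩

/-- `star : ⋀^p V → ⋀^n V*` is a Hodge dual: `dim V = p + n`, and for some isomorphism
`ψ : ⋀^(p+n) V → K` one has `star ω (ω') = ψ (ω ∧ ω')` for all `ω, ω'`. Here `⋀^n V*` is identified
with `(⋀^n V)*` by the determinant pairing `exteriorPower.pairingDual`. -/
def IsHodgeDual {p n : ℕ} (star : ⋀[K]^p V →ₗ[K] ⋀[K]^n (Module.Dual K V)) : Prop :=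
  Module.finrank K V = p + n ∧
    ∃ ψ : ⋀[K]^(p + n) V ≃ₗ[K] K, ∀ (ω : ⋀[K]^p V) (ω' : ⋀[K]^n V),
      exteriorPower.pairingDual K V n (star ω) ω' = ψ (wedge ω ω')

end Hodge

/-! ### Plücker varieties -/

/-- A Plücker variety over `K`: closed subvarieties `obj p V ⊆ ⋀^p V`, for all natural numbers `p`
and all finite-dimensional `V`, preserved by exterior powers of linear maps (so that each
`obj p` is a functor) and by Hodge duals. -/
structure PluckerVariety (K : Type u) [Field K] where
  /-- The instance of the Plücker variety at `p` and `V`. -/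
  obj : ∀ (p : ℕ) (V : Type u) [AddCommGroup V] [Module K V] [FiniteDimensional K V],
    Set (⋀[K]^p V)
  isClosed : ∀ (p : ℕ) (V : Type u) [AddCommGroup V] [Module K V] [FiniteDimensional K V],
    IsZariskiClosed K (obj p V)
  map_mem : ∀ (p : ℕ) (V W : Type u) [AddCommGroup V] [Module K V] [FiniteDimensional K V]
    [AddCommGroup W] [Module K W] [FiniteDimensional K W] (φ : V →ₗ[K] W) (ω : ⋀[K]^p V),
    ω ∈ obj p V → exteriorPower.map p φ ω ∈ obj p W
  hodge_mem : ∀ (p n : ℕ) (V : Type u) [AddCommGroup V] [Module K V] [FiniteDimensional K V]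
    (star : ⋀[K]^p V →ₗ[K] ⋀[K]^n (Module.Dual K V)), IsHodgeDual star →
    ∀ ω : ⋀[K]^p V, ω ∈ obj p V → star ω ∈ obj n (Module.Dual K V)

/-- A Plücker variety is bounded if for some finite-dimensional `V` its instance in `⋀^2 V` is not
the whole space. -/
def PluckerVariety.IsBounded {K : Type u} [Field K] (X : PluckerVariety K) : Prop :=
  ∃ (V : Type u) (_ : AddCommGroup V) (_ : Module K V) (_ : FiniteDimensional K V),
    X.obj 2 V ≠ Set.univ

/-- The linear maps out of `⋀^p V` which are compositions of finite sequences of maps, each of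
which is either an exterior power of a linear map between finite-dimensional vector spaces or a
Hodge dual. -/
inductive IsPluckerMap {K : Type u} [Field K] {p : ℕ} {V : Type u} [AddCommGroup V] [Module K V]
    [FiniteDimensional K V] :
    ∀ {q : ℕ} {W : Type u} [AddCommGroup W] [Module K W] [FiniteDimensional K W],
      (⋀[K]^p V →ₗ[K] ⋀[K]^q W) → Prop
  | refl : IsPluckerMap (LinearMap.id : ⋀[K]^p V →ₗ[K] ⋀[K]^p V)
  | map {q : ℕ} {W W' : Type u} [AddCommGroup W] [Module K W] [FiniteDimensional K W]
      [AddCommGroup W'] [Module K W'] [FiniteDimensional K W']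
      (L : ⋀[K]^p V →ₗ[K] ⋀[K]^q W) (φ : W →ₗ[K] W') :
      IsPluckerMap L → IsPluckerMap (exteriorPower.map q φ ∘ₗ L)
  | hodge {q n : ℕ} {W : Type u} [AddCommGroup W] [Module K W] [FiniteDimensional K W]
      (L : ⋀[K]^p V →ₗ[K] ⋀[K]^q W) (star : ⋀[K]^q W →ₗ[K] ⋀[K]^n (Module.Dual K W)) :
      IsHodgeDual star → IsPluckerMap L → IsPluckerMap (star ∘ₗ L)

/-- All pullbacks to `⋀^p V` of polynomials in `S`, a set of polynomials on `⋀^q W`, along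
compositions of exterior powers of linear maps and Hodge duals. -/
def pluckerPullbacks {K : Type u} [Field K] {q : ℕ} {W : Type u} [AddCommGroup W] [Module K W]
    [FiniteDimensional K W] (S : Set (PolyOn K (⋀[K]^q W)))
    (p : ℕ) (V : Type u) [AddCommGroup V] [Module K V] [FiniteDimensional K V] :
    Set (PolyOn K (⋀[K]^p V)) :=
  {f | ∃ g ∈ S, ∃ L : ⋀[K]^p V →ₗ[K] ⋀[K]^q W, IsPluckerMap L ∧ f = PolyOn.pullback L g}

end

/-! Call the truncation of `X` at level `N` the set of points all of whose images, under Plücker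
maps into the `N`-th exterior power of a space of dimension `2 * N`, lie in `X`. Truncations are
Plücker varieties, contain `X`, decrease with `N`, and at each fixed `p` and `V` equal `X` as soon
as `N` is large. The theorem therefore says that this descending chain is stationary, uniformly in
`p` and `V`. A stable level supplies `p₀` and `V₀`, and the degree bound follows because pullback
along linear maps does not raise degrees.

For the stationarity, elements of exterior powers become alternating forms on coordinate spaces, and
a Plücker variety becomes a `FormSystem`, closed under linear substitution and Hodge duality.
Restricting a form to a coordinate subspace contracts its dual, so a system is also closed under
contraction of nonzero forms. If some space of 2-forms is not filled, the bilinear contractions of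
all forms in the system have bounded rank (`exists_not_hasRank`): a 2-form of large rank specialises
to every 2-form in few variables. The same bound applies to the dual forms.

Fix the maximal contraction ranks `r₁` of a form `x` and `r₂` of its dual `y`, and change
coordinates so that one prescribed minor of each size is nonzero (`exists_isNormal`). The vanishing
of all larger minors then expresses a coordinate of `x` with two distinct variable indices on the
right through simpler ones, after division by the chosen minor. The same holds for `y`, whose
coordinates are those of `x` at complementary indices up to sign. Induction on a weight leaves only
window coordinates, with at most one variable index crossing over from each side
(`coord_mem_of_base`).

These finitely many families of window coordinates are tuples of scalars, of vectors indexed by `A`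
or by `B`, and of `A × B` matrices. Linear maps on the two sides act on them by pairs of matrices,
because passing to a linear image increases neither the rank of a form nor that of its dual
(`hasRank_star_of_comp`).

Functorial closed families of such tuples satisfy the descending chain condition
(`MatFam.chain_stabilizes`), by induction on the number of matrices. Either a nontrivial linear
combination has small rank, and one matrix is traded for vectors and scalars, or all combinations
have large rank, and then the matrices specialise to arbitrary ones while the images of the scalars
and vectors are prescribed. As only finitely many pairs of ranks occur, the chain of form systems is
stationary (`FormSystem.chain_stabilizes`). -/

open Module

/-! ### Locally dependent operators and specialisation of operators of large rank. -/

section LinearAlgebraLemmas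

variable {K : Type*} [Field K] {V W T Y : Type*} [AddCommGroup V] [Module K V]
  [AddCommGroup W] [Module K W] [AddCommGroup T] [Module K T] [AddCommGroup Y] [Module K Y]

/-- A nonzero univariate polynomial over an infinite field has a nonzero non-root. -/
theorem Polynomial.exists_ne_zero_eval_ne_zero [Infinite K] {p : Polynomial K} (hp : p ≠ 0) :
    ∃ s : K, s ≠ 0 ∧ p.eval s ≠ 0 := by
  by_contra! h
  have : (Polynomial.X * p) = 0 := by
    apply Polynomial.funext
    intro r
    by_cases hr : r = 0
    · simp [hr]
    · simp [h r hr]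
  simp [hp] at this

/-- Linear independence is an open condition along a line. -/
theorem LinearIndependent.exists_add_smul [Infinite K] {ι : Type*} [Finite ι] {v : ι → V}
    (hv : LinearIndependent K v) (w : ι → V) :
    ∃ s : K, s ≠ 0 ∧ LinearIndependent K (fun i => v i + s • w i) := by
  classical
  have := Fintype.ofFinite ι
  obtain ⟨g, hg⟩ := LinearMap.exists_leftInverse_of_injective (Fintype.linearCombination K v)
    (LinearMap.ker_eq_bot.2 (linearIndependent_iff_injective_fintypeLinearCombination.1 hv))
  have hgv : ∀ i, g (v i) = Pi.single i 1 := fun i => by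
    have := LinearMap.congr_fun hg (Pi.single i 1)
    simpa using this
  let M : Matrix ι ι K := Matrix.of fun i => g (w i)
  -- In the coordinates given by `g` the perturbed family has matrix `1 + s • M`; its determinant is
  -- a polynomial in `s` with value 1 at 0.
  let p : Polynomial K :=
    ((1 : Matrix ι ι K).map Polynomial.C + (Polynomial.X : Polynomial K) • M.map Polynomial.C).det
  have hp : ∀ s, p.eval s = (1 + s • M).det := fun s => by
    rw [← Polynomial.coe_evalRingHom, RingHom.map_det]
    congr 1
    ext i j
    rcases eq_or_ne i j with rfl | hij
    · simp; ring
    · simp [Matrix.one_apply_ne hij]; ring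
  have hp0 : p ≠ 0 := fun h => by simpa [h] using hp 0
  obtain ⟨s, hs, hs'⟩ := Polynomial.exists_ne_zero_eval_ne_zero hp0
  refine ⟨s, hs, LinearIndependent.of_comp g ?_⟩
  rw [hp] at hs'
  have : (⇑g ∘ fun i => v i + s • w i) = (1 + s • M).row := by
    ext i j
    simp [hgv, M, Matrix.row, Matrix.one_apply, Pi.single_apply, eq_comm]
  rw [this]
  exact Matrix.linearIndependent_rows_of_det_ne_zero hs'

/-- If the values of finitely many linear maps at every vector are linearly dependent, then a
nontrivial linear combination of the maps has small rank. -/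
theorem exists_smallRank_of_locally_dependent [Infinite K] (d : ℕ) (N : Fin d → V →ₗ[K] W)
    (h : ∀ x, ¬ LinearIndependent K (fun e => N e x)) :
    ∃ c : Fin d → K, c ≠ 0 ∧ ∃ S : Submodule K W, FiniteDimensional K S ∧ finrank K S ≤ d ∧
      ∀ x, ∑ e, c e • N e x ∈ S := by
  induction d with
  | zero => exact absurd linearIndependent_empty_type (h 0)
  | succ d ih =>
    by_cases h1 : ∀ x, ¬ LinearIndependent K (fun e : Fin d => N e.castSucc x)
    · obtain ⟨c, hc, S, hS, hS', hcS⟩ := ih (fun e => N e.castSucc) h1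
      refine ⟨Fin.snoc c 0, ?_, S, hS, hS'.trans (Nat.le_succ _), fun x => ?_⟩
      · intro h0
        apply hc
        ext e
        simpa using congrFun h0 e.castSucc
      · simpa [Fin.sum_univ_castSucc] using hcS x
    · push Not at h1
      obtain ⟨x0, hx0⟩ := h1
      -- At `x0` the last value is a combination `c` of the others. The corresponding combination of
      -- operators kills `x0`, and the claim is that all its values lie in `S`.
      let S : Submodule K W := Submodule.span K (Set.range fun e : Fin d => N e.castSucc x0)
      have hmem : N (Fin.last d) x0 ∈ S := by
        by_contra hn
        exact h x0 (linearIndependent_finSucc'.2 ⟨hx0, hn⟩)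
      obtain ⟨c, hc⟩ := (Submodule.mem_span_range_iff_exists_fun K).1 hmem
      refine ⟨Fin.snoc (fun e => - c e) 1, ?_, S,
        FiniteDimensional.span_of_finite K (Set.finite_range _), ?_, fun x => ?_⟩
      · intro h0
        simpa using congrFun h0 (Fin.last d)
      · exact (finrank_range_le_card _).trans (by simp)
      · by_contra hn
        simp only [Fin.sum_univ_castSucc, Fin.snoc_castSucc, Fin.snoc_last, neg_smul, one_smul,
          Finset.sum_neg_distrib] at hn
        -- If the value `z` at `x` lay outside `S`, the family completed by `z` would stay
        -- independent when `x0` moves to `x0 + s • x`. Since the combination kills `x0`, its value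
        -- there is `s • z`, so the operators would be independent at `x0 + s • x`.
        set z := -∑ e : Fin d, c e • N e.castSucc x + N (Fin.last d) x with hz
        have hli : LinearIndependent K (Fin.snoc (fun e : Fin d => N e.castSucc x0) z :
            Fin (d + 1) → W) := by
          rw [linearIndependent_finSucc']
          simpa [Fin.init_def] using ⟨hx0, hn⟩
        obtain ⟨s, hs, hsl⟩ := hli.exists_add_smul
          (Fin.snoc (fun e : Fin d => N e.castSucc x) 0 : Fin (d + 1) → W)
        rw [linearIndependent_finSucc'] at hsl
        apply h (x0 + s • x)
        rw [linearIndependent_finSucc']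
        have hinit : (fun e : Fin d => N e.castSucc (x0 + s • x)) =
            Fin.init (fun i => (Fin.snoc (fun e : Fin d => N e.castSucc x0) z : Fin (d + 1) → W) i
              + s • (Fin.snoc (fun e : Fin d => N e.castSucc x) 0 : Fin (d + 1) → W) i) := by
          ext e
          simp [Fin.init_def]
        change LinearIndependent K (fun e : Fin d => N e.castSucc (x0 + s • x)) ∧
          N (Fin.last d) (x0 + s • x) ∉
            Submodule.span K (Set.range (fun e : Fin d => N e.castSucc (x0 + s • x)))
        rw [hinit]
        refine ⟨hsl.1, fun hmem' => hsl.2 ?_⟩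
        rw [← hinit] at hmem' ⊢
        simp only [Fin.snoc_last, smul_zero, add_zero]
        have hz' : s • z = N (Fin.last d) (x0 + s • x)
            - ∑ e : Fin d, c e • N e.castSucc (x0 + s • x) := by
          simp only [map_add, map_smul, smul_add, Finset.sum_add_distrib, hc, hz]
          rw [show ∑ e : Fin d, c e • s • N e.castSucc x = s • ∑ e : Fin d, c e • N e.castSucc x by
            rw [Finset.smul_sum]; exact Finset.sum_congr rfl fun e _ => smul_comm _ _ _]
          rw [smul_neg]
          abel
        have : s • z ∈ Submodule.span K (Set.range fun e : Fin d => N e.castSucc (x0 + s • x)) := by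
          rw [hz']
          exact Submodule.sub_mem _ hmem' (Submodule.sum_mem _ fun e _ =>
            Submodule.smul_mem _ _ (Submodule.subset_span ⟨e, rfl⟩))
        have h2 := Submodule.smul_mem _ s⁻¹ this
        rwa [smul_smul, inv_mul_cancel₀ hs, one_smul] at h2

/-- Every linear map over a field has a quasi-inverse. -/
theorem LinearMap.exists_quasiInverse (f : V →ₗ[K] W) :
    ∃ g : W →ₗ[K] V, ∀ x, f (g (f x)) = f x := by
  obtain ⟨r, hr⟩ := f.rangeRestrict.exists_rightInverse_of_surjective f.range_rangeRestrict
  obtain ⟨g, hg⟩ := LinearMap.exists_extend r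
  refine ⟨g, fun x => ?_⟩
  have h1 : g (f x) = r (f.rangeRestrict x) := LinearMap.congr_fun hg (f.rangeRestrict x)
  have h2 := LinearMap.congr_fun hr (f.rangeRestrict x)
  rw [h1]
  exact congrArg Subtype.val h2

/-- Operators none of whose nontrivial linear combinations has small rank take linearly independent
values modulo a small subspace, at some vector of a prescribed affine subspace. -/
theorem exists_linearIndependent_mkQ [Infinite K] {d : ℕ} {E : Type*} [Fintype E]
    (M : Fin d → V →ₗ[K] T) (L : V →ₗ[K] (E → K)) (S₀ : Submodule K T) [FiniteDimensional K S₀]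
    {k : ℕ} (hk : finrank K S₀ + d + Fintype.card E ≤ k)
    (h : ∀ c : Fin d → K, c ≠ 0 → ∀ S : Submodule K T, FiniteDimensional K S → finrank K S ≤ k →
      ∃ x, ∑ e, c e • M e x ∉ S) (x₀ : V) :
    ∃ x, L x = L x₀ ∧ LinearIndependent K (fun e => S₀.mkQ (M e x)) := by
  have h1 : ∃ x : LinearMap.ker L, LinearIndependent K (fun e => S₀.mkQ (M e x)) := by
    by_contra! hn
    obtain ⟨c, hc, S, hS, hSd, hcS⟩ := exists_smallRank_of_locally_dependent d
      (fun e => S₀.mkQ ∘ₗ M e ∘ₗ (LinearMap.ker L).subtype) hn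
    obtain ⟨r, hr⟩ := L.exists_quasiInverse
    obtain ⟨σ, hσ⟩ := S₀.mkQ.exists_rightInverse_of_surjective S₀.range_mkQ
    let F : V →ₗ[K] T := ∑ e, c e • M e
    have hF : ∀ x, F x = ∑ e, c e • M e x := fun x => by simp [F]
    -- If independence failed on the kernel of `L`, a combination `F` would have small rank there
    -- modulo `S₀`. Its full range then lies in `S'`, whose three pieces have dimensions at most
    -- `finrank K S₀`, `d` and `Fintype.card E`.
    let S' : Submodule K T := (S₀ ⊔ S.map σ) ⊔ LinearMap.range (F ∘ₗ r)
    have hd : finrank K S' ≤ k := by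
      have e1 := Submodule.finrank_add_le_finrank_add_finrank (S₀ ⊔ S.map σ)
        (LinearMap.range (F ∘ₗ r))
      have e2 := Submodule.finrank_add_le_finrank_add_finrank S₀ (S.map σ)
      have e3 := Submodule.finrank_map_le σ S
      have e4 := LinearMap.finrank_range_le (F ∘ₗ r)
      rw [finrank_fintype_fun_eq_card] at e4
      change finrank K ↥((S₀ ⊔ S.map σ) ⊔ LinearMap.range (F ∘ₗ r)) ≤ k
      omega
    obtain ⟨x, hx⟩ := h c hc S' inferInstance hd
    apply hx
    rw [← hF]
    have hker : x - r (L x) ∈ LinearMap.ker L := by simp [hr]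
    have h2 : S₀.mkQ (F (x - r (L x))) ∈ S := by
      have := hcS ⟨x - r (L x), hker⟩
      simpa [hF] using this
    have h3 : F x = (F (x - r (L x)) - σ (S₀.mkQ (F (x - r (L x))))) +
        σ (S₀.mkQ (F (x - r (L x)))) + (F ∘ₗ r) (L x) := by
      simp
    rw [h3]
    refine Submodule.add_mem_sup (Submodule.add_mem_sup ?_ ?_) ⟨_, rfl⟩
    · refine (Submodule.ker_mkQ S₀).le ?_
      rw [LinearMap.mem_ker, map_sub]
      have := LinearMap.congr_fun hσ (S₀.mkQ (F (x - r (L x))))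
      simp only [LinearMap.comp_apply, LinearMap.id_apply] at this
      rw [this, sub_self]
    · exact Submodule.mem_map_of_mem h2
  obtain ⟨x, hx⟩ := h1
  obtain ⟨s, hs, hli⟩ := hx.exists_add_smul (fun e => S₀.mkQ (M e x₀))
  -- Rescaling `x + s • x₀` makes the coefficient of `x₀` equal to 1, so that `L` takes the
  -- prescribed value.
  refine ⟨x₀ + s⁻¹ • (x : V), ?_, ?_⟩
  · simp
  · have := hli.units_smul (fun _ => (Units.mk0 s hs)⁻¹)
    have he : (fun e => S₀.mkQ (M e (x₀ + s⁻¹ • (x : V)))) = ((fun _ : Fin d => (Units.mk0 s hs)⁻¹) •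
        fun i => S₀.mkQ (M i x) + s • S₀.mkQ (M i x₀)) := by
     ext e
     simp only [map_add, map_smul, Pi.smul_apply', Units.smul_def, Units.val_inv_eq_inv_val, Units.val_mk0,
      smul_add, smul_smul, inv_mul_cancel₀ hs, one_smul]
     abel
    rw [he]
    exact this

/-- Operators none of whose nontrivial linear combinations has small rank can be specialised to
arbitrary values. -/
theorem exists_specialization [Infinite K] {d : ℕ} {E : Type*} [Fintype E]
    (M : Fin d → V →ₗ[K] T) (L : V →ₗ[K] (E → K)) (n : ℕ) {k : ℕ} :
    ∀ (S₀ : Submodule K T) [FiniteDimensional K S₀]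
      (_ : finrank K S₀ + n * d + d + Fintype.card E ≤ k)
      (_ : ∀ c : Fin d → K, c ≠ 0 → ∀ S : Submodule K T, FiniteDimensional K S → finrank K S ≤ k →
        ∃ x, ∑ e, c e • M e x ∉ S) (φ₀ : T →ₗ[K] Y) (x₀ : Fin n → V) (t : Fin n → Fin d → Y),
    ∃ (φ : T →ₗ[K] Y) (x : Fin n → V), (∀ y ∈ S₀, φ y = φ₀ y) ∧ (∀ j, L (x j) = L (x₀ j)) ∧
      ∀ j e, φ (M e (x j)) = t j e := by
  induction n with
  | zero => intro S₀ _ _ _ φ₀ x₀ t; exact ⟨φ₀, x₀, by simp, by simp, by simp⟩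
  | succ n ih =>
    intro S₀ _ hk h φ₀ x₀ t
    obtain ⟨x, hLx, hli⟩ := exists_linearIndependent_mkQ M L S₀ (k := k) (by
      rw [Nat.succ_mul] at hk; omega) h (x₀ (Fin.last n))
    -- The correction `g` lives on the quotient by `S₀`, so adding it to `φ₀` leaves the values on
    -- `S₀` unchanged. Adjoining the new values to `S₀` costs at most `d` dimensions per vector,
    -- whence the term `n * d` in the bound.
    obtain ⟨g, hg⟩ : ∃ g : (T ⧸ S₀) →ₗ[K] Y, ∀ e, g (S₀.mkQ (M e x)) =
        t (Fin.last n) e - φ₀ (M e x) := by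
      obtain ⟨g, hg⟩ := LinearMap.exists_leftInverse_of_injective
        (Fintype.linearCombination K (fun e => S₀.mkQ (M e x)))
        (LinearMap.ker_eq_bot.2 (linearIndependent_iff_injective_fintypeLinearCombination.1 hli))
      refine ⟨Fintype.linearCombination K (fun e => t (Fin.last n) e - φ₀ (M e x)) ∘ₗ g,
        fun e => ?_⟩
      have := LinearMap.congr_fun hg (Pi.single e 1)
      simp only [LinearMap.comp_apply, Fintype.linearCombination_apply_single, one_smul,
        LinearMap.id_apply] at this
      simp only [LinearMap.comp_apply, this, Fintype.linearCombination_apply_single, one_smul]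
    let S₁ : Submodule K T := Submodule.span K (Set.range fun e => M e x)
    have : FiniteDimensional K S₁ := FiniteDimensional.span_of_finite K (Set.finite_range _)
    have hS₁ : finrank K S₁ ≤ d := (finrank_range_le_card _).trans (by simp)
    have hS := Submodule.finrank_add_le_finrank_add_finrank S₀ S₁
    obtain ⟨φ, ψ, h1, h2, h3⟩ := ih (S₀ ⊔ S₁) (by rw [Nat.succ_mul] at hk; omega) h
      (φ₀ + g ∘ₗ S₀.mkQ) (Fin.init x₀) (Fin.init t)
    refine ⟨φ, Fin.snoc ψ x, fun y hy => ?_, fun j => ?_, fun j e => ?_⟩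
    · rw [h1 y (Submodule.mem_sup_left hy)]
      have : (Submodule.Quotient.mk y : T ⧸ S₀) = 0 := (Submodule.Quotient.mk_eq_zero S₀).2 hy
      simp [this]
    · refine Fin.lastCases ?_ (fun j => ?_) j
      · simpa using hLx
      · simpa [Fin.init_def] using h2 j
    · refine Fin.lastCases ?_ (fun j => ?_) j
      · have hm : M e x ∈ S₁ := Submodule.subset_span ⟨e, rfl⟩
        rw [Fin.snoc_last, h1 _ (Submodule.mem_sup_right hm)]
        have := hg e
        simp only [Submodule.mkQ_apply] at this
        simp [this]
      · simpa [Fin.init_def] using h3 j e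

end LinearAlgebraLemmas

/-! ### Polynomial functions and Zariski-closed sets in coordinate spaces. -/

section CoordClosed

variable {K : Type*} [Field K] {σ τ : Type*}

/-- The algebra of polynomial functions on a coordinate space. -/
def polyFun (K : Type*) [Field K] (σ : Type*) : Subalgebra K ((σ → K) → K) where
  carrier := {f | ∃ p : MvPolynomial σ K, ∀ x, f x = MvPolynomial.eval x p}
  mul_mem' := by
    rintro f g ⟨p, hp⟩ ⟨q, hq⟩
    exact ⟨p * q, fun x => by simp [hp, hq]⟩
  add_mem' := by
    rintro f g ⟨p, hp⟩ ⟨q, hq⟩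
    exact ⟨p + q, fun x => by simp [hp, hq]⟩
  algebraMap_mem' r := ⟨MvPolynomial.C r, fun x => by simp⟩

theorem polyFun_coord (i : σ) : (fun x : σ → K => x i) ∈ polyFun K σ :=
  ⟨MvPolynomial.X i, fun x => by simp⟩

theorem polyFun_const (c : K) : (fun _ : σ → K => c) ∈ polyFun K σ :=
  ⟨MvPolynomial.C c, fun x => by simp⟩

theorem polyFun_mul {f g : (σ → K) → K} (hf : f ∈ polyFun K σ) (hg : g ∈ polyFun K σ) :
    (fun x => f x * g x) ∈ polyFun K σ := (polyFun K σ).mul_mem hf hg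

theorem polyFun_add {f g : (σ → K) → K} (hf : f ∈ polyFun K σ) (hg : g ∈ polyFun K σ) :
    (fun x => f x + g x) ∈ polyFun K σ := (polyFun K σ).add_mem hf hg

theorem polyFun_sum {ι : Type*} (s : Finset ι) {f : ι → (σ → K) → K}
    (hf : ∀ i, f i ∈ polyFun K σ) : (fun x => ∑ i ∈ s, f i x) ∈ polyFun K σ := by
  have : (fun x => ∑ i ∈ s, f i x) = ∑ i ∈ s, f i := by ext x; simp
  rw [this]
  exact (polyFun K σ).sum_mem fun i _ => hf i

theorem polyFun_comp {F : (σ → K) → (τ → K)} (hF : ∀ i, (fun x => F x i) ∈ polyFun K σ)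
    {g : (τ → K) → K} (hg : g ∈ polyFun K τ) : (fun x => g (F x)) ∈ polyFun K σ := by
  choose p hp using hF
  obtain ⟨q, hq⟩ := hg
  refine ⟨MvPolynomial.bind₁ p q, fun x => ?_⟩
  have h := MvPolynomial.aeval_bind₁ (R := K) x p q
  simp only [MvPolynomial.aeval_eq_eval, ← hp] at h
  rw [h, ← hq]

/-- A subset of a coordinate space is closed if it is cut out by polynomial functions. -/
def CoordClosed (Z : Set (σ → K)) : Prop :=
  ∃ S : Set ((σ → K) → K), S ⊆ polyFun K σ ∧ Z = {x | ∀ f ∈ S, f x = 0}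

theorem CoordClosed.preimage {Z : Set (τ → K)} (hZ : CoordClosed Z) {F : (σ → K) → (τ → K)}
    (hF : ∀ i, (fun x => F x i) ∈ polyFun K σ) : CoordClosed (F ⁻¹' Z) := by
  obtain ⟨S, hS, rfl⟩ := hZ
  refine ⟨(fun f x => f (F x)) '' S, ?_, ?_⟩
  · rintro _ ⟨f, hf, rfl⟩
    exact polyFun_comp hF (hS hf)
  · ext x
    simp

theorem CoordClosed.iInter {ι : Sort*} {Z : ι → Set (σ → K)} (hZ : ∀ i, CoordClosed (Z i)) :
    CoordClosed (⋂ i, Z i) := by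
  choose S hS hZ using hZ
  refine ⟨⋃ i, S i, Set.iUnion_subset hS, ?_⟩
  ext x
  simp only [hZ, Set.mem_iInter, Set.mem_ofPred_eq, Set.mem_iUnion]
  exact ⟨fun h f ⟨i, hi⟩ => h i f hi, fun h i f hi => h f ⟨i, hi⟩⟩

/-- The smallest closed set containing a given set. -/
def coordClosure (Z : Set (σ → K)) : Set (σ → K) :=
  {x | ∀ f ∈ polyFun K σ, (∀ z ∈ Z, f z = 0) → f x = 0}

theorem coordClosed_coordClosure (Z : Set (σ → K)) : CoordClosed (coordClosure Z) :=
  ⟨{f | f ∈ polyFun K σ ∧ ∀ z ∈ Z, f z = 0}, fun _ hf => hf.1, by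
    ext x; simp [coordClosure]⟩

theorem coordClosure_mono {Z Z' : Set (σ → K)} (h : Z ⊆ Z') :
    coordClosure Z ⊆ coordClosure Z' :=
  fun _ hx f hf hZ => hx f hf fun z hz => hZ z (h hz)

/-- Hilbert's basis theorem: descending chains of closed sets stabilise. -/
theorem CoordClosed.chain_stabilizes [Finite σ] {Z : ℕ → Set (σ → K)}
    (hZ : ∀ i, CoordClosed (Z i)) (hanti : Antitone Z) : ∃ i₀, ∀ i ≥ i₀, Z i₀ ⊆ Z i := by
  let I : ℕ → Ideal (MvPolynomial σ K) := fun i =>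
    { carrier := {p | ∀ x ∈ Z i, MvPolynomial.eval x p = 0}
      add_mem' := fun {p q} hp hq x hx => by simp [hp x hx, hq x hx]
      zero_mem' := fun x _ => by simp
      smul_mem' := fun c p hp x hx => by simp [hp x hx] }
  have hI : Monotone I := fun i j hij p hp x hx => hp x (hanti hij hx)
  obtain ⟨i₀, h⟩ := monotone_stabilizes_iff_noetherian.2
    (inferInstance : IsNoetherianRing (MvPolynomial σ K)) ⟨I, hI⟩
  refine ⟨i₀, fun i hi x hx => ?_⟩
  obtain ⟨S, hS, hZS⟩ := hZ i
  rw [hZS]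
  intro f hf
  obtain ⟨p, hp⟩ := hS hf
  have hpI : p ∈ I i := fun y hy => by
    rw [hZS] at hy
    rw [← hp]
    exact hy f hf
  have : p ∈ I i₀ := by
    have h' : I i₀ = I i := h i hi
    rw [h']
    exact hpI
  rw [hp]
  exact this x hx

end CoordClosed

/-! ### Tuples of scalars, vectors and matrices, and their functorial closed families. -/

/-- Coordinates of tuples consisting of scalars, vectors over `A`, vectors over `B` and
`A × B`-matrices, indexed by `E₀`, `E₁`, `E₂`, `E₃` respectively. -/
inductive MIdx (E₀ E₁ E₂ E₃ A B : Type) : Type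
  | s (e : E₀)
  | u (e : E₁) (a : A)
  | w (e : E₂) (b : B)
  | m (e : E₃) (a : A) (b : B)

namespace MIdx

variable {K : Type*} [Field K] {E₀ E₁ E₂ E₃ A B A' B' A'' B'' : Type}

instance [Finite E₀] [Finite E₁] [Finite E₂] [Finite E₃] [Finite A] [Finite B] :
    Finite (MIdx E₀ E₁ E₂ E₃ A B) :=
  Finite.of_injective
    (fun i => match i with
      | s e => Sum.inl (Sum.inl e)
      | u e a => Sum.inl (Sum.inr (e, a))
      | w e b => Sum.inr (Sum.inl (e, b))
      | m e a b => Sum.inr (Sum.inr (e, a, b)) :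
      MIdx E₀ E₁ E₂ E₃ A B → (E₀ ⊕ E₁ × A) ⊕ (E₂ × B ⊕ E₃ × A × B))
    (by rintro (_ | _ | _ | _) (_ | _ | _ | _) h <;> simp_all)

/-- The action of a pair of matrices. -/
def act [Fintype A] [Fintype B] (φ : Matrix A' A K) (ψ : Matrix B' B K)
    (x : MIdx E₀ E₁ E₂ E₃ A B → K) : MIdx E₀ E₁ E₂ E₃ A' B' → K
  | s e => x (s e)
  | u e a' => ∑ a, φ a' a * x (u e a)
  | w e b' => ∑ b, ψ b' b * x (w e b)
  | m e a' b' => ∑ a, ∑ b, φ a' a * ψ b' b * x (m e a b)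

theorem act_act [Fintype A] [Fintype B] [Fintype A'] [Fintype B'] (φ : Matrix A' A K)
    (ψ : Matrix B' B K) (φ' : Matrix A'' A' K) (ψ' : Matrix B'' B' K)
    (x : MIdx E₀ E₁ E₂ E₃ A B → K) : act φ' ψ' (act φ ψ x) = act (φ' * φ) (ψ' * ψ) x := by
  ext (e | ⟨e, a⟩ | ⟨e, b⟩ | ⟨e, a, b⟩)
  · rfl
  · simp only [act, Matrix.mul_apply, Finset.mul_sum, Finset.sum_mul]
    rw [Finset.sum_comm]
    simp only [mul_assoc]
  · simp only [act, Matrix.mul_apply, Finset.mul_sum, Finset.sum_mul]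
    rw [Finset.sum_comm]
    simp only [mul_assoc]
  · simp only [act, Matrix.mul_apply, Finset.mul_sum, Finset.sum_mul]
    have e1 : ∀ a' : A', ∑ b' : B', ∑ a₁ : A, ∑ b₁ : B,
        φ' a a' * ψ' b b' * (φ a' a₁ * ψ b' b₁ * x (m e a₁ b₁)) =
        ∑ a₁ : A, ∑ b₁ : B, ∑ b' : B', φ' a a' * ψ' b b' * (φ a' a₁ * ψ b' b₁ * x (m e a₁ b₁)) := by
      intro a'
      rw [Finset.sum_comm]
      exact Finset.sum_congr rfl fun _ _ => Finset.sum_comm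
    rw [Finset.sum_congr rfl fun a' _ => e1 a', Finset.sum_comm]
    refine Finset.sum_congr rfl fun a₁ _ => ?_
    rw [Finset.sum_comm]
    refine Finset.sum_congr rfl fun b₁ _ => ?_
    rw [Finset.sum_comm]
    refine Finset.sum_congr rfl fun b' _ => Finset.sum_congr rfl fun a' _ => ?_
    ring

theorem act_one [Fintype A] [Fintype B] [DecidableEq A] [DecidableEq B]
    (x : MIdx E₀ E₁ E₂ E₃ A B → K) : act (1 : Matrix A A K) (1 : Matrix B B K) x = x := by
  ext (e | ⟨e, a⟩ | ⟨e, b⟩ | ⟨e, a, b⟩) <;> simp [act, Matrix.one_apply]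

theorem act_polyFun [Fintype A] [Fintype B] (φ : Matrix A' A K) (ψ : Matrix B' B K)
    (i : MIdx E₀ E₁ E₂ E₃ A' B') :
    (fun x : MIdx E₀ E₁ E₂ E₃ A B → K => act φ ψ x i) ∈ polyFun K _ := by
  rcases i with (e | ⟨e, a⟩ | ⟨e, b⟩ | ⟨e, a, b⟩)
  · exact polyFun_coord _
  · exact polyFun_sum _ fun a => polyFun_mul (polyFun_const _) (polyFun_coord _)
  · exact polyFun_sum _ fun a => polyFun_mul (polyFun_const _) (polyFun_coord _)
  · exact polyFun_sum _ fun a => polyFun_sum _ fun b =>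
      polyFun_mul (polyFun_const _) (polyFun_coord _)

end MIdx

/-- Functorial families of closed sets of tuples of scalars, vectors and matrices. -/
structure MatFam (K : Type*) [Field K] (E₀ E₁ E₂ E₃ : Type) where
  /-- The closed set of tuples of the given format. -/
  carrier : ∀ (A B : Type) [Fintype A] [Fintype B], Set (MIdx E₀ E₁ E₂ E₃ A B → K)
  closed : ∀ (A B : Type) [Fintype A] [Fintype B], CoordClosed (carrier A B)
  stable : ∀ (A B A' B' : Type) [Fintype A] [Fintype B] [Fintype A'] [Fintype B']
    (φ : Matrix A' A K) (ψ : Matrix B' B K), ∀ x ∈ carrier A B, MIdx.act φ ψ x ∈ carrier A' B'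

namespace MatFam

variable {K : Type*} [Field K] {E₀ E₁ E₂ E₃ : Type}

/-- The order on families by inclusion. -/
instance : Preorder (MatFam K E₀ E₁ E₂ E₃) where
  le X Y := ∀ (A B : Type) [Fintype A] [Fintype B], X.carrier A B ⊆ Y.carrier A B
  le_refl _ _ _ _ _ := subset_rfl
  le_trans _ _ _ h h' A B _ _ := (h A B).trans (h' A B)

/-- The given vectors span spaces of dimension at most `|E₁|` and `|E₂|`, so every tuple is
recovered from an image in the format `E₁`, `E₂` by matrices built from quasi-inverses. That single
finite-dimensional instance decides membership, and Hilbert's basis theorem applies to it. -/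
theorem chain_stabilizes_of_isEmpty [Fintype E₀] [Fintype E₁] [Fintype E₂] [IsEmpty E₃]
    (X : ℕ → MatFam K E₀ E₁ E₂ E₃) (hX : Antitone X) : ∃ i₀, ∀ i ≥ i₀, X i₀ ≤ X i := by
  classical
  obtain ⟨i₀, h⟩ := CoordClosed.chain_stabilizes (Z := fun i => (X i).carrier E₁ E₂)
    (fun i => (X i).closed _ _) (fun i j hij => hX hij _ _)
  refine ⟨i₀, fun i hi A B _ _ x hx => ?_⟩
  obtain ⟨r, hr⟩ := LinearMap.exists_quasiInverse
    (Fintype.linearCombination K (fun e a => x (.u e a) : E₁ → A → K))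
  obtain ⟨t, ht⟩ := LinearMap.exists_quasiInverse
    (Fintype.linearCombination K (fun e b => x (.w e b) : E₂ → B → K))
  let f := Fintype.linearCombination K (fun e a => x (.u e a) : E₁ → A → K)
  let g := Fintype.linearCombination K (fun e b => x (.w e b) : E₂ → B → K)
  have h1 := (X i).stable _ _ A B (LinearMap.toMatrix' f) (LinearMap.toMatrix' g) _
    (h i hi ((X i₀).stable _ _ E₁ E₂ (LinearMap.toMatrix' r) (LinearMap.toMatrix' t) x hx))
  rw [MIdx.act_act, ← LinearMap.toMatrix'_comp, ← LinearMap.toMatrix'_comp] at h1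
  convert h1 using 1
  ext (e | ⟨e, a⟩ | ⟨e, b⟩ | ⟨e, a, b⟩)
  · rfl
  · have := congrFun (hr (Pi.single e 1)) a
    rw [Fintype.linearCombination_apply_single, one_smul] at this
    rw [← this]
    exact (congrFun (LinearMap.toMatrix'_mulVec (f ∘ₗ r) (fun a => x (.u e a))) a).symm
  · have := congrFun (ht (Pi.single e 1)) b
    rw [Fintype.linearCombination_apply_single, one_smul] at this
    rw [← this]
    exact (congrFun (LinearMap.toMatrix'_mulVec (g ∘ₗ t) (fun b => x (.w e b))) b).symm
  · exact isEmptyElim e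

end MatFam

/-! ### Trading a matrix for vectors and scalars. -/

namespace MIdx

variable {K : Type*} [Field K] {E₀ E₁ E₂ E₃ A B A' B' : Type}

/-- Combine scalars and vectors with a tuple of matrices. -/
def join {R : Type*} (q : MIdx E₀ E₁ E₂ (Fin 0) A B → R) (M : E₃ → A → B → R) :
    MIdx E₀ E₁ E₂ E₃ A B → R
  | s e => q (s e)
  | u e a => q (u e a)
  | w e b => q (w e b)
  | m e a b => M e a b

/-- Forget the matrices. -/
def low {R : Type*} (x : MIdx E₀ E₁ E₂ E₃ A B → R) : MIdx E₀ E₁ E₂ (Fin 0) A B → R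
  | s e => x (s e)
  | u e a => x (u e a)
  | w e b => x (w e b)
  | m e _ _ => e.elim0

theorem act_join [Fintype A] [Fintype B] (φ : Matrix A' A K) (ψ : Matrix B' B K)
    (q : MIdx E₀ E₁ E₂ (Fin 0) A B → K) (M : E₃ → A → B → K) :
    act φ ψ (join q M) =
      join (act φ ψ q) (fun e a' b' => ∑ a, ∑ b, φ a' a * ψ b' b * M e a b) := by
  ext (e | ⟨e, a⟩ | ⟨e, b⟩ | ⟨e, a, b⟩) <;> rfl

theorem join_low {R : Type*} (x : MIdx E₀ E₁ E₂ E₃ A B → R) :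
    join (low x) (fun e a b => x (m e a b)) = x := by
  ext (e | ⟨e, a⟩ | ⟨e, b⟩ | ⟨e, a, b⟩) <;> rfl

theorem join_polyFun (M : E₃ → A → B → K) (i : MIdx E₀ E₁ E₂ E₃ A B) :
    (fun q : MIdx E₀ E₁ E₂ (Fin 0) A B → K => join q M i) ∈ polyFun K _ := by
  rcases i with (e | ⟨e, a⟩ | ⟨e, b⟩ | ⟨e, a, b⟩)
  · exact polyFun_coord _
  · exact polyFun_coord _
  · exact polyFun_coord _
  · exact polyFun_const _

/-- The morphism expressing each of `d + 1` matrices as a linear combination of `d` matrices and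
a matrix of rank at most `k`. -/
def lowRank (d k : ℕ)
    (y : MIdx (E₀ ⊕ Fin (d + 1) × Option (Fin d)) (E₁ ⊕ Fin k) (E₂ ⊕ Fin k) (Fin d) A B → K) :
    MIdx E₀ E₁ E₂ (Fin (d + 1)) A B → K
  | s e => y (s (Sum.inl e))
  | u e a => y (u (Sum.inl e) a)
  | w e b => y (w (Sum.inl e) b)
  | m e a b => (∑ e', y (s (Sum.inr (e, some e'))) * y (m e' a b)) +
      y (s (Sum.inr (e, none))) * ∑ r, y (u (Sum.inr r) a) * y (w (Sum.inr r) b)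

theorem lowRank_act [Fintype A] [Fintype B] {d k : ℕ} (φ : Matrix A' A K) (ψ : Matrix B' B K)
    (y : MIdx (E₀ ⊕ Fin (d + 1) × Option (Fin d)) (E₁ ⊕ Fin k) (E₂ ⊕ Fin k) (Fin d) A B → K) :
    lowRank d k (act φ ψ y) = act φ ψ (lowRank d k y) := by
  ext (e | ⟨e, a⟩ | ⟨e, b⟩ | ⟨e, a, b⟩)
  · rfl
  · rfl
  · rfl
  · simp only [lowRank, act, mul_add, Finset.sum_add_distrib, Finset.mul_sum, Finset.sum_mul]
    congr 1
    · rw [Finset.sum_comm]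
      refine Finset.sum_congr rfl fun a' _ => ?_
      rw [Finset.sum_comm]
      refine Finset.sum_congr rfl fun b' _ => Finset.sum_congr rfl fun _ _ => by ring
    · rw [Finset.sum_comm]
      have : ∀ b' : B, ∑ r : Fin k, ∑ a' : A, y (s (Sum.inr (e, none))) *
          (φ a a' * y (u (Sum.inr r) a') * (ψ b b' * y (w (Sum.inr r) b'))) =
          ∑ a' : A, ∑ r : Fin k, φ a a' * ψ b b' *
          (y (s (Sum.inr (e, none))) * (y (u (Sum.inr r) a') * y (w (Sum.inr r) b'))) := by
        intro b'
        rw [Finset.sum_comm]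
        exact Finset.sum_congr rfl fun _ _ => Finset.sum_congr rfl fun _ _ => by ring
      rw [Finset.sum_comm' (t' := Finset.univ) (s' := fun _ => Finset.univ) (by simp)]
      conv_rhs => rw [Finset.sum_comm]
      refine Eq.trans ?_ (Finset.sum_congr rfl fun b' _ => this b')
      rw [Finset.sum_comm]

theorem lowRank_polyFun {d k : ℕ} (i : MIdx E₀ E₁ E₂ (Fin (d + 1)) A B) :
    (fun y : MIdx (E₀ ⊕ Fin (d + 1) × Option (Fin d)) (E₁ ⊕ Fin k) (E₂ ⊕ Fin k) (Fin d) A B → K =>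
      lowRank d k y i) ∈ polyFun K _ := by
  rcases i with (e | ⟨e, a⟩ | ⟨e, b⟩ | ⟨e, a, b⟩)
  · exact polyFun_coord _
  · exact polyFun_coord _
  · exact polyFun_coord _
  · exact polyFun_add (polyFun_sum _ fun _ => polyFun_mul (polyFun_coord _) (polyFun_coord _))
      (polyFun_mul (polyFun_coord _)
        (polyFun_sum _ fun _ => polyFun_mul (polyFun_coord _) (polyFun_coord _)))

/-- The combination with coefficients `c` has its columns in `S`, hence factors through `k` vectors.
Solving for a matrix whose coefficient is nonzero writes it through the remaining `d` matrices and
this factorisation. -/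
theorem exists_lowRank [Fintype B] {d k : ℕ} (x : MIdx E₀ E₁ E₂ (Fin (d + 1)) A B → K)
    {c : Fin (d + 1) → K} (hc : c ≠ 0) (S : Submodule K (A → K)) [FiniteDimensional K S]
    (hS : finrank K S ≤ k)
    (h : ∀ v : B → K, (fun a => ∑ e, c e * ∑ b, x (m e a b) * v b) ∈ S) :
    ∃ y, lowRank d k y = x := by
  classical
  obtain ⟨e₀, he₀⟩ : ∃ e, c e ≠ 0 := by
    by_contra! h0
    exact hc (funext h0)
  -- A basis of `S`, padded by zeros because its dimension may be smaller than `k`.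
  let p : Fin k → A → K := fun r =>
    if hr : (r : ℕ) < finrank K S then (finBasis K S ⟨r, hr⟩ : A → K) else 0
  have hp : S ≤ Submodule.span K (Set.range p) := by
    intro v hv
    have h1 := (finBasis K S).sum_repr ⟨v, hv⟩
    have h2 : v = ∑ i, (finBasis K S).repr ⟨v, hv⟩ i • (finBasis K S i : A → K) := by
      have := congrArg S.subtype h1
      rw [map_sum] at this
      exact this.symm
    rw [h2]
    refine Submodule.sum_mem _ fun i _ => Submodule.smul_mem _ _ (Submodule.subset_span ?_)
    exact ⟨⟨i, i.2.trans_le hS⟩, by simp [p]⟩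
  have hq : ∀ b : B, ∃ q : Fin k → K, ∀ a, ∑ r, q r * p r a = ∑ e, c e * x (m e a b) := by
    intro b
    obtain ⟨q, hq⟩ := (Submodule.mem_span_range_iff_exists_fun K).1 (hp (h (Pi.single b 1)))
    refine ⟨q, fun a => ?_⟩
    have := congrFun hq a
    simpa [Pi.single_apply] using this
  choose q hq using hq
  refine ⟨fun
    | s (Sum.inl e) => x (s e)
    | s (Sum.inr (e, some e')) => if e = e₀ then - (c e₀)⁻¹ * c (e₀.succAbove e')
        else if e = e₀.succAbove e' then 1 else 0
    | s (Sum.inr (e, none)) => if e = e₀ then (c e₀)⁻¹ else 0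
    | u (Sum.inl e) a => x (u e a)
    | u (Sum.inr r) a => p r a
    | w (Sum.inl e) b => x (w e b)
    | w (Sum.inr r) b => q b r
    | m e' a b => x (m (e₀.succAbove e') a b), ?_⟩
  ext (e | ⟨e, a⟩ | ⟨e, b⟩ | ⟨e, a, b⟩)
  · rfl
  · rfl
  · rfl
  · simp only [lowRank]
    refine Fin.succAboveCases e₀ ?_ (fun e' => ?_) e
    · have h1 := hq b a
      rw [Fin.sum_univ_succAbove _ e₀] at h1
      have h2 : ∑ r, p r a * q b r = c e₀ * x (m e₀ a b) +
          ∑ i, c (e₀.succAbove i) * x (m (e₀.succAbove i) a b) := by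
        rw [← h1]; exact Finset.sum_congr rfl fun _ _ => mul_comm _ _
      simp only [if_true, h2, mul_assoc]
      rw [← Finset.mul_sum, mul_add, ← mul_assoc _ (c e₀), inv_mul_cancel₀ he₀]
      ring
    · simp [Fin.succAbove_ne]

end MIdx

/-! ### The descending chain condition for tuples of matrices. -/

namespace MatFam

open MIdx

variable {K : Type*} [Field K] {E₀ E₁ E₂ E₃ : Type}

/-- The scalars and vectors all of whose images over `Fin l` can be combined with arbitrary
matrices. -/
def fullFibre (X : MatFam K E₀ E₁ E₂ E₃) (l : ℕ) : MatFam K E₀ E₁ E₂ (Fin 0) where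
  carrier A B _ _ := {q | ∀ (φ : Matrix (Fin l) A K) (ψ : Matrix (Fin l) B K)
    (M : E₃ → Fin l → Fin l → K), join (act φ ψ q) M ∈ X.carrier (Fin l) (Fin l)}
  closed A B _ _ := by
    have : {q | ∀ (φ : Matrix (Fin l) A K) (ψ : Matrix (Fin l) B K)
        (M : E₃ → Fin l → Fin l → K), join (act φ ψ q) M ∈ X.carrier (Fin l) (Fin l)} =
        ⋂ (φ : Matrix (Fin l) A K) (ψ : Matrix (Fin l) B K) (M : E₃ → Fin l → Fin l → K),
          (fun q => join (act φ ψ q) M) ⁻¹' X.carrier (Fin l) (Fin l) := by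
      ext q; simp
    rw [this]
    exact CoordClosed.iInter fun φ => CoordClosed.iInter fun ψ => CoordClosed.iInter fun M =>
      (X.closed _ _).preimage fun i => polyFun_comp (act_polyFun φ ψ) (join_polyFun M i)
  stable A B A' B' _ _ _ _ φ ψ q hq φ' ψ' M := by
    rw [act_act]
    exact hq _ _ _

/-- The preimage of a family under `lowRank`. -/
def lowRankPreimage {d : ℕ} (X : MatFam K E₀ E₁ E₂ (Fin (d + 1))) (k : ℕ) :
    MatFam K (E₀ ⊕ Fin (d + 1) × Option (Fin d)) (E₁ ⊕ Fin k) (E₂ ⊕ Fin k) (Fin d) where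
  carrier A B _ _ := lowRank d k ⁻¹' X.carrier A B
  closed A B _ _ := (X.closed A B).preimage lowRank_polyFun
  stable A B A' B' _ _ _ _ φ ψ y hy := by
    rw [Set.mem_preimage, lowRank_act]
    exact X.stable _ _ _ _ φ ψ _ hy

theorem exists_retraction {A : Type} [Fintype A] [DecidableEq A] {l : ℕ}
    (h : Fintype.card A ≤ l) :
    ∃ (i : Matrix (Fin l) A K) (p : Matrix A (Fin l) K), p * i = 1 := by
  obtain ⟨f⟩ : Nonempty (A ↪ Fin l) :=
    Function.Embedding.nonempty_of_card_le (by simpa using h)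
  refine ⟨Matrix.of fun i a => if i = f a then 1 else 0,
    Matrix.of fun a i => if i = f a then 1 else 0, ?_⟩
  ext a b
  simp [Matrix.mul_apply, Matrix.one_apply, eq_comm]

/-- The format `A × B` is a retract of `Fin l × Fin l`, where the fibre over the image of the
scalars and vectors contains all matrices. -/
theorem mem_of_low_mem_fullFibre (X : MatFam K E₀ E₁ E₂ E₃) {l : ℕ} {A B : Type} [Fintype A]
    [Fintype B] (hA : Fintype.card A ≤ l) (hB : Fintype.card B ≤ l)
    (x : MIdx E₀ E₁ E₂ E₃ A B → K) (hx : low x ∈ (X.fullFibre l).carrier A B) :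
    x ∈ X.carrier A B := by
  classical
  obtain ⟨i, p, hip⟩ := exists_retraction (K := K) hA
  obtain ⟨j, r, hjr⟩ := exists_retraction (K := K) hB
  have h1 : act i j x ∈ X.carrier (Fin l) (Fin l) := by
    rw [← join_low x, act_join]
    exact hx _ _ _
  have h2 := X.stable _ _ A B p r _ h1
  rwa [act_act, hip, hjr, act_one] at h2

theorem fullFibre_anti (X : MatFam K E₀ E₁ E₂ E₃) {l l' : ℕ} (hl : l ≤ l') :
    X.fullFibre l' ≤ X.fullFibre l := by
  classical
  intro A B _ _ q hq φ ψ M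
  obtain ⟨i, p, hip⟩ := exists_retraction (K := K) (A := Fin l) (l := l') (by simpa using hl)
  have h1 : act i i (join (act φ ψ q) M) ∈ X.carrier (Fin l') (Fin l') := by
    rw [act_join, act_act]
    exact hq _ _ _
  have h2 := X.stable _ _ (Fin l) (Fin l) p p _ h1
  rwa [act_act, hip, act_one] at h2

/-- Without combinations of small rank, some pair of matrices acts on the vectors exactly as `φ` and
`ψ` do, yet sends the matrices of `x` to the arbitrary tuple `M`. In the bound on `k`, `|E₁|` pays
for the span on which the row action is prescribed, `l * d` for the `l` rows of `ψ'` chosen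
successively, and `|E₂|` for the linear conditions on each of them. -/
theorem low_mem_fullFibre_of_rank [Infinite K] [Fintype E₁] [Fintype E₂] {d : ℕ}
    (X : MatFam K E₀ E₁ E₂ (Fin d)) {l k : ℕ}
    (hk : Fintype.card E₁ + l * d + d + Fintype.card E₂ ≤ k) {A B : Type} [Fintype A] [Fintype B]
    (x : MIdx E₀ E₁ E₂ (Fin d) A B → K) (hx : x ∈ X.carrier A B)
    (h : ∀ c : Fin d → K, c ≠ 0 → ∀ S : Submodule K (A → K), FiniteDimensional K S →
      finrank K S ≤ k → ∃ v : B → K, (fun a => ∑ e, c e * ∑ b, x (m e a b) * v b) ∉ S) :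
    low x ∈ (X.fullFibre l).carrier A B := by
  classical
  intro φ ψ M
  let S₀ : Submodule K (A → K) := Submodule.span K (Set.range fun e a => x (u e a))
  have hS₀ : finrank K S₀ ≤ Fintype.card E₁ := finrank_range_le_card _
  obtain ⟨φ', ψ', h1, h2, h3⟩ := exists_specialization
    (fun e => Matrix.mulVecLin (Matrix.of fun a b => x (m e a b)))
    (Matrix.mulVecLin (Matrix.of fun e b => x (w e b))) l (k := k) S₀ (by omega)
    (by
      intro c hc S hS hSk
      obtain ⟨v, hv⟩ := h c hc S hS hSk
      refine ⟨v, fun hv' => hv ?_⟩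
      convert hv' using 1
      ext a
      simp [Matrix.mulVec, dotProduct]) (Matrix.mulVecLin φ) (fun j => ψ j)
      (fun j e i => M e i j)
  have : join (act φ ψ (low x)) M = act (LinearMap.toMatrix' φ') (Matrix.of ψ') x := by
    ext (e | ⟨e, i⟩ | ⟨e, j⟩ | ⟨e, i, j⟩)
    · rfl
    · have := congrFun (h1 _ (Submodule.subset_span ⟨e, rfl⟩)) i
      have h' := congrFun (LinearMap.toMatrix'_mulVec φ' (fun a => x (u e a))) i
      exact (h'.trans this).symm
    · have := congrFun (h2 j) e
      simp only [Matrix.mulVecLin_apply, Matrix.mulVec, dotProduct, Matrix.of_apply] at this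
      simp only [join, act, low, Matrix.of_apply, mul_comm _ (x _)]
      exact this.symm
    · have := congrFun (h3 j e) i
      rw [← LinearMap.toMatrix'_mulVec] at this
      simp only [Matrix.mulVecLin_apply, Matrix.mulVec, dotProduct, Matrix.of_apply] at this
      simp only [join, act, Matrix.of_apply]
      rw [← this]
      exact Finset.sum_congr rfl fun a _ => by
        rw [Finset.mul_sum]
        exact Finset.sum_congr rfl fun b _ => by ring
  rw [this]
  exact X.stable _ _ _ _ _ _ _ hx

/-- Descending chains of functorial closed families of tuples of matrices stabilise. -/
theorem chain_stabilizes [Infinite K] (d : ℕ) : ∀ (E₀ E₁ E₂ : Type) [Fintype E₀] [Fintype E₁]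
    [Fintype E₂] (X : ℕ → MatFam K E₀ E₁ E₂ (Fin d)), Antitone X → ∃ i₀, ∀ i ≥ i₀, X i₀ ≤ X i := by
  induction d with
  | zero => intro E₀ E₁ E₂ _ _ _ X hX; exact chain_stabilizes_of_isEmpty X hX
  | succ d ih =>
    intro E₀ E₁ E₂ _ _ _ X hX
    have hmono : ∀ l, Antitone fun i => (X i).fullFibre l :=
      fun l i j hij A B _ _ q hq φ ψ M => hX hij _ _ (hq φ ψ M)
    -- The full fibres decrease both in the family and in the level, so the diagonal sequence is a
    -- chain without matrices.
    obtain ⟨i₀, h₀⟩ := chain_stabilizes_of_isEmpty (fun i => (X i).fullFibre i)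
      (fun i j hij => (hmono j hij).trans ((X i).fullFibre_anti hij))
    let k := Fintype.card E₁ + i₀ * (d + 1) + (d + 1) + Fintype.card E₂
    obtain ⟨i₁, h₁⟩ := ih _ _ _ (fun i => (X i).lowRankPreimage k)
      (fun i j hij A B _ _ y hy => hX hij A B hy)
    refine ⟨max i₀ i₁, fun i hi A B _ _ x hx => ?_⟩
    -- In the first case stability carries the full fibre to a level `j` above `i`, `|A|` and `|B|`,
    -- where it forces membership. In the second a combination of rank at most `k` exists, and the
    -- induction hypothesis for one matrix fewer applies to a preimage under `lowRank`.
    by_cases hq : low x ∈ ((X i₀).fullFibre i₀).carrier A B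
    · let j := max (max i₀ i) (max (Fintype.card A) (Fintype.card B))
      have hij : i ≤ j := (le_max_right _ _).trans (le_max_left _ _)
      have h2 := h₀ j ((le_max_left _ _).trans (le_max_left _ _)) A B hq
      exact mem_of_low_mem_fullFibre (X i)
        ((le_max_left _ _).trans (le_max_right _ _) : Fintype.card A ≤ j)
        ((le_max_right _ _).trans (le_max_right _ _)) x (hmono j hij A B h2)
    · have h2 : ∃ c : Fin (d + 1) → K, c ≠ 0 ∧ ∃ S : Submodule K (A → K),
          FiniteDimensional K S ∧ finrank K S ≤ k ∧
          ∀ v : B → K, (fun a => ∑ e, c e * ∑ b, x (m e a b) * v b) ∈ S := by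
        by_contra! h2
        exact hq (low_mem_fullFibre_of_rank (X i₀) le_rfl x (hX (le_max_left _ _) A B hx) h2)
      obtain ⟨c, hc, S, hS, hSk, hcS⟩ := h2
      obtain ⟨y, rfl⟩ := exists_lowRank (k := k) x hc S hSk hcS
      exact h₁ i ((le_max_right _ _).trans hi) A B (hX (le_max_right _ _) A B hx)

end MatFam

/-! ### Alternating forms and Hodge duality in coordinates. -/

/-- Alternating forms on a coordinate space, with arguments indexed by `P`. -/
abbrev Form (K : Type*) [Field K] (ι P : Type) : Type _ := (ι → K) [⋀^P]→ₗ[K] K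

namespace Form

variable {K : Type*} [Field K] {ι ι' P P' N N' κ : Type}

/-- The standard basis vectors of a coordinate space. -/
noncomputable def unit (K : Type*) [Field K] {ι : Type} (i : ι) : ι → K :=
  open Classical in Pi.single i 1

theorem unit_apply [DecidableEq ι] (i j : ι) : unit K i j = if j = i then 1 else 0 := by
  classical
  simp only [unit, Pi.single_apply]
  congr

@[simp] theorem unit_self (i : ι) : unit K i i = 1 := by
  classical
  simp [unit_apply]

theorem unit_of_ne {i j : ι} (h : j ≠ i) : unit K i j = 0 := by
  classical
  simp [unit_apply, h]

@[simp] theorem unit_dotProduct [Fintype ι] (i : ι) (v : ι → K) : unit K i ⬝ᵥ v = v i := by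
  classical
  simp [dotProduct, unit_apply]

theorem sum_smul_unit [Fintype ι] (v : ι → K) : ∑ i, v i • unit K i = v := by
  classical
  ext j
  simp [unit_apply]

theorem linearMap_apply [Fintype ι] {V : Type*} [AddCommGroup V] [Module K V]
    (f : (ι → K) →ₗ[K] V) (v : ι → K) : f v = ∑ i, v i • f (unit K i) := by
  conv_lhs => rw [← sum_smul_unit v, map_sum]
  simp

/-- The coordinates of a form. -/
noncomputable def coord (x : Form K ι P) (s : P → ι) : K := x fun p => unit K (s p)

theorem apply_eq_sum [Fintype ι] [Fintype P] [DecidableEq P] (x : Form K ι P) (v : P → ι → K) :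
    x v = ∑ s : P → ι, (∏ p, v p (s p)) * x.coord s := by
  have h : v = fun p => ∑ i, v p i • unit K i := by
    ext1 p
    rw [sum_smul_unit]
  conv_lhs => rw [h]
  have h2 := x.toMultilinearMap.map_sum (fun p i => v p i • unit K i)
  rw [AlternatingMap.coe_multilinearMap] at h2
  rw [h2]
  refine Finset.sum_congr rfl fun s _ => ?_
  have h3 := x.toMultilinearMap.map_smul_univ (fun p => v p (s p)) (fun p => unit K (s p))
  rw [AlternatingMap.coe_multilinearMap] at h3
  rw [h3, smul_eq_mul]
  rfl

/-- If the coordinates of the arguments belong to an algebra of functions, then so does the value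
of a form. -/
theorem apply_mem [Finite ι] [Finite P] {T : Type*} (S : Subalgebra K (T → K)) (x : Form K ι P)
    {v : T → P → ι → K} (hv : ∀ p i, (fun t => v t p i) ∈ S) : (fun t => x (v t)) ∈ S := by
  classical
  have := Fintype.ofFinite ι
  have := Fintype.ofFinite P
  have h : (fun t => x (v t)) =
      ∑ s : P → ι, (∏ p, fun t => v t p (s p)) * algebraMap K (T → K) (x.coord s) := by
    ext t
    rw [apply_eq_sum]
    simp
  rw [h]
  exact S.sum_mem fun s _ => S.mul_mem (S.prod_mem fun p _ => hv p (s p)) (S.algebraMap_mem _)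

theorem ext_coord [Finite ι] {x x' : Form K ι P} [Finite P]
    (h : ∀ s : P → ι, Function.Injective s → x.coord s = x'.coord s) : x = x' := by
  classical
  refine (Pi.basisFun K ι).ext_alternating fun s hs => ?_
  have : (fun i => (Pi.basisFun K ι) (s i)) = fun p => unit K (s p) := by
    ext p j
    simp [unit_apply, Pi.single_apply]
  rw [this]
  exact h s hs

/-- Evaluate some of the arguments of a form. -/
def fix (x : Form K ι (P ⊕ κ)) (w : κ → ι → K) : Form K ι P where
  toFun v := x (Sum.elim v w)
  map_update_add' v i a b := by
    classical
    simp only [← Sum.update_elim_inl]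
    convert x.map_update_add (Sum.elim v w) (Sum.inl i) a b
  map_update_smul' v i c a := by
    classical
    simp only [← Sum.update_elim_inl]
    convert x.map_update_smul (Sum.elim v w) (Sum.inl i) c a
  map_eq_zero_of_eq' v i j h hij :=
    x.map_eq_zero_of_eq (i := Sum.inl i) (j := Sum.inl j) _ (by simpa using h) (by simpa using hij)

@[simp] theorem fix_apply (x : Form K ι (P ⊕ κ)) (w : κ → ι → K) (v : P → ι → K) :
    x.fix w v = x (Sum.elim v w) := rfl

/-- Two families of vectors that are dual bases with respect to the dot product. -/
def DualBases [Fintype ι] (G G' : κ → ι → K) : Prop :=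
  (∀ i, G i ⬝ᵥ G' i = 1) ∧ ∀ i j, i ≠ j → G i ⬝ᵥ G' j = 0

theorem dualBases_unit [Fintype ι] (e : κ ≃ ι) :
    DualBases (fun i => unit K (e i)) (fun i => unit K (e i)) :=
  ⟨fun i => by simp, fun i j hij => by
    rw [unit_dotProduct]; exact unit_of_ne (fun h => hij (e.injective h))⟩

theorem DualBases.symm [Fintype ι] {G G' : κ → ι → K} (h : DualBases G G') : DualBases G' G :=
  ⟨fun i => by rw [dotProduct_comm]; exact h.1 i, fun i j hij => by
    rw [dotProduct_comm]; exact h.2 j i hij.symm⟩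

theorem DualBases.comp [Fintype ι] {G G' : κ → ι → K} (h : DualBases G G') {κ' : Type}
    (e : κ' ≃ κ) : DualBases (G ∘ e) (G' ∘ e) :=
  ⟨fun _ => h.1 _, fun _ _ hij => h.2 _ _ fun h' => hij (e.injective h')⟩

/-- The determinant, as a form with arguments indexed by a type equivalent to `ι`. -/
noncomputable def vol (e : κ ≃ ι) [Fintype ι] : Form K ι κ :=
  open Classical in (Matrix.detRowAlternating (n := ι) (R := K)).domDomCongr e.symm

theorem vol_apply [Fintype ι] [DecidableEq ι] (e : κ ≃ ι) (v : κ → ι → K) :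
    vol e v = (Matrix.of fun i j => v (e.symm i) j).det := by
  unfold vol
  rw [Subsingleton.elim (fun a b => Classical.propDecidable (a = b)) ‹DecidableEq ι›]
  rfl

theorem vol_unit [Fintype ι] (e : κ ≃ ι) : vol e (fun i => unit K (e i)) = 1 := by
  classical
  rw [vol_apply]
  have : (Matrix.of fun i j : ι => unit K (e (e.symm i)) j) = 1 := by
    ext i j
    simp [unit_apply, Matrix.one_apply, eq_comm]
  rw [this, Matrix.det_one]

/-- The product of the first matrix with the transpose of the second is the identity. -/
theorem vol_mul_vol [Fintype ι] (e : κ ≃ ι) {G G' : κ → ι → K} (h : DualBases G G') :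
    vol e G * vol e G' = 1 := by
  classical
  rw [vol_apply, vol_apply, ← Matrix.det_transpose (Matrix.of fun i j => G' (e.symm i) j),
    ← Matrix.det_mul]
  have : (Matrix.of fun i j => G (e.symm i) j) *
      (Matrix.of fun i j => G' (e.symm i) j).transpose = 1 := by
    ext i j
    rw [Matrix.mul_apply]
    change G (e.symm i) ⬝ᵥ G' (e.symm j) = _
    rw [Matrix.one_apply]
    split_ifs with hij
    · rw [hij]; exact h.1 _
    · exact h.2 _ _ fun h' => hij (e.symm.injective h')
  rw [this, Matrix.det_one]

theorem eq_smul_vol [Fintype ι] (e : κ ≃ ι) (d : Form K ι κ) :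
    d = d (fun i => unit K (e i)) • vol e := by
  classical
  have : Finite κ := Finite.of_equiv _ e.symm
  have := Fintype.ofFinite κ
  refine ext_coord fun s hs => ?_
  let σ : Equiv.Perm κ := Equiv.ofBijective (e.symm ∘ s)
    ((Finite.injective_iff_bijective).1 (e.symm.injective.comp hs))
  have h : ∀ f : Form K ι κ, f.coord s = Equiv.Perm.sign σ • f (fun i => unit K (e i)) := by
    intro f
    rw [← f.map_perm]
    have : (fun i => unit K (e i)) ∘ σ = fun p => unit K (s p) := by
      ext1 p
      simp [σ]
    rw [this]
    rfl
  rw [h d, h]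
  simp [vol_unit, mul_comm]

theorem apply_unit_ne_zero [Fintype ι] (e : κ ≃ ι) {d : Form K ι κ} (hd : d ≠ 0) :
    d (fun i => unit K (e i)) ≠ 0 := fun h => hd (by rw [eq_smul_vol e d, h, zero_smul])

/-- `y` is the Hodge dual of `x` with respect to the volume form `d`. -/
def IsStar [Fintype ι] (d : Form K ι (P ⊕ N)) (x : Form K ι P) (y : Form K ι N) : Prop :=
  ∀ G G' : P ⊕ N → ι → K, DualBases G G' → y (G ∘ Sum.inr) = d G * x (G' ∘ Sum.inl)

/-- Extend an injection to an equivalence. -/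
theorem exists_equiv_extend [Finite P] [Finite N] [Finite ι] (e : P ⊕ N ≃ ι) (s : N → ι)
    (hs : Function.Injective s) : ∃ e' : P ⊕ N ≃ ι, ∀ j, e' (Sum.inr j) = s j := by
  classical
  have := Fintype.ofFinite P
  have := Fintype.ofFinite N
  have := Fintype.ofFinite ι
  have hc : Fintype.card (P ⊕ N) = (Finset.univ : Finset ι).card := by
    rw [Fintype.card_congr e]; rfl
  obtain ⟨g, hg⟩ := Set.MapsTo.exists_equiv_extend_of_card_eq hc
    (s := Set.range (Sum.inr : N → P ⊕ N)) (f := Sum.elim (fun p => e (Sum.inl p)) s)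
    (fun _ _ => by simp)
    (by
      rintro _ ⟨i, rfl⟩ _ ⟨j, rfl⟩ h
      exact congrArg _ (hs h))
  refine ⟨g.trans ((Equiv.subtypeUnivEquiv (by simp))), fun j => ?_⟩
  simpa using hg (Sum.inr j) ⟨j, rfl⟩

theorem IsStar.unique [Fintype ι] [Finite P] [Finite N] (e : P ⊕ N ≃ ι) {d : Form K ι (P ⊕ N)}
    {x : Form K ι P} {y y' : Form K ι N} (h : IsStar d x y) (h' : IsStar d x y') : y = y' := by
  refine ext_coord fun s hs => ?_
  obtain ⟨e', he'⟩ := exists_equiv_extend e s hs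
  have h1 := h _ _ (dualBases_unit e')
  have h2 := h' _ _ (dualBases_unit e')
  have : (fun i => unit K (e' i)) ∘ Sum.inr = fun p => unit K (s p) := by
    ext1 p
    simp [he']
  rw [this] at h1 h2
  exact h1.trans h2.symm

theorem IsStar.smul [Fintype ι] {d : Form K ι (P ⊕ N)} {x : Form K ι P} {y : Form K ι N}
    (h : IsStar d x y) (c : K) : IsStar (c • d) x (c • y) := fun G G' hG => by
  rw [AlternatingMap.smul_apply, AlternatingMap.smul_apply, h G G' hG, smul_eq_mul, smul_eq_mul,
    mul_assoc]

/-- Hodge duals of the same form are proportional. -/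
theorem IsStar.proportional [Fintype ι] [Finite P] [Finite N] (e : P ⊕ N ≃ ι)
    {d d' : Form K ι (P ⊕ N)} {x : Form K ι P} {y y' : Form K ι N} (h : IsStar d x y)
    (hd : d ≠ 0) (h' : IsStar d' x y') : ∃ c : K, (d' ≠ 0 → c ≠ 0) ∧ d' = c • d ∧ y' = c • y := by
  have h0 := apply_unit_ne_zero e hd
  have hdd : d' = (d' (fun i => unit K (e i)) / d (fun i => unit K (e i))) • d := by
    conv_lhs => rw [eq_smul_vol e d']
    conv_rhs => rw [eq_smul_vol e d]
    rw [smul_smul, AlternatingMap.smul_apply, vol_unit, smul_eq_mul, mul_one, div_mul_cancel₀ _ h0]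
  refine ⟨_, fun hd' => div_ne_zero (apply_unit_ne_zero e hd') h0, hdd, ?_⟩
  refine IsStar.unique e h' ?_
  have := h.smul (d' (fun i => unit K (e i)) / d (fun i => unit K (e i)))
  rwa [← hdd] at this

/-- Exchanging the two dual bases inverts the volume factor, by `vol_mul_vol`. Hence duality is
invertible, with the reciprocal constant in the new volume form. -/
theorem IsStar.exists_swap [Fintype ι] [Finite P] [Finite N] (e : P ⊕ N ≃ ι)
    {d : Form K ι (P ⊕ N)} (hd : d ≠ 0) {x : Form K ι P} {y : Form K ι N} (h : IsStar d x y) :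
    ∃ d' : Form K ι (N ⊕ P), d' ≠ 0 ∧ IsStar d' y x := by
  have h0 := apply_unit_ne_zero e hd
  let d' : Form K ι (N ⊕ P) := ((d (fun i => unit K (e i)))⁻¹ • vol e).domDomCongr
    (Equiv.sumComm P N)
  have hd' : ∀ G, d' G = (d (fun i => unit K (e i)))⁻¹ * vol e (G ∘ Equiv.sumComm P N) :=
    fun G => rfl
  refine ⟨d', fun hz => ?_, fun G G' hG => ?_⟩
  · have h1 := hd' ((fun i => unit K (e i)) ∘ Equiv.sumComm N P)
    have h2 : ((fun i => unit K (e i)) ∘ Equiv.sumComm N P) ∘ Equiv.sumComm P N =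
      fun i => unit K (e i) := by ext i; simp
    rw [h2, vol_unit, hz, AlternatingMap.zero_apply, mul_one] at h1
    exact inv_ne_zero h0 h1.symm
  · have h1 := h _ _ (hG.symm.comp (Equiv.sumComm P N))
    have e1 : (G' ∘ Equiv.sumComm P N) ∘ Sum.inr = G' ∘ Sum.inl := by ext i; simp
    have e2 : (G ∘ Equiv.sumComm P N) ∘ Sum.inl = G ∘ Sum.inr := by ext i; simp
    rw [e1, e2, eq_smul_vol e d, AlternatingMap.smul_apply, smul_eq_mul] at h1
    have h3 := vol_mul_vol e (hG.comp (Equiv.sumComm P N))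
    rw [hd', h1]
    generalize d (fun i => unit K (e i)) = c at *
    generalize vol e (G ∘ Equiv.sumComm P N) = a at *
    generalize vol e (G' ∘ Equiv.sumComm P N) = b at *
    calc x (G ∘ Sum.inr) = c⁻¹ * c * (a * b) * x (G ∘ Sum.inr) := by
          rw [inv_mul_cancel₀ h0, h3]; ring
      _ = _ := by ring

/-- A contragredient pair carries dual families to dual families, and `IsStar` quantifies over all
of these; so `x` is substituted by one map and `y` by the other. -/
theorem IsStar.comp [Fintype ι] [Fintype ι'] {d : Form K ι (P ⊕ N)} {x : Form K ι P}
    {y : Form K ι N} (h : IsStar d x y) (f f' : (ι' → K) →ₗ[K] (ι → K))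
    (hf : ∀ v w, f v ⬝ᵥ f' w = v ⬝ᵥ w) :
    IsStar (d.compLinearMap f) (x.compLinearMap f') (y.compLinearMap f) := fun G G' hG =>
  h (fun i => f (G i)) (fun i => f' (G' i))
    ⟨fun i => by rw [hf]; exact hG.1 i, fun i j hij => by rw [hf]; exact hG.2 i j hij⟩

theorem IsStar.reindex [Fintype ι] {d : Form K ι (P ⊕ N)} {x : Form K ι P}
    {y : Form K ι N} (h : IsStar d x y) (e : P ≃ P') (e' : N ≃ N') :
    IsStar (d.domDomCongr (Equiv.sumCongr e e')) (x.domDomCongr e) (y.domDomCongr e') :=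
  fun _ _ hG => h _ _ (hG.comp (Equiv.sumCongr e e'))

/-- Extension of vectors by zero. -/
def extend (K : Type*) [Field K] (ι κ : Type) : (ι → K) →ₗ[K] (ι ⊕ κ → K) where
  toFun v := Sum.elim v 0
  map_add' v w := by ext (i | i) <;> simp
  map_smul' c v := by ext (i | i) <;> simp

/-- Restriction of vectors. -/
def restrict (K : Type*) [Field K] (ι κ : Type) : (ι ⊕ κ → K) →ₗ[K] (ι → K) :=
  LinearMap.funLeft K K Sum.inl

@[simp] theorem extend_inl (v : ι → K) (i : ι) : extend K ι κ v (Sum.inl i) = v i := rfl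
@[simp] theorem extend_inr (v : ι → K) (i : κ) : extend K ι κ v (Sum.inr i) = 0 := rfl
@[simp] theorem restrict_apply (v : ι ⊕ κ → K) (i : ι) : restrict K ι κ v i = v (Sum.inl i) := rfl
@[simp] theorem restrict_extend (v : ι → K) : restrict K ι κ (extend K ι κ v) = v := rfl

theorem extend_dotProduct [Fintype ι] [Fintype κ] (v : ι → K) (w : ι ⊕ κ → K) :
    extend K ι κ v ⬝ᵥ w = v ⬝ᵥ restrict K ι κ w := by
  simp [dotProduct]

theorem extend_unit (i : ι) : extend K ι κ (unit K i) = unit K (Sum.inl i) := by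
  classical
  ext (j | j) <;> simp [unit_apply]

/-- The Hodge dual of the restriction of a form to a coordinate subspace. -/
theorem IsStar.comp_extend [Fintype ι] [Fintype κ] {d : Form K (ι ⊕ κ) (P ⊕ (N ⊕ κ))}
    {x : Form K (ι ⊕ κ) P} {y : Form K (ι ⊕ κ) (N ⊕ κ)} (h : IsStar d x y) :
    IsStar ((Form.fix (d.domDomCongr (Equiv.sumAssoc P N κ).symm)
        fun k => unit K (Sum.inr k)).compLinearMap (extend K ι κ))
      (x.compLinearMap (extend K ι κ))
      ((Form.fix y fun k => unit K (Sum.inr k)).compLinearMap (extend K ι κ)) := by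
  intro G G' hG
  -- Dual bases of the subspace are completed by the same unit vectors on both sides.
  let H : P ⊕ (N ⊕ κ) → ι ⊕ κ → K := Sum.elim (fun p => Form.extend K ι κ (G (Sum.inl p)))
    (Sum.elim (fun n => Form.extend K ι κ (G (Sum.inr n))) fun k => unit K (Sum.inr k))
  let H' : P ⊕ (N ⊕ κ) → ι ⊕ κ → K := Sum.elim (fun p => Form.extend K ι κ (G' (Sum.inl p)))
    (Sum.elim (fun n => Form.extend K ι κ (G' (Sum.inr n))) fun k => unit K (Sum.inr k))
  have hH : DualBases H H' := by
    constructor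
    · rintro (p | n | k)
      · simpa [H, H', extend_dotProduct] using hG.1 (Sum.inl p)
      · simpa [H, H', extend_dotProduct] using hG.1 (Sum.inr n)
      · simp [H, H']
    · rintro (p | n | k) (p' | n' | k') hne
      · simpa [H, H', extend_dotProduct] using hG.2 (Sum.inl p) (Sum.inl p') (by simpa using hne)
      · simpa [H, H', extend_dotProduct] using hG.2 (Sum.inl p) (Sum.inr n') (by simp)
      · simp [H, H', dotProduct_comm _ (unit K _)]
      · simpa [H, H', extend_dotProduct] using hG.2 (Sum.inr n) (Sum.inl p') (by simp)
      · simpa [H, H', extend_dotProduct] using hG.2 (Sum.inr n) (Sum.inr n') (by simpa using hne)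
      · simp [H, H', dotProduct_comm _ (unit K _)]
      · simp [H, H']
      · simp [H, H']
      · simp only [H, H', Sum.elim_inr, unit_dotProduct]
        exact unit_of_ne fun h => hne (by rw [Sum.inr.injEq] at h; rw [h])
  have := h H H' hH
  convert this using 2
  · simp only [AlternatingMap.compLinearMap_apply, fix_apply]
    refine congrArg _ ?_
    ext1 i
    rcases i with n | k <;> rfl
  · simp only [AlternatingMap.compLinearMap_apply, fix_apply, AlternatingMap.domDomCongr_apply]
    refine congrArg _ ?_
    ext1 i
    rcases i with p | n | k <;> rfl
  · rfl

/-- The Hodge dual of a form inflated along the projection from a larger coordinate space. -/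
theorem IsStar.of_restrict [Fintype ι] {d : Form K (ι ⊕ Unit) (P ⊕ (N ⊕ Unit))}
    {x : Form K ι P} {y : Form K (ι ⊕ Unit) (N ⊕ Unit)}
    (h : IsStar d (x.compLinearMap (restrict K ι Unit)) y) (w : ι ⊕ Unit → K)
    (hw : w (Sum.inr ()) = 1) :
    IsStar ((Form.fix (d.domDomCongr (Equiv.sumAssoc P N Unit).symm)
        fun _ => w).compLinearMap (Form.extend K ι Unit)) x
      ((Form.fix y fun _ => w).compLinearMap (Form.extend K ι Unit)) := by
  intro G G' hG
  let H : P ⊕ (N ⊕ Unit) → ι ⊕ Unit → K := Sum.elim (fun p => Form.extend K ι Unit (G (Sum.inl p)))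
    (Sum.elim (fun n => Form.extend K ι Unit (G (Sum.inr n))) fun _ => w)
  -- The vector `w` replaces the last unit vector in one basis. The dual basis therefore has to be
  -- corrected along the last coordinate so as to be orthogonal to `w`; this is invisible to the
  -- inflated form.
  let T : (ι → K) → ι ⊕ Unit → K := fun v =>
    Form.extend K ι Unit v - (v ⬝ᵥ restrict K ι Unit w) • unit K (Sum.inr ())
  have hT : ∀ v v', Form.extend K ι Unit v ⬝ᵥ T v' = v ⬝ᵥ v' := fun v v' => by
    simp [T, dotProduct_sub, dotProduct_smul, dotProduct_comm _ (unit K _), extend_dotProduct]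
  have hT' : ∀ v, w ⬝ᵥ T v = 0 := fun v => by
    rw [dotProduct_comm]
    simp [T, sub_dotProduct, smul_dotProduct, extend_dotProduct, hw]
  let H' : P ⊕ (N ⊕ Unit) → ι ⊕ Unit → K := Sum.elim (fun p => T (G' (Sum.inl p)))
    (Sum.elim (fun n => T (G' (Sum.inr n))) fun _ => unit K (Sum.inr ()))
  have hH : DualBases H H' := by
    constructor
    · rintro (p | n | k)
      · simpa [H, H', hT] using hG.1 (Sum.inl p)
      · simpa [H, H', hT] using hG.1 (Sum.inr n)
      · simp [H, H', dotProduct_comm _ (unit K _), hw]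
    · rintro (p | n | k) (p' | n' | k') hne
      · simpa [H, H', hT] using hG.2 (Sum.inl p) (Sum.inl p') (by simpa using hne)
      · simpa [H, H', hT] using hG.2 (Sum.inl p) (Sum.inr n') (by simp)
      · simp [H, H', dotProduct_comm _ (unit K _)]
      · simpa [H, H', hT] using hG.2 (Sum.inr n) (Sum.inl p') (by simp)
      · simpa [H, H', hT] using hG.2 (Sum.inr n) (Sum.inr n') (by simpa using hne)
      · simp [H, H', dotProduct_comm _ (unit K _)]
      · simp [H, H', hT']
      · simp [H, H', hT']
      · exact absurd rfl hne
  have := h H H' hH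
  convert this using 2
  · simp only [AlternatingMap.compLinearMap_apply, fix_apply]
    refine congrArg _ ?_
    ext1 i
    rcases i with n | k <;> rfl
  · simp only [AlternatingMap.compLinearMap_apply, fix_apply, AlternatingMap.domDomCongr_apply]
    refine congrArg _ ?_
    ext1 i
    rcases i with p | n | k <;> rfl
  · simp only [AlternatingMap.compLinearMap_apply]
    congr 1
    ext p i
    simp [H', T, unit_of_ne]

end Form

/-! ### Polynomial functions on a line. -/

section LinePoly

variable {K : Type*} [Field K]

/-- The algebra of polynomial functions on a line. -/
def linePoly (K : Type*) [Field K] : Subalgebra K (K → K) where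
  carrier := {f | ∃ p : Polynomial K, ∀ t, f t = p.eval t}
  mul_mem' := by
    rintro f g ⟨p, hp⟩ ⟨q, hq⟩
    exact ⟨p * q, fun x => by simp [hp, hq]⟩
  add_mem' := by
    rintro f g ⟨p, hp⟩ ⟨q, hq⟩
    exact ⟨p + q, fun x => by simp [hp, hq]⟩
  algebraMap_mem' r := ⟨Polynomial.C r, fun x => by simp⟩

theorem linePoly_affine (a b : K) : (fun t : K => a + t * b) ∈ linePoly K :=
  ⟨Polynomial.C a + Polynomial.X * Polynomial.C b, fun x => by simp; ring⟩

/-- A product of nonzero polynomials is nonzero. This combines two open conditions, each known at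
one point only, along the line joining the two points. -/
theorem exists_common_ne_zero [Infinite K] {f g : K → K} (hf : f ∈ linePoly K)
    (hg : g ∈ linePoly K) {s t : K} (hs : f s ≠ 0) (ht : g t ≠ 0) : ∃ r, f r ≠ 0 ∧ g r ≠ 0 := by
  obtain ⟨p, hp⟩ := hf
  obtain ⟨q, hq⟩ := hg
  have hp0 : p ≠ 0 := by rintro rfl; simp [hp] at hs
  have hq0 : q ≠ 0 := by rintro rfl; simp [hq] at ht
  obtain ⟨r, -, hr⟩ := Polynomial.exists_ne_zero_eval_ne_zero (mul_ne_zero hp0 hq0)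
  rw [Polynomial.eval_mul] at hr
  exact ⟨r, by rw [hp]; exact left_ne_zero_of_mul hr, by rw [hq]; exact right_ne_zero_of_mul hr⟩

theorem det_mem_subalgebra {T n : Type*} [Fintype n] [DecidableEq n] (S : Subalgebra K (T → K))
    {M : T → Matrix n n K} (hM : ∀ i j, (fun t => M t i j) ∈ S) : (fun t => (M t).det) ∈ S := by
  have : (fun t => (M t).det) = ∑ σ : Equiv.Perm n,
      Equiv.Perm.sign σ • ∏ i, fun t => M t (σ i) i := by
    ext t
    simp [Matrix.det_apply]
  rw [this]
  refine S.sum_mem fun σ _ => ?_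
  rw [Units.smul_def]
  exact S.toSubring.zsmul_mem (S.prod_mem fun i _ => hM _ _) _

end LinePoly

/-! ### Ranks of bilinear contractions. -/

namespace Form

variable {K : Type*} [Field K] {ι ι' P P' N N' κ : Type}

/-- The Gram matrix of a bilinear contraction of a form. -/
def gram {r : ℕ} (x : Form K ι (P ⊕ Fin 2)) (ζ : P → ι → K) (a a' : Fin r → ι → K) :
    Matrix (Fin r) (Fin r) K :=
  Matrix.of fun i j => x (Sum.elim ζ ![a i, a' j])

/-- Some bilinear contraction of the form has rank at least `r`. -/
def HasRank (r : ℕ) (x : Form K ι P) : Prop :=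
  ∃ (m : ℕ) (e : P ≃ Fin m ⊕ Fin 2) (ζ : Fin m → ι → K) (a a' : Fin r → ι → K),
    (gram (x.domDomCongr e) ζ a a').det ≠ 0

theorem HasRank.of_domDomCongr {r : ℕ} {x : Form K ι P} {e : P ≃ P'}
    (h : HasRank r (x.domDomCongr e)) : HasRank r x := by
  obtain ⟨m, e', ζ, a, a', h⟩ := h
  exact ⟨m, e.trans e', ζ, a, a', h⟩

theorem HasRank.domDomCongr {r : ℕ} {x : Form K ι P} (h : HasRank r x) (e : P ≃ P') :
    HasRank r (x.domDomCongr e) := by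
  have : x = (x.domDomCongr e).domDomCongr e.symm := by ext v; simp [Function.comp_def]
  rw [this] at h
  exact h.of_domDomCongr

theorem hasRank_of_gram [Finite P'] {r : ℕ} (x : Form K ι (P' ⊕ Fin 2)) (ζ : P' → ι → K)
    (a a' : Fin r → ι → K) (h : (gram x ζ a a').det ≠ 0) : HasRank r x := by
  obtain ⟨m, ⟨e⟩⟩ := Finite.exists_equiv_fin P'
  refine ⟨m, Equiv.sumCongr e (Equiv.refl _), ζ ∘ e.symm, a, a', ?_⟩
  convert h using 2
  ext i j
  simp only [gram, Matrix.of_apply, AlternatingMap.domDomCongr_apply]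
  refine congrArg _ ?_
  ext1 p
  rcases p with p | p <;> simp

theorem HasRank.of_compLinearMap {r : ℕ} {x : Form K ι P} {f : (ι' → K) →ₗ[K] (ι → K)}
    (h : HasRank r (x.compLinearMap f)) : HasRank r x := by
  obtain ⟨m, e, ζ, a, a', h⟩ := h
  refine ⟨m, e, fun i => f (ζ i), fun i => f (a i), fun i => f (a' i), ?_⟩
  convert h using 2
  ext i j
  simp only [gram, Matrix.of_apply, AlternatingMap.domDomCongr_apply,
    AlternatingMap.compLinearMap_apply]
  refine congrArg _ ?_
  ext1 p
  simp only [Function.comp_apply]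
  rcases e p with q | q
  · rfl
  · fin_cases q <;> rfl

theorem HasRank.of_smul {r : ℕ} {x : Form K ι P} {c : K} (h : HasRank r (c • x)) :
    HasRank r x := by
  obtain ⟨m, e, ζ, a, a', h⟩ := h
  refine ⟨m, e, ζ, a, a', fun h0 => h ?_⟩
  have : gram ((c • x).domDomCongr e) ζ a a' = c • gram (x.domDomCongr e) ζ a a' := by
    ext i j
    simp [gram]
  rw [this, Matrix.det_smul, h0, mul_zero]

/-- The fixed vectors `w` join the vectors of the contraction. -/
theorem HasRank.of_fix [Finite κ] {r : ℕ} {y : Form K ι (N ⊕ κ)} {w : κ → ι → K}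
    (h : HasRank r (y.fix w)) : HasRank r y := by
  obtain ⟨m, e, ζ, a, a', h⟩ := h
  let E : N ⊕ κ ≃ (Fin m ⊕ κ) ⊕ Fin 2 :=
    { toFun := Sum.elim (fun n => Sum.map Sum.inl id (e n)) (fun k => Sum.inl (Sum.inr k))
      invFun := Sum.elim (Sum.elim (fun i => Sum.inl (e.symm (Sum.inl i))) Sum.inr)
        (fun i => Sum.inl (e.symm (Sum.inr i)))
      left_inv := by
        rintro (n | k)
        · obtain ⟨q, rfl⟩ := e.symm.surjective n
          rcases q with q | q <;> simp
        · rfl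
      right_inv := by rintro ((i | k) | i) <;> simp }
  refine HasRank.of_domDomCongr (e := E) (hasRank_of_gram _ (Sum.elim ζ w) a a' ?_)
  convert h using 2
  ext i j
  simp only [gram, Matrix.of_apply, AlternatingMap.domDomCongr_apply, fix_apply]
  refine congrArg _ ?_
  ext1 p
  rcases p with n | k
  · simp only [Function.comp_apply, Sum.elim_inl, E, Equiv.coe_fn_mk]
    rcases e n with q | q <;> rfl
  · rfl

/-- Adding multiples of a fixed argument to the others does not change the value. -/
theorem fix_add_smul [Finite N] (z : Form K ι (N ⊕ Unit)) (w : ι → K) (v : N → ι → K)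
    (c : N → K) : z.fix (fun _ => w) (fun i => v i + c i • w) = z.fix (fun _ => w) v := by
  classical
  have := Fintype.ofFinite N
  have h := (z.fix (fun _ => w)).map_add_univ v (fun i => c i • w)
  change z.fix (fun _ => w) (fun i => v i + c i • w) = _ at h
  rw [h, Finset.sum_eq_single Finset.univ]
  · rw [Finset.piecewise_univ]
  · intro s _ hs
    obtain ⟨i, hi⟩ : ∃ i, i ∉ s := by
      by_contra! h'
      exact hs (Finset.eq_univ_iff_forall.2 h')
    have e1 : s.piecewise v (fun i => c i • w) =
        Function.update (s.piecewise v (fun i => c i • w)) i (c i • w) := by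
      rw [eq_comm, Function.update_eq_self_iff]
      simp [hi]
    rw [e1, AlternatingMap.map_update_smul]
    rw [fix_apply, AlternatingMap.map_eq_zero_of_eq (i := Sum.inl i) (j := Sum.inr ()), smul_zero]
    · simp
    · simp
  · simp

/-- Inflating a form by one dimension does not increase the rank of its dual. -/
theorem IsStar.hasRank_of_restrict_aux [Infinite K] [Fintype ι] {m r : ℕ} [Finite P]
    (e : P ⊕ (Fin m ⊕ Fin 2) ≃ ι) {x : Form K ι P}
    {d : Form K ι (P ⊕ (Fin m ⊕ Fin 2))} {y : Form K ι (Fin m ⊕ Fin 2)} (hd : d ≠ 0)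
    (hy : IsStar d x y) {d' : Form K (ι ⊕ Unit) (P ⊕ ((Fin m ⊕ Fin 2) ⊕ Unit))}
    {y' : Form K (ι ⊕ Unit) ((Fin m ⊕ Fin 2) ⊕ Unit)}
    (hy' : IsStar d' (x.compLinearMap (restrict K ι Unit)) y')
    {w₀ : ι ⊕ Unit → K} {ζ : Fin m → ι ⊕ Unit → K} {a a' : Fin r → ι ⊕ Unit → K}
    (h₀ : (gram (y'.fix fun _ => w₀) ζ a a').det ≠ 0) : HasRank r y := by
  -- Moving `w₀` along the last unit vector keeps the minor nonzero for all but finitely many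
  -- parameters, and makes the last coordinate nonzero for all but one.
  obtain ⟨w₁, h₁, hw₁⟩ : ∃ w₁, (gram (y'.fix fun _ => w₁) ζ a a').det ≠ 0 ∧
      w₁ (Sum.inr ()) ≠ 0 := by
    obtain ⟨t, ht, ht'⟩ := exists_common_ne_zero (K := K)
      (f := fun t => (gram (y'.fix fun _ => w₀ + t • unit K (Sum.inr ())) ζ a a').det)
      (g := fun t => w₀ (Sum.inr ()) + t * 1) (s := 0) (t := 1 - w₀ (Sum.inr ()))
      (by
        refine det_mem_subalgebra _ fun i j => ?_
        simp only [gram, Matrix.of_apply, fix_apply]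
        refine apply_mem _ _ fun p k => ?_
        rcases p with p | p
        · exact (linePoly K).algebraMap_mem _
        · exact linePoly_affine _ _)
      (linePoly_affine _ _) (by simpa using h₀) (by simp)
    exact ⟨_, ht, by simpa using ht'⟩
  let w := (w₁ (Sum.inr ()))⁻¹ • w₁
  have hw : w (Sum.inr ()) = 1 := by simp [w, hw₁]
  obtain ⟨c, -, -, hc⟩ := hy.proportional e hd (hy'.of_restrict w hw)
  -- Projection along `w` onto the hyperplane of the old coordinates. The contraction of `y'` with
  -- `w` does not see multiples of `w`, so it factors through `ρ`, and on the hyperplane it is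
  -- proportional to `y`.
  let ρ : (ι ⊕ Unit → K) → (ι → K) := fun u =>
    restrict K ι Unit (u - u (Sum.inr ()) • w)
  have hρ : ∀ u, extend K ι Unit (ρ u) = u + (- u (Sum.inr ())) • w := fun u => by
    ext (i | i)
    · simp [ρ, sub_eq_add_neg]
    · simp [hw]
  have key : ∀ u, (y'.fix fun _ => w₁) u = (w₁ (Sum.inr ()) * c) * y (fun i => ρ (u i)) := by
    intro u
    have h1 := congrArg (fun f => f (fun i => ρ (u i))) hc
    simp only [AlternatingMap.compLinearMap_apply, AlternatingMap.smul_apply, hρ, smul_eq_mul] at h1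
    rw [fix_add_smul] at h1
    rw [mul_assoc, ← h1]
    have h2 : w₁ = w₁ (Sum.inr ()) • w := by simp [w, smul_smul, hw₁]
    have h3 := y'.map_update_smul (Sum.elim u fun _ => w) (Sum.inr ()) (w₁ (Sum.inr ())) w
    rw [← h2, smul_eq_mul] at h3
    rw [fix_apply, fix_apply]
    convert h3 using 2
    · ext1 (i | i) <;> simp
    · congr 1
      ext1 (i | i) <;> simp
  refine HasRank.of_smul (c := w₁ (Sum.inr ()) * c) (hasRank_of_gram _ (fun i => ρ (ζ i))
    (fun i => ρ (a i)) (fun i => ρ (a' i)) ?_)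
  convert h₁ using 2
  ext i j
  simp only [gram, Matrix.of_apply, AlternatingMap.smul_apply, smul_eq_mul, key]
  congr 2
  ext1 p
  rcases p with p | p
  · rfl
  · fin_cases p <;> rfl

theorem IsStar.hasRank_of_restrict [Infinite K] [Fintype ι] [Finite P] [Fintype N] {r : ℕ}
    (e : P ⊕ N ≃ ι) (hN : 2 ≤ Fintype.card N) {x : Form K ι P}
    {d : Form K ι (P ⊕ N)} {y : Form K ι N} (hd : d ≠ 0)
    (hy : IsStar d x y) {d' : Form K (ι ⊕ Unit) (P ⊕ (N ⊕ Unit))}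
    {y' : Form K (ι ⊕ Unit) (N ⊕ Unit)}
    (hy' : IsStar d' (x.compLinearMap (restrict K ι Unit)) y') (h : HasRank r y') :
    HasRank r y := by
  obtain ⟨m, e', ζ, a, a', h⟩ := h
  -- Since `N` has at least two elements, the contraction of `y'` fixes at least one vector; the
  -- last one serves as `w₀`.
  obtain ⟨m', rfl⟩ : ∃ m', m = m' + 1 := by
    have := Fintype.card_congr e'
    simp only [Fintype.card_sum, Fintype.card_fin, Fintype.card_unit] at this
    exact ⟨m - 1, by omega⟩
  have eN : N ≃ Fin m' ⊕ Fin 2 := Fintype.equivOfCardEq (by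
    have := Fintype.card_congr e'
    simp only [Fintype.card_sum, Fintype.card_fin, Fintype.card_unit] at this ⊢
    omega)
  let E : Fin (m' + 1) ⊕ Fin 2 ≃ (Fin m' ⊕ Fin 2) ⊕ Unit :=
    (Equiv.sumCongr (finSumFinEquiv.symm.trans
      (Equiv.sumCongr (Equiv.refl _) (Equiv.ofUnique _ _))) (Equiv.refl _)).trans
      ((Equiv.sumAssoc _ _ _).trans ((Equiv.sumCongr (Equiv.refl _) (Equiv.sumComm _ _)).trans
        (Equiv.sumAssoc _ _ _).symm))
  have h1 := hy.reindex (Equiv.refl P) eN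
  have h2 := hy'.reindex (Equiv.refl P) (e'.trans E)
  have hd1 : d.domDomCongr (Equiv.sumCongr (Equiv.refl P) eN) ≠ 0 := by
    rwa [Ne, AlternatingMap.domDomCongr_eq_zero_iff]
  refine HasRank.of_domDomCongr (e := eN) (IsStar.hasRank_of_restrict_aux
    ((Equiv.sumCongr (Equiv.refl P) eN.symm).trans e) hd1 h1 h2 (r := r)
    (w₀ := ζ (Fin.last m')) (ζ := fun i => ζ i.castSucc) (a := a) (a' := a') ?_)
  convert h using 2
  ext i j
  simp only [gram, Matrix.of_apply, fix_apply, AlternatingMap.domDomCongr_apply]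
  refine congrArg _ ?_
  ext1 n
  simp only [Function.comp_apply, Equiv.trans_apply]
  rcases e' n with q | q
  · refine Fin.lastCases ?_ (fun q => ?_) q
    · have : E (Sum.inl (Fin.last m')) = Sum.inr () := by
        simp [E, show finSumFinEquiv.symm (Fin.last m') = Sum.inr (0 : Fin 1) from
          finSumFinEquiv_symm_last]
      rw [this]
      rfl
    · have : E (Sum.inl q.castSucc) = Sum.inl (Sum.inl q) := by
        simp [E, show finSumFinEquiv.symm q.castSucc = Sum.inl q from
          finSumFinEquiv_symm_apply_castAdd q]
      rw [this]
      rfl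
  · rfl

end Form

/-! ### Systems of forms, and the rank of the dual under linear maps. -/

open Form in
/-- Families of closed sets of alternating forms on coordinate spaces, preserved by linear maps and
by Hodge duals. -/
structure FormSystem (K : Type*) [Field K] where
  /-- The forms in the family on a given space, with a given number of arguments. -/
  mem : ∀ (ι P : Type) [Fintype ι] [Fintype P], Set (Form K ι P)
  closed : ∀ (ι P : Type) [Fintype ι] [Fintype P],
    ∃ Z : Set ((P → ι) → K), CoordClosed Z ∧ ∀ x, x ∈ mem ι P ↔ x.coord ∈ Z
  comp : ∀ {ι ι' P : Type} [Fintype ι] [Fintype ι'] [Fintype P] {x : Form K ι P},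
    x ∈ mem ι P → ∀ f : (ι' → K) →ₗ[K] (ι → K), x.compLinearMap f ∈ mem ι' P
  reindex : ∀ {ι P P' : Type} [Fintype ι] [Fintype P] [Fintype P'] {x : Form K ι P},
    x ∈ mem ι P → ∀ e : P ≃ P', x.domDomCongr e ∈ mem ι P'
  star : ∀ {ι P N : Type} [Fintype ι] [Fintype P] [Fintype N] {x : Form K ι P},
    x ∈ mem ι P → (P ⊕ N ≃ ι) → ∀ d : Form K ι (P ⊕ N), d ≠ 0 → ∃ y ∈ mem ι N, IsStar d x y

namespace FormSystem

open Form

variable {K : Type*} [Field K] {ι ι' P P' N N' κ : Type} [Fintype ι] [Fintype ι'] [Fintype P]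
  [Fintype P'] [Fintype N] [Fintype N'] [Fintype κ]

instance : Preorder (FormSystem K) where
  le X Y := ∀ (ι P : Type) [Fintype ι] [Fintype P], X.mem ι P ⊆ Y.mem ι P
  le_refl _ _ _ _ _ := subset_rfl
  le_trans _ _ _ h h' A B _ _ := (h A B).trans (h' A B)

variable (X : FormSystem K)

theorem star_mem (e : P ⊕ N ≃ ι) {d : Form K ι (P ⊕ N)} (hd : d ≠ 0) {x : Form K ι P}
    {y : Form K ι N} (h : IsStar d x y) (hx : x ∈ X.mem ι P) : y ∈ X.mem ι N := by
  obtain ⟨y', hy', hxy'⟩ := X.star hx e d hd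
  rwa [h.unique e hxy']

theorem mem_of_star_mem (e : P ⊕ N ≃ ι) {d : Form K ι (P ⊕ N)} (hd : d ≠ 0) {x : Form K ι P}
    {y : Form K ι N} (h : IsStar d x y) (hy : y ∈ X.mem ι N) : x ∈ X.mem ι P := by
  obtain ⟨d', hd', h'⟩ := h.exists_swap e hd
  exact X.star_mem ((Equiv.sumComm N P).trans e) hd' h' hy

omit [Fintype κ] in
theorem vol_ne_zero (e : κ ≃ ι) : (vol e : Form K ι κ) ≠ 0 := fun h => by
  have := vol_unit (K := K) e
  rw [h] at this
  simp at this

omit [Fintype ι] [Fintype ι'] [Fintype P] in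
theorem comp_ne_zero {d : Form K ι P} (hd : d ≠ 0) (f : (ι' → K) →ₗ[K] (ι → K))
    (hf : Function.Surjective f) : d.compLinearMap f ≠ 0 := fun h => hd (by
  ext v
  choose g hg using hf
  have := congrArg (fun x => x fun i => g (v i)) h
  simpa [hg] using this)

omit [Fintype ι] [Fintype P] [Fintype P'] in
theorem domDomCongr_ne_zero {d : Form K ι P} (hd : d ≠ 0) (e : P ≃ P') :
    d.domDomCongr e ≠ 0 := by
  rwa [Ne, AlternatingMap.domDomCongr_eq_zero_iff]

/-- The linear map permuting coordinates. -/
def permute (K : Type*) [Field K] (e : ι' ≃ ι) : (ι' → K) →ₗ[K] (ι → K) :=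
  LinearMap.funLeft K K e.symm

omit [Fintype ι] [Fintype ι'] in
@[simp] theorem permute_apply (e : ι' ≃ ι) (v : ι' → K) (i : ι) :
    permute K e v i = v (e.symm i) := rfl

theorem permute_dotProduct (e : ι' ≃ ι) (v w : ι' → K) :
    permute K e v ⬝ᵥ permute K e w = v ⬝ᵥ w := by
  simp only [dotProduct, permute_apply]
  exact Equiv.sum_comp e.symm fun i => v i * w i

omit [Fintype ι] [Fintype ι'] in
theorem permute_surjective (e : ι' ≃ ι) : Function.Surjective (permute K e) := fun v =>
  ⟨permute K e.symm v, by ext i; simp⟩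

omit [Fintype ι] [Fintype ι'] [Fintype P] in
theorem hasRank_comp_permute {r : ℕ} {x : Form K ι P} (h : HasRank r x) (e : ι' ≃ ι) :
    HasRank r (x.compLinearMap (permute K e)) := by
  have : x = (x.compLinearMap (permute K e)).compLinearMap (permute K e.symm) := by
    ext v
    simp only [AlternatingMap.compLinearMap_apply]
    congr 1
    ext p i
    simp
  rw [this] at h
  exact h.of_compLinearMap

/-- The extra coordinates are added one at a time; the system provides the dual of each intermediate
inflation. -/
theorem hasRank_star_of_restrict [Infinite K] {r : ℕ} (n : ℕ) : ∀ {κ : Type} [Fintype κ]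
    (_ : Fintype.card κ = n) {ι P N : Type} [Fintype ι] [Fintype P] [Fintype N] {x : Form K ι P}
    (_ : x ∈ X.mem ι P) (_ : P ⊕ N ≃ ι) (_ : 2 ≤ Fintype.card N) {d : Form K ι (P ⊕ N)}
    {y : Form K ι N} (_ : d ≠ 0) (_ : IsStar d x y) {d' : Form K (ι ⊕ κ) (P ⊕ (N ⊕ κ))}
    {y' : Form K (ι ⊕ κ) (N ⊕ κ)} (_ : IsStar d' (x.compLinearMap (restrict K ι κ)) y')
    (_ : HasRank r y'), HasRank r y := by
  induction n with
  | zero =>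
    intro κ _ hκ ι P N _ _ _ x hx e hN d y hd hy d' y' hy' h
    have : IsEmpty κ := Fintype.card_eq_zero_iff.1 hκ
    have h1 := (hy'.comp (permute K (Equiv.sumEmpty ι κ).symm)
      (permute K (Equiv.sumEmpty ι κ).symm) (permute_dotProduct _)).reindex (Equiv.refl P)
      (Equiv.sumEmpty N κ)
    have e1 : ((x.compLinearMap (restrict K ι κ)).compLinearMap
        (permute K (Equiv.sumEmpty ι κ).symm)).domDomCongr (Equiv.refl P) = x := by
      ext v
      rfl
    rw [e1] at h1
    obtain ⟨c, -, -, hc⟩ := hy.proportional e hd h1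
    have h2 := (hasRank_comp_permute h (Equiv.sumEmpty ι κ).symm).domDomCongr (Equiv.sumEmpty N κ)
    rw [hc] at h2
    exact h2.of_smul
  | succ n ih =>
    intro κ _ hκ ι P N _ _ _ x hx e hN d y hd hy d' y' hy' h
    have eκ : κ ≃ Fin n ⊕ Unit := Fintype.equivOfCardEq (by simpa using hκ)
    have e1 : P ⊕ (N ⊕ Fin n) ≃ ι ⊕ Fin n :=
      (Equiv.sumAssoc _ _ _).symm.trans (Equiv.sumCongr e (Equiv.refl _))
    have hx1 := X.comp hx (restrict K ι (Fin n))
    obtain ⟨y1, -, hy1⟩ := X.star hx1 e1 (vol e1) (vol_ne_zero e1)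
    refine ih (Fintype.card_fin n) hx e hN hd hy hy1 ?_
    let E : ∀ ι : Type, (ι ⊕ Fin n) ⊕ Unit ≃ ι ⊕ κ := fun ι =>
      (Equiv.sumAssoc _ _ _).trans (Equiv.sumCongr (Equiv.refl _) eκ.symm)
    have h1 := (hy'.comp (permute K (E ι)) (permute K (E ι)) (permute_dotProduct _)).reindex
      (Equiv.refl P) (E N).symm
    refine IsStar.hasRank_of_restrict e1 (by simp; omega) (vol_ne_zero e1) hy1 h1
      ((hasRank_comp_permute h (E ι)).domDomCongr _)

/-- The rank of the Hodge dual does not increase under linear maps. -/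
theorem hasRank_star_of_comp [Infinite K] {r : ℕ} {x : Form K ι P} (hx : x ∈ X.mem ι P)
    (f : (ι' → K) →ₗ[K] (ι → K)) (e : P ⊕ N ≃ ι) (e' : P ⊕ N' ≃ ι') (hN : 2 ≤ Fintype.card N)
    {d : Form K ι (P ⊕ N)} {y : Form K ι N} (hd : d ≠ 0) (hy : IsStar d x y)
    {d' : Form K ι' (P ⊕ N')} {y' : Form K ι' N'} (hy' : IsStar d' (x.compLinearMap f) y')
    (h : HasRank r y') : HasRank r y := by
  have e1 : P ⊕ (N ⊕ ι') ≃ ι ⊕ ι' :=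
    (Equiv.sumAssoc _ _ _).symm.trans (Equiv.sumCongr e (Equiv.refl _))
  have hx1 := X.comp hx (restrict K ι ι')
  obtain ⟨y1, -, hy1⟩ := X.star hx1 e1 (vol e1) (vol_ne_zero e1)
  refine X.hasRank_star_of_restrict _ rfl hx e hN hd hy hy1 ?_
  -- The map `f` is the inclusion of `ι'`, followed by the shear `A'`, followed by the projection to
  -- `ι`. The projection inflates the form, `A'` is a change of coordinates with contragredient `A`,
  -- and the inclusion contracts the dual with unit vectors. None of these raises the rank of the
  -- dual.
  let A' : (ι' ⊕ ι → K) →ₗ[K] (ι ⊕ ι' → K) :=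
    { toFun := fun u => Sum.elim (fun i => u (Sum.inr i) + f (fun j => u (Sum.inl j)) i)
        (fun j => u (Sum.inl j))
      map_add' := fun u v => by
        ext (i | i)
        · have : f (fun j => u (Sum.inl j) + v (Sum.inl j)) =
              f (fun j => u (Sum.inl j)) + f (fun j => v (Sum.inl j)) := map_add f _ _
          simp only [Sum.elim_inl, Pi.add_apply, this]
          ring
        · simp
      map_smul' := fun c v => by
        ext (i | i)
        · have : f (fun j => c * v (Sum.inl j)) = c • f (fun j => v (Sum.inl j)) :=
            map_smul f c _
          simp only [Sum.elim_inl, Pi.smul_apply, smul_eq_mul, RingHom.id_apply, this]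
          ring
        · simp }
  let A : (ι' ⊕ ι → K) →ₗ[K] (ι ⊕ ι' → K) :=
    { toFun := fun u => Sum.elim (fun i => u (Sum.inr i))
        (fun j => u (Sum.inl j) - (fun i => u (Sum.inr i)) ⬝ᵥ f (unit K j))
      map_add' := fun u v => by
        ext (i | i)
        · simp
        · simp only [dotProduct, Pi.add_apply, add_mul, Finset.sum_add_distrib, Sum.elim_inr]
          ring
      map_smul' := fun c v => by
        ext (i | i)
        · simp
        · simp only [dotProduct, Pi.smul_apply, smul_eq_mul, Sum.elim_inr, RingHom.id_apply,
            mul_sub, Finset.mul_sum, mul_assoc] }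
  have hA : ∀ v w, A v ⬝ᵥ A' w = v ⬝ᵥ w := by
    intro v w
    have h1 := linearMap_apply f (fun j => w (Sum.inl j))
    have h2 : ∀ i, f (fun j => w (Sum.inl j)) i = ∑ j, w (Sum.inl j) * f (unit K j) i := by
      intro i
      rw [h1]
      simp
    simp only [dotProduct, Fintype.sum_sum_type, A, A', LinearMap.coe_mk, AddHom.coe_mk,
      Sum.elim_inl, Sum.elim_inr, h2, mul_add, sub_mul, Finset.sum_add_distrib,
      Finset.sum_sub_distrib, Finset.mul_sum, Finset.sum_mul]
    rw [Finset.sum_comm]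
    have : ∀ i : ι', ∀ j : ι, v (Sum.inr j) * (w (Sum.inl i) * f (unit K i) j) =
      v (Sum.inr j) * f (unit K i) j * w (Sum.inl i) := fun i j => by ring
    simp only [this]
    ring
  have hA' : Function.Surjective A := fun u =>
    ⟨Sum.elim (fun j => u (Sum.inr j) + (fun i => u (Sum.inl i)) ⬝ᵥ f (unit K j))
      (fun i => u (Sum.inl i)), by ext (i | i) <;> simp [A]⟩
  have E : N ⊕ ι' ≃ N' ⊕ ι := Fintype.equivOfCardEq (by
    have h1 := Fintype.card_congr e
    have h2 := Fintype.card_congr e'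
    simp only [Fintype.card_sum] at h1 h2 ⊢
    omega)
  have h2 := (hy1.comp A A' hA).reindex (Equiv.refl P) E
  have hd2 := domDomCongr_ne_zero (comp_ne_zero (vol_ne_zero (K := K) e1) A hA')
    (Equiv.sumCongr (Equiv.refl P) E)
  have h3 := h2.comp_extend
  have e3 : (((x.compLinearMap (restrict K ι ι')).compLinearMap A').domDomCongr
      (Equiv.refl P)).compLinearMap (extend K ι' ι) = x.compLinearMap f := by
    ext v
    simp only [AlternatingMap.compLinearMap_apply, AlternatingMap.domDomCongr_apply]
    congr 1
    ext p i
    simp [A']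
  rw [e3] at h3
  have hd3 : (Form.fix (AlternatingMap.domDomCongr (Equiv.sumAssoc P N' ι).symm
      (((vol e1 : Form K _ _).compLinearMap A).domDomCongr
        (Equiv.sumCongr (Equiv.refl P) E))) fun k => unit K (Sum.inr k)).compLinearMap
        (extend K ι' ι) ≠ 0 := by
    intro h0
    let e2 : P ⊕ (N' ⊕ ι) ≃ ι' ⊕ ι :=
      (Equiv.sumAssoc _ _ _).symm.trans (Equiv.sumCongr e' (Equiv.refl _))
    apply apply_unit_ne_zero e2 hd2
    have := congrArg (fun z => z fun i => unit K (e' i)) h0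
    simp only [AlternatingMap.zero_apply] at this
    rw [← this]
    simp only [AlternatingMap.compLinearMap_apply, fix_apply, AlternatingMap.domDomCongr_apply]
    congr 1
    ext1 i
    simp only [Function.comp_apply]
    congr 1
    generalize (Equiv.sumCongr (Equiv.refl P) E) i = q
    rcases q with p | n | k
    · simp [e2, extend_unit]
    · simp [e2, extend_unit]
    · simp [e2]
  obtain ⟨c, -, -, hc⟩ := h3.proportional e' hd3 hy'
  rw [hc] at h
  exact (h.of_smul.of_compLinearMap.of_fix.of_domDomCongr).of_compLinearMap

end FormSystem

/-! ### Specialisation of 2-forms of large rank. -/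

namespace Form

variable {K : Type*} [Field K] {ι ι' P P' N N' κ : Type}

theorem exists_equiv_of_ne_zero [Finite ι] [Finite P] {x : Form K ι P} (hx : x ≠ 0) :
    ∃ n, Nonempty (P ⊕ Fin n ≃ ι) := by
  obtain ⟨s, hs⟩ : ∃ s : P → ι, Function.Injective s := by
    by_contra! h
    exact hx (ext_coord fun s hs => absurd hs (h s))
  have := Fintype.ofFinite ι
  have := Fintype.ofFinite P
  have h := Fintype.card_le_of_injective s hs
  exact ⟨Fintype.card ι - Fintype.card P, ⟨Fintype.equivOfCardEq (by simp; omega)⟩⟩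

theorem update_zero {V : Type*} (v w u : V) : Function.update ![v, w] 0 u = ![u, w] := by
  ext1 i
  fin_cases i <;> simp

theorem update_one {V : Type*} (v w u : V) : Function.update ![v, w] 1 u = ![v, u] := by
  ext1 i
  fin_cases i <;> simp

/-- The bilinear map given by a form with two arguments. -/
def bilin (Q : Form K ι (Fin 2)) : (ι → K) →ₗ[K] (ι → K) →ₗ[K] K :=
  LinearMap.mk₂ K (fun v w => Q ![v, w])
    (fun v v' w => by
      have h := Q.map_update_add ![v, w] 0 v v'
      rwa [update_zero, update_zero, update_zero] at h)
    (fun c v w => by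
      have h := Q.map_update_smul ![v, w] 0 c v
      rwa [update_zero, update_zero] at h)
    (fun v w w' => by
      have h := Q.map_update_add ![v, w] 1 w w'
      rwa [update_one, update_one, update_one] at h)
    (fun c v w => by
      have h := Q.map_update_smul ![v, w] 1 c w
      rwa [update_one, update_one] at h)

@[simp] theorem bilin_apply (Q : Form K ι (Fin 2)) (v w : ι → K) : Q.bilin v w = Q ![v, w] := rfl

theorem bilin_self (Q : Form K ι (Fin 2)) (v : ι → K) : Q ![v, v] = 0 :=
  Q.map_eq_zero_of_eq (i := 0) (j := 1) _ rfl (by simp)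

theorem bilin_swap (Q : Form K ι (Fin 2)) (v w : ι → K) : Q ![v, w] = - Q ![w, v] := by
  have := Q.map_swap ![v, w] (i := 0) (j := 1) (by simp)
  rw [← neg_eq_iff_eq_neg, ← this]
  congr 1
  ext1 i
  fin_cases i <;> rfl

/-- A form with two arguments of large rank specializes to every form in few variables. -/
theorem exists_bilin_eq (Q : Form K ι (Fin 2)) {r : ℕ} {a a' : Fin r → ι → K}
    (h : (Matrix.of fun i j => Q ![a i, a' j]).det ≠ 0) (c : ℕ → ℕ → K) (q : ℕ) (hq : 2 * q ≤ r) :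
    ∃ w : Fin q → ι → K, (∀ i j, i < j → Q ![w i, w j] = c i j) ∧
      Function.Surjective fun v i => Q ![w i, v] := by
  induction q with
  | zero => exact ⟨fun i => i.elim0, fun i => i.elim0, fun v => ⟨0, Subsingleton.elim _ _⟩⟩
  | succ q ih =>
    obtain ⟨w, hw, hT⟩ := ih (by omega)
    let T : (ι → K) →ₗ[K] (Fin q → K) := LinearMap.pi fun i => Q.bilin (w i)
    have hT' : ∀ t, ∃ v, T v = t := hT
    obtain ⟨g, hg⟩ := T.exists_rightInverse_of_surjective (LinearMap.range_eq_top.2 hT')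
    obtain ⟨w₀, hw₀⟩ := hT' fun i => c i q
    -- The new vector `v` needs prescribed pairings with the old ones, and a partner `u` orthogonal
    -- to the old ones with `Q ![v, u] ≠ 0`, so that surjectivity persists.
    obtain ⟨v, hv, u, hu, hvu⟩ : ∃ v, T v = (fun i : Fin q => c i q) ∧ ∃ u, T u = 0 ∧
        Q ![v, u] ≠ 0 := by
      by_contra! hcon
      have hiso : ∀ v u, T v = 0 → T u = 0 → Q.bilin v u = 0 := by
        intro v u hv hu
        have h1 := hcon w₀ hw₀ u hu
        have h2 := hcon (w₀ + v) (by rw [map_add, hw₀, hv, add_zero]) u hu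
        rw [← bilin_apply, map_add, LinearMap.add_apply, bilin_apply, h1, zero_add] at h2
        exact h2
      let A : (Fin r → K) →ₗ[K] (ι → K) := Fintype.linearCombination K a
      -- Otherwise `Q` vanishes on the kernel of `T`. As `r > 2 * q`, some nonzero combination of
      -- the vectors `a` satisfies the `2 * q` conditions of lying in this kernel and being
      -- orthogonal to a complement. It is then orthogonal to everything, against the invertible
      -- Gram matrix.
      let Λ : (Fin r → K) →ₗ[K] (Fin q → K) × (Fin q → K) :=
        (T ∘ₗ A).prod (LinearMap.pi fun l =>
          (Q.bilin.flip (g (Pi.single l 1))) ∘ₗ A)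
      obtain ⟨b, hb, hb0⟩ := Submodule.exists_mem_ne_zero_of_ne_bot
        (Λ.ker_ne_bot_of_finrank_lt (by simp; omega))
      rw [LinearMap.mem_ker, Prod.ext_iff] at hb
      obtain ⟨hb1, hb2⟩ := hb
      have hb2' : ∀ t, Q.bilin (A b) (g t) = 0 := by
        intro t
        have : Q.bilin (A b) ∘ₗ g = 0 := by
          refine LinearMap.pi_ext' fun l => ?_
          ext
          exact congrFun hb2 l
        exact LinearMap.congr_fun this t
      have hG : ∀ j, Q.bilin (A b) (a' j) = 0 := by
        intro j
        have h1 : T (a' j - g (T (a' j))) = 0 := by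
          rw [map_sub, sub_eq_zero]
          exact (LinearMap.congr_fun hg (T (a' j))).symm
        have h2 := hiso (A b) _ hb1 h1
        rwa [map_sub, hb2', sub_zero] at h2
      refine hb0 (Matrix.eq_zero_of_vecMul_eq_zero h ?_)
      ext j
      have := hG j
      rw [Fintype.linearCombination_apply, map_sum, LinearMap.sum_apply] at this
      simpa [Matrix.vecMul, dotProduct] using this
    refine ⟨Fin.snoc w v, fun i j hij => ?_, fun t => ?_⟩
    · induction i using Fin.lastCases with
      | last => exact absurd hij (Fin.le_last j).not_gt
      | cast i =>
        induction j using Fin.lastCases with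
        | last => simpa [T] using congrFun hv i
        | cast j => simpa using hw i j (by simpa using hij)
    · obtain ⟨v₁, hv₁⟩ := hT' fun i => t i.castSucc
      refine ⟨v₁ + ((t (Fin.last q) - Q ![v, v₁]) / Q ![v, u]) • u, ?_⟩
      ext i
      induction i using Fin.lastCases with
      | last =>
        simp only [Fin.snoc_last]
        rw [← bilin_apply, map_add, map_smul, bilin_apply, bilin_apply, smul_eq_mul,
          div_mul_cancel₀ _ hvu]
        ring
      | cast i =>
        have h1 : Q.bilin (w i) v₁ = t i.castSucc := congrFun hv₁ i
        have h2 : Q.bilin (w i) u = 0 := congrFun hu i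
        simp only [Fin.snoc_castSucc]
        rw [← bilin_apply, map_add, map_smul, h1, h2, smul_zero, add_zero]

end Form

/-! ### Closure under contraction and boundedness of ranks. -/

namespace FormSystem

open Form

variable {K : Type*} [Field K] {ι ι' P P' N N' κ : Type} [Fintype ι] [Fintype ι'] [Fintype P]
  [Fintype P'] [Fintype N] [Fintype N'] [Fintype κ] (X : FormSystem K)

/-- Contraction with unit vectors is dual to restriction to a coordinate subspace: dualise,
restrict, dualise back. -/
theorem fix_unit_mem {y : Form K (ι ⊕ κ) (N ⊕ κ)} (hy : y ∈ X.mem _ _) (e : P ⊕ N ≃ ι) :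
    (Form.fix y fun k => unit K (Sum.inr k)).compLinearMap (extend K ι κ) ∈ X.mem ι N := by
  let E : P ⊕ (N ⊕ κ) ≃ ι ⊕ κ :=
    (Equiv.sumAssoc _ _ _).symm.trans (Equiv.sumCongr e (Equiv.refl _))
  have E' := (Equiv.sumComm (N ⊕ κ) P).trans E
  obtain ⟨x, hx, hyx⟩ := X.star hy E' (vol E') (vol_ne_zero E')
  obtain ⟨d, hd, hxy⟩ := hyx.exists_swap E' (vol_ne_zero E')
  refine X.star_mem e (fun h0 => ?_) hxy.comp_extend (X.comp hx _)
  apply apply_unit_ne_zero E hd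
  have := congrArg (fun z => z fun i => unit K (e i)) h0
  simp only [AlternatingMap.zero_apply] at this
  rw [← this]
  simp only [AlternatingMap.compLinearMap_apply, fix_apply, AlternatingMap.domDomCongr_apply]
  congr 1
  ext1 i
  rcases i with p | n | k
  · simp [E, extend_unit]
  · simp [E, extend_unit]
  · simp [E]

/-- Adjoining coordinates that map to the vectors `w` reduces to contraction with unit vectors. A
nonzero form has at most as many arguments as there are coordinates, so the complementary arguments
needed for the dual exist. -/
theorem fix_mem {y : Form K ι (N ⊕ κ)} (hy : y ∈ X.mem _ _) (hy0 : y ≠ 0) (w : κ → ι → K) :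
    Form.fix y w ∈ X.mem ι N := by
  obtain ⟨n, ⟨E⟩⟩ := exists_equiv_of_ne_zero hy0
  let e : (κ ⊕ Fin n) ⊕ N ≃ ι := ((Equiv.sumComm _ _).trans (Equiv.sumAssoc _ _ _).symm).trans E
  let A : (ι ⊕ κ → K) →ₗ[K] (ι → K) :=
    restrict K ι κ + Fintype.linearCombination K w ∘ₗ LinearMap.funLeft K K Sum.inr
  have h := X.fix_unit_mem (X.comp hy A) e
  convert h using 1
  ext v
  simp only [fix_apply, AlternatingMap.compLinearMap_apply]
  congr 1
  ext1 i
  rcases i with i | i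
  · ext j
    simp [A, Fintype.linearCombination_apply, LinearMap.funLeft]
  · classical
    ext j
    simp [A, Fintype.linearCombination_apply, LinearMap.funLeft, unit_apply]

/-- If some form with two arguments is not in the family, then the ranks of the forms in the
family are bounded. -/
theorem exists_not_hasRank {ι₀ : Type} [Fintype ι₀] (h : X.mem ι₀ (Fin 2) ≠ Set.univ) :
    ∃ R, 0 < R ∧ ∀ (ι P : Type) [Fintype ι] [Fintype P], ∀ x ∈ X.mem ι P, ¬ HasRank R x := by
  -- Prescribing all pairings of `|ι₀|` vectors requires rank `2 * |ι₀|`; the extra 1 makes the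
  -- bound positive. A contraction of that rank lies in the system and specialises to every 2-form
  -- on `ι₀`.
  refine ⟨2 * Fintype.card ι₀ + 1, by omega, fun ι P _ _ x hx hr => h ?_⟩
  obtain ⟨m, e, ζ, a, a', hr⟩ := hr
  let y : Form K ι (Fin 2 ⊕ Fin m) := (x.domDomCongr e).domDomCongr (Equiv.sumComm _ _)
  have hy : y ∈ X.mem _ _ := X.reindex (X.reindex hx e) _
  have hyv : ∀ v w, (Form.fix y ζ) ![v, w] = (x.domDomCongr e) (Sum.elim ζ ![v, w]) := by
    intro v w
    rw [fix_apply]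
    refine congrArg (x.domDomCongr e) ?_
    ext1 i
    rcases i with i | i <;> rfl
  have hy0 : y ≠ 0 := fun h0 => hr (by
    have : gram (x.domDomCongr e) ζ a a' = 0 := by
      ext i j
      simp [gram, ← hyv, h0]
    rw [this, Matrix.det_zero])
  have hQ := X.fix_mem hy hy0 ζ
  have hg : (Matrix.of fun i j => (Form.fix y ζ) ![a i, a' j]).det ≠ 0 := by
    simp only [hyv]
    exact hr
  refine Set.eq_univ_of_forall fun Q₀ => ?_
  let ε := Fintype.equivFin ι₀
  obtain ⟨w, hw, -⟩ := exists_bilin_eq (Form.fix y ζ) hg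
    (fun i j => if h : i < Fintype.card ι₀ ∧ j < Fintype.card ι₀ then
      Q₀ ![unit K (ε.symm ⟨i, h.1⟩), unit K (ε.symm ⟨j, h.2⟩)] else 0) (Fintype.card ι₀) (by omega)
  let f : (ι₀ → K) →ₗ[K] (ι → K) := Fintype.linearCombination K fun i => w (ε i)
  have hf : ∀ i, f (unit K i) = w (ε i) := by
    intro i
    rw [show f (unit K i) = ∑ c, unit K i c • w (ε c) from rfl, Finset.sum_eq_single i]
    · simp
    · intro c _ hc
      rw [unit_of_ne hc, zero_smul]
    · simp
  have key : Q₀ = (Form.fix y ζ).compLinearMap f := by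
    have hlt : ∀ i j, ε i < ε j → Q₀ ![unit K i, unit K j] =
        (Form.fix y ζ) ![w (ε i), w (ε j)] := by
      intro i j hij
      rw [hw _ _ hij]
      simp
    have hall : ∀ i j, Q₀ ![unit K i, unit K j] = (Form.fix y ζ) ![w (ε i), w (ε j)] := by
      intro i j
      rcases lt_trichotomy (ε i) (ε j) with hij | hij | hij
      · exact hlt i j hij
      · rw [ε.injective hij, bilin_self, bilin_self]
      · rw [bilin_swap, bilin_swap (Form.fix y ζ), hlt j i hij]
    refine ext_coord fun s _ => ?_
    have e1 : (fun p => unit K (s p)) = ![unit K (s 0), unit K (s 1)] := by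
      ext1 p
      fin_cases p <;> rfl
    have e2 : (fun p => f (unit K (s p))) = ![w (ε (s 0)), w (ε (s 1))] := by
      ext1 p
      fin_cases p <;> simp [hf]
    simp only [coord, AlternatingMap.compLinearMap_apply]
    rw [e2, ← hall, e1]
  rw [key]
  exact X.comp hQ f

end FormSystem

/-! ### Relations between coordinates from vanishing minors. -/

namespace Form

variable {K : Type*} [Field K] {ι ι' P P' N N' κ : Type}

/-- Multilinear expansion: a power of `t` counts the positions at which the index from `s` replaces
the one from `o`. -/
theorem fix_line_eq_sum [Fintype P] [DecidableEq P] (x : Form K ι P) (o s : P → ι) (D : Finset P)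
    (t : K) : x (D.piecewise (fun p => t • unit K (s p) + unit K (o p)) fun p => unit K (o p)) =
      ∑ T ∈ D.powerset, x.coord (T.piecewise s o) * t ^ T.card := by
  have h := x.toMultilinearMap.map_piecewise_add (fun p => t • unit K (s p))
    (fun p => unit K (o p)) D
  rw [AlternatingMap.coe_multilinearMap] at h
  refine h.trans (Finset.sum_congr rfl fun T _ => ?_)
  have h2 := x.toMultilinearMap.map_piecewise_smul (fun _ => t)
    (T.piecewise (fun p => unit K (s p)) fun p => unit K (o p)) T
  rw [AlternatingMap.coe_multilinearMap] at h2
  have e1 : T.piecewise (fun p => t • unit K (s p)) (fun p => unit K (o p)) =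
      T.piecewise (fun p => t • T.piecewise (fun p => unit K (s p)) (fun p => unit K (o p)) p)
        (T.piecewise (fun p => unit K (s p)) fun p => unit K (o p)) := by
    ext1 p
    by_cases hp : p ∈ T <;> simp [hp]
  have e2 : T.piecewise (fun p => unit K (s p)) (fun p => unit K (o p)) =
      fun p => unit K (T.piecewise s o p) := by
    ext1 p
    by_cases hp : p ∈ T <;> simp [hp]
  rw [e1, h2, Finset.prod_const, smul_eq_mul, mul_comm, e2]
  rfl

/-- Along a line in the fixed arguments, the vanishing `(r + 1)`-minor is a polynomial identity in
`t`. The wanted coordinate occurs only in the corner entry, with `t ^ D.card`, and is multiplied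
there by the complementary minor. All other coefficients belong to `𝓑`, and `hdiv` permits division
by the value of that minor at `t = 0`. -/
theorem coord_mem_of_not_hasRank [Infinite K] [Fintype P] [DecidableEq P] {Z : Type*}
    (𝓑 : Subalgebra K (Z → K)) {r : ℕ} {x : Z → Form K ι (P ⊕ Fin 2)}
    (hx : ∀ z, ¬ HasRank (r + 1) (x z)) {o s : P → ι} {D : Finset P} (hD : ∀ p ∉ D, s p = o p)
    (b b' : Fin (r + 1) → ι)
    (hdiv : ∀ f : Z → K, (f * fun z => (Matrix.of fun i j : Fin r => (x z).coord
      (Sum.elim o ![b i.succ, b' j.succ])).det) ∈ 𝓑 → f ∈ 𝓑)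
    (h : ∀ T ⊆ D, ∀ i j : Fin (r + 1), (T ≠ D ∨ i ≠ 0 ∨ j ≠ 0) →
      (fun z => (x z).coord (Sum.elim (T.piecewise s o) ![b i, b' j])) ∈ 𝓑) :
    (fun z => (x z).coord (Sum.elim s ![b 0, b' 0])) ∈ 𝓑 := by
  classical
  let M : Finset P → Fin (r + 1) → Fin (r + 1) → Z → K := fun T i j z =>
    (x z).coord (Sum.elim (T.piecewise s o) ![b i, b' j])
  let E : Matrix (Fin (r + 1)) (Fin (r + 1)) (Polynomial (Z → K)) := Matrix.of fun i j =>
    ∑ T ∈ D.powerset, Polynomial.C (M T i j) * Polynomial.X ^ T.card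
  have hE : E.det = 0 := by
    have h1 : ∀ z, E.det.map (Pi.evalRingHom (fun _ => K) z) = 0 := by
      intro z
      refine Polynomial.funext fun t => ?_
      rw [Polynomial.eval_zero, Polynomial.eval_map, ← Polynomial.coe_eval₂RingHom,
        RingHom.map_det]
      by_contra h0
      refine hx z (hasRank_of_gram (x z)
        (D.piecewise (fun p => t • unit K (s p) + unit K (o p)) fun p => unit K (o p))
        (fun i => unit K (b i)) (fun i => unit K (b' i)) ?_)
      convert h0 using 2
      ext i j
      have h2 := fix_line_eq_sum (Form.fix (x z) ![unit K (b i), unit K (b' j)]) o s D t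
      rw [fix_apply] at h2
      simp only [gram, Matrix.of_apply, RingHom.mapMatrix_apply, Matrix.map_apply, E,
        Polynomial.coe_eval₂RingHom, Polynomial.eval₂_finsetSum, Polynomial.eval₂_mul,
        Polynomial.eval₂_pow, Polynomial.eval₂_C, Polynomial.eval₂_X]
      refine h2.trans (Finset.sum_congr rfl fun T _ => ?_)
      congr 1
      change (x z) _ = (x z) _
      congr 1
      ext1 p
      rcases p with p | p
      · rfl
      · fin_cases p <;> rfl
    ext n z
    have := congrArg (fun p => p.coeff n) (h1 z)
    simpa using this
  let 𝓛 : Subring (Polynomial (Z → K)) :=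
    { carrier := {p | ∀ n, p.coeff n ∈ 𝓑}
      mul_mem' := fun {p q} hp hq n => by
        rw [Polynomial.coeff_mul]
        exact 𝓑.sum_mem fun i _ => 𝓑.mul_mem (hp _) (hq _)
      one_mem' := fun n => by
        rw [Polynomial.coeff_one]
        split_ifs
        · exact 𝓑.one_mem
        · exact 𝓑.zero_mem
      add_mem' := fun {p q} hp hq n => by
        rw [Polynomial.coeff_add]
        exact 𝓑.add_mem (hp n) (hq n)
      zero_mem' := fun n => 𝓑.zero_mem
      neg_mem' := fun {p} hp n => by
        rw [Polynomial.coeff_neg]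
        exact 𝓑.neg_mem (hp n) }
  have hC : ∀ f ∈ 𝓑, Polynomial.C f ∈ 𝓛 := fun f hf n => by
    rw [Polynomial.coeff_C]
    split_ifs
    · exact hf
    · exact 𝓑.zero_mem
  have hX : ∀ n : ℕ, Polynomial.X ^ n ∈ 𝓛 := fun n m => by
    rw [Polynomial.coeff_X_pow]
    split_ifs
    · exact 𝓑.one_mem
    · exact 𝓑.zero_mem
  have hcoeff : ∀ p ∈ 𝓛, ∀ n, p.coeff n ∈ 𝓑 := fun p hp => hp
  have hM : ∀ T ⊆ D, ∀ i j : Fin (r + 1), (T ≠ D ∨ i ≠ 0 ∨ j ≠ 0) →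
      Polynomial.C (M T i j) * Polynomial.X ^ T.card ∈ 𝓛 := fun T hT i j hij =>
    𝓛.mul_mem (hC _ (h T hT i j hij)) (hX _)
  have hEij : ∀ i j : Fin (r + 1), (i ≠ 0 ∨ j ≠ 0) → E i j ∈ 𝓛 := fun i j hij =>
    𝓛.sum_mem fun T hT => hM T (Finset.mem_powerset.1 hT) i j (Or.inr hij)
  have hdet : ∀ f g : Fin r → Fin (r + 1), (∀ i, f i ≠ 0) → (E.submatrix f g).det ∈ 𝓛 := by
    intro f g hf
    rw [Matrix.det_apply]
    refine 𝓛.sum_mem fun σ _ => ?_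
    rw [Units.smul_def]
    exact 𝓛.zsmul_mem (𝓛.prod_mem fun i _ => hEij _ _ (Or.inl (hf _))) _
  have hf0 : M D 0 0 = fun z => (x z).coord (Sum.elim s ![b 0, b' 0]) := by
    have : D.piecewise s o = s := by
      ext1 p
      by_cases hp : p ∈ D
      · simp [hp]
      · simp [hp, hD p hp]
    simp only [M, this]
  rw [← hf0]
  rw [Matrix.det_succ_row_zero, Fin.sum_univ_succ] at hE
  have h00 : E 0 0 = (∑ T ∈ D.powerset.erase D, Polynomial.C (M T 0 0) * Polynomial.X ^ T.card) +
      Polynomial.C (M D 0 0) * Polynomial.X ^ D.card :=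
    (Finset.sum_erase_add _ _ (Finset.mem_powerset_self D)).symm
  have hS1 : (∑ T ∈ D.powerset.erase D, Polynomial.C (M T 0 0) * Polynomial.X ^ T.card) ∈ 𝓛 :=
    𝓛.sum_mem fun T hT => hM T (Finset.mem_powerset.1 (Finset.mem_of_mem_erase hT)) 0 0
      (Or.inl (Finset.ne_of_mem_erase hT))
  have hS2 : (∑ i : Fin r, (-1) ^ ((i.succ : Fin (r + 1)) : ℕ) * E 0 i.succ *
      (E.submatrix Fin.succ i.succ.succAbove).det) ∈ 𝓛 :=
    𝓛.sum_mem fun i _ => 𝓛.mul_mem (𝓛.mul_mem (𝓛.pow_mem (𝓛.neg_mem 𝓛.one_mem) _)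
      (hEij _ _ (Or.inr (Fin.succ_ne_zero i)))) (hdet _ _ fun i => Fin.succ_ne_zero i)
  have hmain : Polynomial.C (M D 0 0) * Polynomial.X ^ D.card *
      (E.submatrix Fin.succ (Fin.succAbove 0)).det ∈ 𝓛 := by
    have : Polynomial.C (M D 0 0) * Polynomial.X ^ D.card *
      (E.submatrix Fin.succ (Fin.succAbove 0)).det =
        -((∑ T ∈ D.powerset.erase D, Polynomial.C (M T 0 0) * Polynomial.X ^ T.card) *
          (E.submatrix Fin.succ (Fin.succAbove 0)).det) -
        (∑ i : Fin r, (-1) ^ ((i.succ : Fin (r + 1)) : ℕ) * E 0 i.succ *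
          (E.submatrix Fin.succ i.succ.succAbove).det) := by
      rw [h00] at hE
      simp only [Fin.val_zero, pow_zero, one_mul] at hE
      linear_combination hE
    rw [this]
    exact 𝓛.sub_mem (𝓛.neg_mem (𝓛.mul_mem hS1 (hdet _ _ fun i => Fin.succ_ne_zero i))) hS2
  -- The coefficient of `t ^ D.card` in `hmain` is the wanted coordinate times the constant term of
  -- the complementary minor, in which all fixed arguments are those of `o`.
  apply hdiv
  have h3 := hcoeff _ hmain D.card
  rw [mul_assoc, Polynomial.coeff_C_mul, Polynomial.coeff_X_pow_mul', if_pos le_rfl,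
    Nat.sub_self, ← Polynomial.constantCoeff_apply, RingHom.map_det] at h3
  convert h3 using 2
  ext z
  refine Eq.trans ?_ (RingHom.map_det (Pi.evalRingHom (fun _ => K) z) _).symm
  congr 1
  ext i j
  simp only [Matrix.of_apply, RingHom.mapMatrix_apply, Matrix.map_apply, E, Matrix.submatrix_apply,
    Polynomial.constantCoeff_apply, Polynomial.coeff_X_pow, Fin.zero_succAbove, map_sum, map_mul]
  rw [Finset.sum_eq_single ∅]
  · simp [M]
  · intro T _ hT
    rw [if_neg (fun h => hT (Finset.card_eq_zero.1 h.symm)), map_zero, mul_zero]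
  · simp

theorem exists_perm_eqOn {α : Type*} [Finite α] {S : Set α} {f : α → α} (hf : Set.InjOn f S) :
    ∃ ρ : Equiv.Perm α, ∀ i ∈ S, ρ i = f i := by
  classical
  have := Fintype.ofFinite α
  obtain ⟨g, hg⟩ := Set.MapsTo.exists_equiv_extend_of_card_eq
    (show Fintype.card α = (Finset.univ : Finset α).card from rfl) (s := S) (f := f)
    (fun _ _ => by simp) hf
  exact ⟨g.trans (Equiv.subtypeUnivEquiv (by simp)), fun i hi => by simpa using hg i hi⟩

theorem coord_eq_zero (x : Form K ι P) {s : P → ι} (hs : ¬ Function.Injective s) :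
    x.coord s = 0 :=
  x.map_eq_zero_of_not_injective _ fun h => hs fun _ _ hij => h (congrArg (unit K) hij)

theorem coord_comp_perm [Fintype P] [DecidableEq P] (x : Form K ι P) (s : P → ι)
    (ρ : Equiv.Perm P) : x.coord (s ∘ ρ) = Equiv.Perm.sign ρ • x.coord s :=
  x.map_perm (fun p => unit K (s p)) ρ

theorem coord_mem_of_comp_perm [Finite P] {Z : Type*} (𝓑 : Subalgebra K (Z → K))
    {x : Z → Form K ι P} {s : P → ι} (ρ : Equiv.Perm P)
    (h : (fun z => (x z).coord (s ∘ ρ)) ∈ 𝓑) : (fun z => (x z).coord s) ∈ 𝓑 := by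
  classical
  have := Fintype.ofFinite P
  simp only [coord_comp_perm] at h
  have h2 : (fun z => (x z).coord s) = ((Equiv.Perm.sign ρ : ℤˣ) : ℤ) •
      fun z => Equiv.Perm.sign ρ • (x z).coord s := by
    ext z
    rw [Pi.smul_apply, ← Units.smul_def, smul_smul, Int.units_mul_self, one_smul]
  rw [h2]
  exact 𝓑.toSubring.zsmul_mem h _

open Classical in
/-- The weight of a coordinate: the total weight `ω` of the indices that occur plus the total
weight `ω'` of those that do not. -/
noncomputable def weight [Fintype ι] [Fintype P] (ω ω' : ι → ℕ) (s : P → ι) : ℕ :=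
  ∑ p, ω (s p) + ∑ i, if i ∈ Set.range s then 0 else ω' i

theorem weight_comp_perm [Fintype ι] [Fintype P] (ω ω' : ι → ℕ) (s : P → ι)
    (ρ : Equiv.Perm P) : weight ω ω' (s ∘ ρ) = weight ω ω' s := by
  classical
  unfold weight
  congr 1
  · exact Equiv.sum_comp ρ fun p => ω (s p)
  · exact Finset.sum_congr rfl fun i _ => by
      simp only [ρ.surjective.range_comp]

/-- Coordinates of a form of bounded rank are determined by coordinates of smaller weight. -/
theorem coord_mem_of_weight [Infinite K] [Fintype ι] [Fintype P] {Z : Type*}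
    (𝓑 : Subalgebra K (Z → K)) {r : ℕ} {x : Z → Form K ι (P ⊕ Fin 2)}
    (hx : ∀ z, ¬ HasRank (r + 1) (x z)) {o : P → ι} (ho : Function.Injective o)
    (a a' : Fin r → ι)
    (hdiv : ∀ f : Z → K, (f * fun z => (Matrix.of fun i j : Fin r => (x z).coord
      (Sum.elim o ![a i, a' j])).det) ∈ 𝓑 → f ∈ 𝓑)
    (ω ω' : ι → ℕ) (hω : ∀ p, ω (o p) = 0) (hω' : ∀ p, 0 < ω' (o p))
    (hω'' : ∀ i ∉ Set.range o, ω' i = 0) (s : P ⊕ Fin 2 → ι) (hs : Function.Injective s)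
    (q q' : P ⊕ Fin 2) (hq : q ≠ q') (hq₀ : 0 < ω (s q)) (hq₀' : 0 < ω (s q'))
    (ha : ∀ i, ω (a i) < ω (s q)) (ha' : ∀ i, ω (a' i) < ω (s q'))
    (ih : ∀ s' : P ⊕ Fin 2 → ι, Function.Injective s' → weight ω ω' s' < weight ω ω' s →
      (fun z => (x z).coord s') ∈ 𝓑) :
    (fun z => (x z).coord s) ∈ 𝓑 := by
  classical
  -- The arguments are reordered, at the cost of a sign, so that the two heavy indices occupy the
  -- slots and every index `o p` that occurs stands at its own position `p`. The requirements are
  -- compatible because the indices `o p` have `ω`-weight zero.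
  obtain ⟨ρ, hρ⟩ : ∃ ρ : Equiv.Perm (P ⊕ Fin 2), ρ (Sum.inr 0) = q ∧ ρ (Sum.inr 1) = q' ∧
      ∀ p, o p ∈ Set.range s → s (ρ (Sum.inl p)) = o p := by
    let g : P ⊕ Fin 2 → P ⊕ Fin 2 := Sum.elim
      (fun p => if h : o p ∈ Set.range s then h.choose else q) ![q, q']
    have hg : ∀ p, o p ∈ Set.range s → s (g (Sum.inl p)) = o p := fun p h => by
      simp only [g, Sum.elim_inl, dif_pos h]
      exact h.choose_spec
    obtain ⟨ρ, hρ⟩ := exists_perm_eqOn (f := g)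
      (S := {i | ∀ p, i = Sum.inl p → o p ∈ Set.range s}) (by
        have h1 : ∀ p, o p ∈ Set.range s → ∀ j, g (Sum.inl p) ≠ g (Sum.inr j) := by
          intro p hp j h
          have h2 := hg p hp
          rw [h] at h2
          have h3 := hω p
          rw [← h2] at h3
          fin_cases j
          · exact hq₀.ne' h3
          · exact hq₀'.ne' h3
        rintro (p | i) hi (p' | j) hj hij
        · refine congrArg _ (ho ?_)
          rw [← hg p (hi p rfl), ← hg p' (hj p' rfl), hij]
        · exact absurd hij (h1 p (hi p rfl) j)
        · exact absurd hij.symm (h1 p' (hj p' rfl) i)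
        · fin_cases i <;> fin_cases j
          · rfl
          · exact absurd hij hq
          · exact absurd hij.symm hq
          · rfl)
    refine ⟨ρ, hρ _ (by simp), hρ _ (by simp), fun p hp => ?_⟩
    rw [hρ _ (by rintro p' hp'; rw [Sum.inl.injEq] at hp'; rwa [← hp']), hg p hp]
  obtain ⟨hρ0, hρ1, hρ2⟩ := hρ
  apply coord_mem_of_comp_perm 𝓑 ρ
  rw [← weight_comp_perm ω ω' s ρ] at ih
  have hinj : Function.Injective (s ∘ ρ) := hs.comp ρ.injective
  rw [← hρ0] at ha
  rw [← hρ1] at ha'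
  have hnorm : ∀ p, o p ∈ Set.range (s ∘ ρ) → (s ∘ ρ) (Sum.inl p) = o p := by
    rw [ρ.surjective.range_comp]
    exact hρ2
  change ∀ i, ω (a i) < ω ((s ∘ ρ) (Sum.inr 0)) at ha
  change ∀ i, ω (a' i) < ω ((s ∘ ρ) (Sum.inr 1)) at ha'
  generalize s ∘ ρ = s at *
  let D : Finset P := Finset.univ.filter fun p => s (Sum.inl p) ≠ o p
  have hs' : s = Sum.elim (fun p => s (Sum.inl p)) ![s (Sum.inr 0), s (Sum.inr 1)] := by
    ext1 p
    rcases p with p | p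
    · rfl
    · fin_cases p <;> rfl
  rw [hs']
  refine coord_mem_of_not_hasRank 𝓑 hx (D := D) (o := o) (by simp [D])
    (Fin.cons (s (Sum.inr 0)) a) (Fin.cons (s (Sum.inr 1)) a') (by simpa using hdiv) ?_
  intro T hT i j hij
  generalize hb : (Fin.cons (s (Sum.inr 0)) a : Fin (r + 1) → ι) i = b
  generalize hb' : (Fin.cons (s (Sum.inr 1)) a' : Fin (r + 1) → ι) j = b'
  have hb1 : ω b ≤ ω (s (Sum.inr 0)) ∧ (i ≠ 0 → ω b < ω (s (Sum.inr 0))) := by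
    rw [← hb]
    refine Fin.cases ?_ (fun i => ?_) i
    · simp
    · simpa using ⟨(ha i).le, ha i⟩
  have hb2 : ω b' ≤ ω (s (Sum.inr 1)) ∧ (j ≠ 0 → ω b' < ω (s (Sum.inr 1))) := by
    rw [← hb']
    refine Fin.cases ?_ (fun i => ?_) j
    · simp
    · simpa using ⟨(ha' i).le, ha' i⟩
  by_cases hζ : Function.Injective
    (Sum.elim (T.piecewise (fun p => s (Sum.inl p)) o) ![b, b'] : P ⊕ Fin 2 → ι)
  swap
  · simp only [coord_eq_zero _ hζ]
    exact 𝓑.zero_mem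
  refine ih _ hζ ?_
  have hT' : ∀ p ∈ T, s (Sum.inl p) ≠ o p := fun p hp => by
    have := hT hp
    simpa [D] using this
  have h1 : ∀ p, ω (T.piecewise (fun p => s (Sum.inl p)) o p) ≤ ω (s (Sum.inl p)) := by
    intro p
    by_cases hp : p ∈ T
    · simp [hp]
    · simp [hp, hω]
  have h2 : ∀ p ∉ T, o p ∈ Set.range
      (Sum.elim (T.piecewise (fun p => s (Sum.inl p)) o) ![b, b'] : P ⊕ Fin 2 → ι) := fun p hp =>
    ⟨Sum.inl p, by simp [hp]⟩
  have h3 : ∀ i, (if i ∈ Set.range (Sum.elim (T.piecewise (fun p => s (Sum.inl p)) o) ![b, b'])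
      then 0 else ω' i) ≤ if i ∈ Set.range s then 0 else ω' i := by
    intro i
    by_cases hi : i ∈ Set.range o
    · obtain ⟨p, rfl⟩ := hi
      by_cases hp : p ∈ T
      · rw [if_neg (c := o p ∈ Set.range s) fun h => hT' p hp (hnorm p h)]
        split_ifs <;> simp
      · rw [if_pos (h2 p hp)]
        exact Nat.zero_le _
    · simp [hω'' i hi]
  have h4 := Finset.sum_le_sum fun i (_ : i ∈ Finset.univ) => h3 i
  have h5 := Finset.sum_le_sum fun p (_ : p ∈ Finset.univ) => h1 p
  unfold weight
  simp only [Fintype.sum_sum_type, Sum.elim_inl, Sum.elim_inr, Fin.sum_univ_two,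
    Matrix.cons_val_zero, Matrix.cons_val_one]
  -- If `T ≠ D`, some index `o p` that was missing from `s` now occurs, and its positive `ω'`-weight
  -- disappears from the sum. In the other cases a slot index is replaced by one of smaller
  -- `ω`-weight.
  rcases hij with hij | hij | hij
  · obtain ⟨p, hpD, hpT⟩ := Finset.exists_of_ssubset (Finset.ssubset_iff_subset_ne.2 ⟨hT, hij⟩)
    have h6 := Finset.sum_lt_sum (fun i (_ : i ∈ Finset.univ) => h3 i) ⟨o p, Finset.mem_univ _, by
      rw [if_pos (h2 p hpT), if_neg fun h => ?_]
      · exact hω' p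
      · have := hnorm p h
        simp [D, this] at hpD⟩
    omega
  · have := hb1.2 hij
    omega
  · have := hb2.2 hij
    omega

end Form

/-! ### Localised algebras of functions. -/

section Localize

variable {K : Type*} [Field K] {Z σ τ : Type*}

/-- The algebra of functions that become elements of `𝓐` after multiplication with a power
of `w`. -/
def Subalgebra.localize (𝓐 : Subalgebra K (Z → K)) {w : Z → K} (hw : w ∈ 𝓐) :
    Subalgebra K (Z → K) where
  carrier := {f | ∃ k : ℕ, w ^ k * f ∈ 𝓐}
  mul_mem' := by
    rintro f g ⟨k, hf⟩ ⟨l, hg⟩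
    refine ⟨k + l, ?_⟩
    have := 𝓐.mul_mem hf hg
    rwa [show w ^ (k + l) * (f * g) = w ^ k * f * (w ^ l * g) by ring]
  add_mem' := by
    rintro f g ⟨k, hf⟩ ⟨l, hg⟩
    refine ⟨k + l, ?_⟩
    have := 𝓐.add_mem (𝓐.mul_mem (𝓐.pow_mem hw l) hf) (𝓐.mul_mem (𝓐.pow_mem hw k) hg)
    rwa [show w ^ (k + l) * (f + g) = w ^ l * (w ^ k * f) + w ^ k * (w ^ l * g) by ring]
  algebraMap_mem' c := ⟨0, by simp⟩

/-- Division by the factor `h` is multiplication by `g / w`. -/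
theorem Subalgebra.mem_localize_of_mul {𝓐 : Subalgebra K (Z → K)} {w : Z → K} {hw : w ∈ 𝓐}
    {f g h : Z → K} (hg : g ∈ 𝓐) (hgh : w = g * h) (hf : f * h ∈ 𝓐.localize hw) :
    f ∈ 𝓐.localize hw := by
  obtain ⟨k, hk⟩ := hf
  refine ⟨k + 1, ?_⟩
  have := 𝓐.mul_mem hg hk
  rwa [show w ^ (k + 1) * f = g * (w ^ k * (f * h)) by rw [pow_succ]; nth_rw 2 [hgh]; ring]

/-- The algebra of polynomial expressions in a tuple of functions. -/
def pullbackAlg (π : Z → σ → K) : Subalgebra K (Z → K) where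
  carrier := {f | ∃ G ∈ polyFun K σ, ∀ z, f z = G (π z)}
  mul_mem' := by
    rintro f g ⟨F, hF, hf⟩ ⟨G, hG, hg⟩
    exact ⟨F * G, (polyFun K σ).mul_mem hF hG, fun z => by simp [hf, hg]⟩
  add_mem' := by
    rintro f g ⟨F, hF, hf⟩ ⟨G, hG, hg⟩
    exact ⟨F + G, (polyFun K σ).add_mem hF hG, fun z => by simp [hf, hg]⟩
  algebraMap_mem' c := ⟨fun _ => c, polyFun_const c, fun z => rfl⟩

theorem comp_mem_of_polyFun (𝓑 : Subalgebra K (Z → K)) {F : Z → τ → K}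
    (hF : ∀ i, (fun z => F z i) ∈ 𝓑) {g : (τ → K) → K} (hg : g ∈ polyFun K τ) :
    (fun z => g (F z)) ∈ 𝓑 := by
  obtain ⟨p, hp⟩ := hg
  simp only [hp]
  induction p using MvPolynomial.induction_on generalizing g with
  | C c =>
    simp only [MvPolynomial.eval_C]
    exact 𝓑.algebraMap_mem c
  | add p q h1 h2 =>
    simp only [map_add]
    exact 𝓑.add_mem (h1 (g := fun x => MvPolynomial.eval x p) fun _ => rfl)
      (h2 (g := fun x => MvPolynomial.eval x q) fun _ => rfl)
  | mul_X p i h =>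
    simp only [map_mul, MvPolynomial.eval_X]
    exact 𝓑.mul_mem (h (g := fun x => MvPolynomial.eval x p) fun _ => rfl) (hF i)

end Localize

/-! ### Reduction to coordinates with few variable indices, using a form and its dual. -/

namespace Form

variable {K : Type*} [Field K] {ι ι' P P' N N' κ : Type}

/-- For permuted standard bases the volume factor is the sign: dual coordinates are complementary
coordinates up to sign. -/
theorem IsStar.coord_perm [Fintype P] [Fintype N] [DecidableEq P] [DecidableEq N]
    {x : Form K (P ⊕ N) P} {y : Form K (P ⊕ N) N} (h : IsStar (vol (Equiv.refl _)) x y)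
    (σ : Equiv.Perm (P ⊕ N)) :
    y.coord (σ ∘ Sum.inr) = ((Equiv.Perm.sign σ : ℤ) : K) * x.coord (σ ∘ Sum.inl) := by
  have h1 := h _ _ (dualBases_unit σ)
  have h2 : vol (Equiv.refl (P ⊕ N)) (fun i => unit K (σ i)) = ((Equiv.Perm.sign σ : ℤ) : K) := by
    have h3 := (vol (K := K) (Equiv.refl (P ⊕ N))).map_perm (fun i => unit K i) σ
    have h4 : vol (K := K) (Equiv.refl (P ⊕ N)) (fun i => unit K i) = 1 :=
      vol_unit (K := K) (Equiv.refl (P ⊕ N))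
    rw [h4] at h3
    refine h3.trans ?_
    rw [Units.smul_def]
    simp
  rw [h2] at h1
  exact h1

theorem IsStar.coord_perm' [Fintype P] [Fintype N] [DecidableEq P] [DecidableEq N]
    {x : Form K (P ⊕ N) P} {y : Form K (P ⊕ N) N} (h : IsStar (vol (Equiv.refl _)) x y)
    (σ : Equiv.Perm (P ⊕ N)) :
    x.coord (σ ∘ Sum.inl) = ((Equiv.Perm.sign σ : ℤ) : K) * y.coord (σ ∘ Sum.inr) := by
  rw [h.coord_perm, ← mul_assoc, ← Int.cast_mul, ← Units.val_mul, Int.units_mul_self]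
  simp

theorem isStar_vol_swap [Fintype P] [Fintype N] {x : Form K (P ⊕ N) P} {y : Form K (P ⊕ N) N}
    (h : IsStar (vol (Equiv.refl _)) x y) : IsStar (vol (Equiv.sumComm N P)) y x := by
  classical
  intro G G' hG
  have h1 := h _ _ (hG.symm.comp (Equiv.sumComm P N))
  have e1 : (G' ∘ Equiv.sumComm P N) ∘ Sum.inr = G' ∘ Sum.inl := by ext i; simp
  have e2 : (G ∘ Equiv.sumComm P N) ∘ Sum.inl = G ∘ Sum.inr := by ext i; simp
  rw [e1, e2] at h1
  have h3 := vol_mul_vol (Equiv.refl _) (hG.comp (Equiv.sumComm P N))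
  have h4 : vol (Equiv.sumComm N P) G = vol (Equiv.refl _) (G ∘ Equiv.sumComm P N) := by
    rw [vol_apply, vol_apply]
    rfl
  rw [h4, h1, ← mul_assoc, h3, one_mul]

theorem weight_equiv [Fintype ι] [Fintype P] [Fintype N] (ω ω' : ι → ℕ) (σ : P ⊕ N ≃ ι) :
    weight ω ω' (σ ∘ Sum.inl) = ∑ p, ω (σ (Sum.inl p)) + ∑ n, ω' (σ (Sum.inr n)) := by
  classical
  unfold weight
  congr 1
  rw [← Equiv.sum_comp σ, Fintype.sum_sum_type]
  simp

/-- Passing to complementary indices exchanges occurring and missing ones, so one weight drives the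
induction for both the form and its dual. -/
theorem weight_equiv' [Fintype ι] [Fintype P] [Fintype N] (ω ω' : ι → ℕ) (σ : P ⊕ N ≃ ι) :
    weight ω' ω (σ ∘ Sum.inr) = weight ω ω' (σ ∘ Sum.inl) := by
  have h := weight_equiv ω' ω ((Equiv.sumComm N P).trans σ)
  have e : ((Equiv.sumComm N P).trans σ : N ⊕ P → ι) ∘ Sum.inl = σ ∘ Sum.inr := rfl
  rw [e] at h
  rw [h, weight_equiv, add_comm]
  rfl

/-- The index type of the arguments of a form: a variable part, two lists of `r` indices, and two
slots. -/
abbrev Side (B : Type) (r : ℕ) : Type := (B ⊕ (Fin r ⊕ Fin r)) ⊕ Fin 2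

/-- The weights of the elements of `Side B r`. -/
def sideWeight {B : Type} {r : ℕ} : Side B r → ℕ :=
  Sum.elim (Sum.elim (fun _ => 2) fun _ => 1) fun _ => 0

/-- All coordinates of a form of bounded rank whose dual has bounded rank are determined by the
coordinates that involve at most one variable index on either side. -/
theorem coord_mem_of_base [Infinite K] {Z : Type*} (𝓑 : Subalgebra K (Z → K)) {A B : Type}
    [Fintype A] [Fintype B] {r₁ r₂ : ℕ} {x : Z → Form K (Side B r₂ ⊕ Side A r₁) (Side B r₂)}
    {y : Z → Form K (Side B r₂ ⊕ Side A r₁) (Side A r₁)}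
    (hxy : ∀ z, IsStar (vol (Equiv.refl _)) (x z) (y z))
    (hx : ∀ z, ¬ HasRank (r₁ + 1) (x z)) (hy : ∀ z, ¬ HasRank (r₂ + 1) (y z))
    (hdiv : ∀ f : Z → K, (f * fun z => (Matrix.of fun i j : Fin r₁ => (x z).coord
      (Sum.elim (fun p => Sum.inl (Sum.inl p)) ![Sum.inr (Sum.inl (Sum.inr (Sum.inl i))),
        Sum.inr (Sum.inl (Sum.inr (Sum.inr j)))])).det) ∈ 𝓑 → f ∈ 𝓑)
    (hdiv' : ∀ f : Z → K, (f * fun z => (Matrix.of fun i j : Fin r₂ => (y z).coord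
      (Sum.elim (fun p => Sum.inr (Sum.inl p)) ![Sum.inl (Sum.inl (Sum.inr (Sum.inl i))),
        Sum.inl (Sum.inl (Sum.inr (Sum.inr j)))])).det) ∈ 𝓑 → f ∈ 𝓑)
    (base : ∀ σ : Equiv.Perm (Side B r₂ ⊕ Side A r₁),
      (∀ a a' p p', σ (Sum.inl p) = Sum.inr (Sum.inl (Sum.inl a)) →
        σ (Sum.inl p') = Sum.inr (Sum.inl (Sum.inl a')) → a = a') →
      (∀ b b' n n', σ (Sum.inr n) = Sum.inl (Sum.inl (Sum.inl b)) →
        σ (Sum.inr n') = Sum.inl (Sum.inl (Sum.inl b')) → b = b') →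
      (fun z => (x z).coord (σ ∘ Sum.inl)) ∈ 𝓑) (s : Side B r₂ → Side B r₂ ⊕ Side A r₁) :
    (fun z => (x z).coord s) ∈ 𝓑 := by
  classical
  -- Right indices are counted when they occur, left indices when they are missing. Weight 2 for
  -- variable indices exceeds weight 1 for the listed indices in the minors; the slots have weight
  -- 0, so positivity on a side holds exactly for the indices fixed in the minor.
  let ω : Side B r₂ ⊕ Side A r₁ → ℕ := Sum.elim 0 sideWeight
  let ω' : Side B r₂ ⊕ Side A r₁ → ℕ := Sum.elim sideWeight 0
  have hsign : ∀ (σ : Equiv.Perm (Side B r₂ ⊕ Side A r₁)) (f : Z → K), f ∈ 𝓑 →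
      (fun z => ((Equiv.Perm.sign σ : ℤ) : K) * f z) ∈ 𝓑 := fun σ f hf =>
    𝓑.mul_mem (𝓑.algebraMap_mem ((Equiv.Perm.sign σ : ℤ) : K)) hf
  have key : ∀ n, ∀ σ : Equiv.Perm (Side B r₂ ⊕ Side A r₁), weight ω ω' (σ ∘ Sum.inl) = n →
      (fun z => (x z).coord (σ ∘ Sum.inl)) ∈ 𝓑 := by
    intro n
    induction n using Nat.strong_induction_on with
    | _ n ih =>
    intro σ hσ
    by_cases hA : ∃ a a' p p', σ (Sum.inl p) = Sum.inr (Sum.inl (Sum.inl a)) ∧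
        σ (Sum.inl p') = Sum.inr (Sum.inl (Sum.inl a')) ∧ a ≠ a'
    · obtain ⟨a, a', p, p', hp, hp', haa'⟩ := hA
      refine coord_mem_of_weight 𝓑 hx (o := fun p => Sum.inl (Sum.inl p))
        (Sum.inl_injective.comp Sum.inl_injective) _ _ hdiv ω ω' (by simp [ω]) ?_ ?_ _
        (σ.injective.comp Sum.inl_injective) p p' ?_ ?_ ?_ ?_ ?_ ?_
      · rintro (p | p) <;> simp [ω', sideWeight]
      · rintro ((i | i) | i) hi
        · exact absurd ⟨i, rfl⟩ hi
        · simp [ω', sideWeight]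
        · simp [ω']
      · rintro rfl
        rw [hp] at hp'
        simp at hp'
        exact haa' hp'
      · simp [hp, ω, sideWeight]
      · simp [hp', ω, sideWeight]
      · simp [hp, ω, sideWeight]
      · simp [hp', ω, sideWeight]
      · intro s' hs' hlt
        obtain ⟨σ', hσ'⟩ := exists_equiv_extend (Equiv.sumComm (Side A r₁) (Side B r₂)) s' hs'
        have e : s' = ((Equiv.sumComm _ _).trans σ' : Equiv.Perm _) ∘ Sum.inl := by
          ext1 q
          simp [hσ']
        rw [e] at hlt ⊢
        exact ih _ (hσ ▸ hlt) _ rfl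
    by_cases hB : ∃ b b' n n', σ (Sum.inr n) = Sum.inl (Sum.inl (Sum.inl b)) ∧
        σ (Sum.inr n') = Sum.inl (Sum.inl (Sum.inl b')) ∧ b ≠ b'
    · obtain ⟨b, b', q, q', hq, hq', hbb'⟩ := hB
      simp only [fun z => (hxy z).coord_perm' σ]
      apply hsign
      rw [← weight_equiv'] at hσ
      refine coord_mem_of_weight 𝓑 hy (o := fun p => Sum.inr (Sum.inl p))
        (Sum.inr_injective.comp Sum.inl_injective) _ _ hdiv' ω' ω (by simp [ω']) ?_ ?_ _
        (σ.injective.comp Sum.inr_injective) q q' ?_ ?_ ?_ ?_ ?_ ?_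
      · rintro (p | p) <;> simp [ω, sideWeight]
      · rintro (i | (i | i)) hi
        · simp [ω]
        · exact absurd ⟨i, rfl⟩ hi
        · simp [ω, sideWeight]
      · rintro rfl
        rw [hq] at hq'
        simp at hq'
        exact hbb' hq'
      · simp [hq, ω', sideWeight]
      · simp [hq', ω', sideWeight]
      · simp [hq, ω', sideWeight]
      · simp [hq', ω', sideWeight]
      · intro s' hs' hlt
        obtain ⟨σ', hσ'⟩ := exists_equiv_extend (Equiv.refl (Side B r₂ ⊕ Side A r₁)) s' hs'
        have e : s' = σ' ∘ Sum.inr := by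
          ext1 q
          simp [hσ']
        rw [e] at hlt ⊢
        simp only [fun z => (hxy z).coord_perm σ']
        apply hsign
        rw [weight_equiv'] at hlt
        exact ih _ (hσ ▸ hlt) _ rfl
    push Not at hA hB
    exact base σ hA hB
  by_cases hs : Function.Injective s
  · obtain ⟨σ', hσ'⟩ := exists_equiv_extend (Equiv.sumComm (Side A r₁) (Side B r₂)) s hs
    have e : s = ((Equiv.sumComm _ _).trans σ' : Equiv.Perm _) ∘ Sum.inl := by
      ext1 q
      simp [hσ']
    rw [e]
    exact key _ _ rfl
  · simp only [coord_eq_zero _ hs]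
    exact 𝓑.zero_mem

end Form

/-! ### Windows in the index set, and the action of matrices on their coordinates. -/

namespace Form

variable {K : Type*} [Field K] {ι ι' P P' N N' κ : Type}

theorem linearCombination_unit [Fintype ι] {V : Type*} [AddCommGroup V] [Module K V] (c : ι → V)
    (i : ι) : Fintype.linearCombination K c (unit K i) = c i := by
  rw [Fintype.linearCombination_apply, Finset.sum_eq_single i]
  · simp
  · intro j _ hj
    rw [unit_of_ne hj, zero_smul]
  · simp

theorem coord_comp_eq {x : Form K ι P} {f : (ι' → K) →ₗ[K] (ι → K)} {s' : P → ι'} {s : P → ι}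
    (h : ∀ p, f (unit K (s' p)) = unit K (s p)) : Form.coord (x.compLinearMap f) s' = x.coord s := by
  simp only [coord, AlternatingMap.compLinearMap_apply, h]

theorem coord_comp_eq_sum {x : Form K ι P} {f : (ι' → K) →ₗ[K] (ι → K)} {s' : P → ι'}
    {A : Type*} [Fintype A] {s : A → P → ι} (p₀ : P) {c : A → K}
    (h : ∀ p, p ≠ p₀ → ∀ a, f (unit K (s' p)) = unit K (s a p))
    (h₀ : f (unit K (s' p₀)) = ∑ a, c a • unit K (s a p₀)) :
    Form.coord (x.compLinearMap f) s' = ∑ a, c a * x.coord (s a) := by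
  classical
  have e : (fun p => f (unit K (s' p))) =
      Function.update (fun p => f (unit K (s' p))) p₀ (∑ a, c a • unit K (s a p₀)) := by
    rw [← h₀, Function.update_eq_self]
  simp only [coord, AlternatingMap.compLinearMap_apply]
  rw [e, AlternatingMap.map_update_sum]
  refine Finset.sum_congr rfl fun a _ => ?_
  rw [AlternatingMap.map_update_smul, smul_eq_mul]
  congr 2
  ext1 p
  by_cases hp : p = p₀
  · rw [hp, Function.update_self]
  · rw [Function.update_of_ne hp, h p hp a]

variable {A B A' B' : Type} {r r₁ r₂ α β : ℕ}

/-- Map the variable part of a side. -/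
def sideMap (k : Fin α ↪ B) (r : ℕ) : Side (Fin α) r ↪ Side B r :=
  (k.sumMap (Function.Embedding.refl _)).sumMap (Function.Embedding.refl _)

theorem sideMap_cases (k : Fin α ↪ B) (p : Side B r) :
    (∃ w, p = sideMap k r w) ∨ ∃ b, b ∉ Set.range k ∧ p = Sum.inl (Sum.inl b) := by
  rcases p with (b | w) | c
  · by_cases hb : b ∈ Set.range k
    · obtain ⟨i, rfl⟩ := hb
      exact Or.inl ⟨Sum.inl (Sum.inl i), rfl⟩
    · exact Or.inr ⟨b, hb, rfl⟩
  · exact Or.inl ⟨Sum.inl (Sum.inr w), rfl⟩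
  · exact Or.inl ⟨Sum.inr c, rfl⟩

theorem sideMap_ne (k : Fin α ↪ B) {b : B} (hb : b ∉ Set.range k) (w : Side (Fin α) r) :
    sideMap k r w ≠ Sum.inl (Sum.inl b) := by
  rcases w with (i | w) | c
  · intro h
    have : k i = b := by simpa [sideMap] using h
    exact hb ⟨i, this⟩
  · simp [sideMap]
  · simp [sideMap]

/-- The embedding of the index set of a window. -/
def windowEmb (j : Fin β ↪ A) (k : Fin α ↪ B) (r₁ r₂ : ℕ) :
    Side (Fin α) r₂ ⊕ Side (Fin β) r₁ ↪ Side B r₂ ⊕ Side A r₁ :=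
  (sideMap k r₂).sumMap (sideMap j r₁)

@[simp] theorem windowEmb_inl (j : Fin β ↪ A) (k : Fin α ↪ B) (w : Side (Fin α) r₂) :
    windowEmb j k r₁ r₂ (Sum.inl w) = Sum.inl (sideMap k r₂ w) := rfl

@[simp] theorem windowEmb_inr (j : Fin β ↪ A) (k : Fin α ↪ B) (w : Side (Fin β) r₁) :
    windowEmb j k r₁ r₂ (Sum.inr w) = Sum.inr (sideMap j r₁ w) := rfl

/-- Extend a permutation of the index set of a window by the identity. -/
noncomputable def windowPerm (τ : Equiv.Perm (Side (Fin α) r₂ ⊕ Side (Fin β) r₁)) (j : Fin β ↪ A)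
    (k : Fin α ↪ B) : Equiv.Perm (Side B r₂ ⊕ Side A r₁) :=
  open Classical in τ.viaFintypeEmbedding (windowEmb j k r₁ r₂)

section

variable (τ : Equiv.Perm (Side (Fin α) r₂ ⊕ Side (Fin β) r₁)) (j : Fin β ↪ A) (k : Fin α ↪ B)

theorem windowPerm_emb (w : Side (Fin α) r₂ ⊕ Side (Fin β) r₁) :
    windowPerm τ j k (windowEmb j k r₁ r₂ w) = windowEmb j k r₁ r₂ (τ w) := by
  classical
  exact Equiv.Perm.viaFintypeEmbedding_apply_image _ _ _

theorem windowPerm_of_notMem {i : Side B r₂ ⊕ Side A r₁}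
    (hi : i ∉ Set.range (windowEmb j k r₁ r₂)) : windowPerm τ j k i = i := by
  classical
  exact Equiv.Perm.viaFintypeEmbedding_apply_notMem_range _ _ hi

theorem windowPerm_inl (w : Side (Fin α) r₂) :
    windowPerm τ j k (Sum.inl (sideMap k r₂ w)) = windowEmb j k r₁ r₂ (τ (Sum.inl w)) :=
  windowPerm_emb τ j k (Sum.inl w)

theorem windowPerm_inr (w : Side (Fin β) r₁) :
    windowPerm τ j k (Sum.inr (sideMap j r₁ w)) = windowEmb j k r₁ r₂ (τ (Sum.inr w)) :=
  windowPerm_emb τ j k (Sum.inr w)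

theorem inl_notMem_range {b : B} (hb : b ∉ Set.range k) :
    (Sum.inl (Sum.inl (Sum.inl b)) : Side B r₂ ⊕ Side A r₁) ∉
      Set.range (windowEmb j k r₁ r₂) := by
  rintro ⟨w | w, h⟩
  · exact sideMap_ne k hb w (by simpa using h)
  · simp at h

theorem inr_notMem_range {a : A} (ha : a ∉ Set.range j) :
    (Sum.inr (Sum.inl (Sum.inl a)) : Side B r₂ ⊕ Side A r₁) ∉
      Set.range (windowEmb j k r₁ r₂) := by
  rintro ⟨w | w, h⟩
  · simp at h
  · exact sideMap_ne j ha w (by simpa using h)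

theorem sign_windowPerm [Fintype A] [Fintype B] [DecidableEq A] [DecidableEq B] :
    Equiv.Perm.sign (windowPerm τ j k) = Equiv.Perm.sign τ := by
  unfold windowPerm
  convert Equiv.Perm.viaFintypeEmbedding_sign τ (windowEmb j k r₁ r₂)

end

/-- The linear map acting on the variable part of the right side by a matrix. -/
noncomputable def actRight [Fintype A] [Fintype A'] [Fintype B] (φ : Matrix A' A K) (r₁ r₂ : ℕ) :
    (Side B r₂ ⊕ Side A' r₁ → K) →ₗ[K] (Side B r₂ ⊕ Side A r₁ → K) :=
  Fintype.linearCombination K (Sum.elim (fun p => unit K (Sum.inl p))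
    (Sum.elim (Sum.elim (fun a' => ∑ a, φ a' a • unit K (Sum.inr (Sum.inl (Sum.inl a))))
      fun w => unit K (Sum.inr (Sum.inl (Sum.inr w)))) fun c => unit K (Sum.inr (Sum.inr c))))

/-- The linear map acting on the variable part of the left side by a matrix. -/
noncomputable def actLeft [Fintype A] [Fintype B] [Fintype B'] (ψ : Matrix B' B K) (r₁ r₂ : ℕ) :
    (Side B' r₂ ⊕ Side A r₁ → K) →ₗ[K] (Side B r₂ ⊕ Side A r₁ → K) :=
  Fintype.linearCombination K (Sum.elim
    (Sum.elim (Sum.elim (fun b' => ∑ b, ψ b' b • unit K (Sum.inl (Sum.inl (Sum.inl b))))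
      fun w => unit K (Sum.inl (Sum.inl (Sum.inr w)))) fun c => unit K (Sum.inl (Sum.inr c)))
    (fun p => unit K (Sum.inr p)))

section

variable [Fintype A] [Fintype A'] [Fintype B] (φ : Matrix A' A K)

theorem actRight_inl (p : Side B r₂) :
    actRight φ r₁ r₂ (unit K (Sum.inl p)) = unit K (Sum.inl p) :=
  linearCombination_unit _ _

theorem actRight_emb (j : Fin β ↪ A) (j' : Fin β ↪ A') (k : Fin α ↪ B)
    (w : Side (Fin α) r₂ ⊕ Side (Fin β) r₁) (hw : ∀ i, w ≠ Sum.inr (Sum.inl (Sum.inl i))) :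
    actRight φ r₁ r₂ (unit K (windowEmb j' k r₁ r₂ w)) = unit K (windowEmb j k r₁ r₂ w) := by
  refine (linearCombination_unit _ _).trans ?_
  rcases w with w | (i | w) | c
  · rfl
  · exact absurd rfl (hw i)
  · rfl
  · rfl

theorem actRight_slot (a' : A') :
    actRight φ r₁ r₂ (unit K (Sum.inr (Sum.inl (Sum.inl a')))) =
      ∑ a, φ a' a • unit K (Sum.inr (Sum.inl (Sum.inl a)) : Side B r₂ ⊕ Side A r₁) :=
  linearCombination_unit _ _

theorem coord_actRight_zero (x : Form K (Side B r₂ ⊕ Side A r₁) (Side B r₂))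
    (τ : Equiv.Perm (Side (Fin α) r₂ ⊕ Side (Fin 0) r₁)) (j : Fin 0 ↪ A) (j' : Fin 0 ↪ A')
    (k : Fin α ↪ B) : Form.coord (x.compLinearMap (actRight φ r₁ r₂)) (windowPerm τ j' k ∘ Sum.inl) =
      x.coord (windowPerm τ j k ∘ Sum.inl) := by
  refine coord_comp_eq fun p => ?_
  simp only [Function.comp_apply]
  rcases sideMap_cases k p with ⟨w, rfl⟩ | ⟨b, hb, rfl⟩
  · rw [windowPerm_inl, windowPerm_inl, actRight_emb φ j j' k _ fun i => i.elim0]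
  · rw [windowPerm_of_notMem _ _ _ (inl_notMem_range _ _ hb),
      windowPerm_of_notMem _ _ _ (inl_notMem_range _ _ hb), actRight_inl]

/-- The hypothesis on `τ` puts the variable right index into exactly one argument; the map fixes the
unit vectors in all others, so multilinearity gives a single sum. -/
theorem coord_actRight_one (x : Form K (Side B r₂ ⊕ Side A r₁) (Side B r₂))
    (τ : Equiv.Perm (Side (Fin α) r₂ ⊕ Side (Fin 1) r₁))
    (hτ : ∃ p, τ (Sum.inl p) = Sum.inr (Sum.inl (Sum.inl 0))) (j : A → Fin 1 ↪ A)
    (hj : ∀ a, j a 0 = a) (j' : Fin 1 ↪ A') (k : Fin α ↪ B) :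
    Form.coord (x.compLinearMap (actRight φ r₁ r₂)) (windowPerm τ j' k ∘ Sum.inl) =
      ∑ a, φ (j' 0) a * x.coord (windowPerm τ (j a) k ∘ Sum.inl) := by
  obtain ⟨p₀, hp₀⟩ := hτ
  refine coord_comp_eq_sum (sideMap k r₂ p₀) (fun p hp a => ?_) ?_
  · simp only [Function.comp_apply]
    rcases sideMap_cases k p with ⟨w, rfl⟩ | ⟨b, hb, rfl⟩
    · rw [windowPerm_inl, windowPerm_inl, actRight_emb φ (j a) j' k]
      intro i h
      rw [Subsingleton.elim i 0, ← hp₀] at h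
      exact hp (congrArg _ (Sum.inl_injective (τ.injective h)))
    · rw [windowPerm_of_notMem _ _ _ (inl_notMem_range _ _ hb),
        windowPerm_of_notMem _ _ _ (inl_notMem_range _ _ hb), actRight_inl]
  · simp only [Function.comp_apply, windowPerm_inl, hp₀]
    have h1 : ∀ a, windowEmb (j a) k r₁ r₂ (Sum.inr (Sum.inl (Sum.inl 0))) =
        Sum.inr (Sum.inl (Sum.inl a)) := fun a => by
      conv_rhs => rw [← hj a]
      rfl
    simp only [h1]
    exact actRight_slot φ (j' 0)

end

section

variable [Fintype A] [Fintype B] [Fintype B'] (ψ : Matrix B' B K)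

theorem actLeft_inr (p : Side A r₁) :
    actLeft ψ r₁ r₂ (unit K (Sum.inr p)) = unit K (Sum.inr p) :=
  linearCombination_unit _ _

theorem actLeft_emb (j : Fin β ↪ A) (k : Fin α ↪ B) (k' : Fin α ↪ B')
    (w : Side (Fin α) r₂ ⊕ Side (Fin β) r₁) (hw : ∀ i, w ≠ Sum.inl (Sum.inl (Sum.inl i))) :
    actLeft ψ r₁ r₂ (unit K (windowEmb j k' r₁ r₂ w)) = unit K (windowEmb j k r₁ r₂ w) := by
  refine (linearCombination_unit _ _).trans ?_
  rcases w with ((i | w) | c) | w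
  · exact absurd rfl (hw i)
  · rfl
  · rfl
  · rfl

theorem actLeft_slot (b' : B') :
    actLeft ψ r₁ r₂ (unit K (Sum.inl (Sum.inl (Sum.inl b')))) =
      ∑ b, ψ b' b • unit K (Sum.inl (Sum.inl (Sum.inl b)) : Side B r₂ ⊕ Side A r₁) :=
  linearCombination_unit _ _

theorem coord_actLeft_zero (y : Form K (Side B r₂ ⊕ Side A r₁) (Side A r₁))
    (τ : Equiv.Perm (Side (Fin 0) r₂ ⊕ Side (Fin β) r₁)) (j : Fin β ↪ A) (k : Fin 0 ↪ B)
    (k' : Fin 0 ↪ B') : Form.coord (y.compLinearMap (actLeft ψ r₁ r₂)) (windowPerm τ j k' ∘ Sum.inr) =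
      y.coord (windowPerm τ j k ∘ Sum.inr) := by
  refine coord_comp_eq fun p => ?_
  simp only [Function.comp_apply]
  rcases sideMap_cases j p with ⟨w, rfl⟩ | ⟨b, hb, rfl⟩
  · rw [windowPerm_inr, windowPerm_inr, actLeft_emb ψ j k k' _ fun i => i.elim0]
  · rw [windowPerm_of_notMem _ _ _ (inr_notMem_range _ _ hb),
      windowPerm_of_notMem _ _ _ (inr_notMem_range _ _ hb), actLeft_inr]

theorem coord_actLeft_one (y : Form K (Side B r₂ ⊕ Side A r₁) (Side A r₁))
    (τ : Equiv.Perm (Side (Fin 1) r₂ ⊕ Side (Fin β) r₁))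
    (hτ : ∃ p, τ (Sum.inr p) = Sum.inl (Sum.inl (Sum.inl 0))) (j : Fin β ↪ A)
    (k : B → Fin 1 ↪ B) (hk : ∀ b, k b 0 = b) (k' : Fin 1 ↪ B') :
    Form.coord (y.compLinearMap (actLeft ψ r₁ r₂)) (windowPerm τ j k' ∘ Sum.inr) =
      ∑ b, ψ (k' 0) b * y.coord (windowPerm τ j (k b) ∘ Sum.inr) := by
  obtain ⟨p₀, hp₀⟩ := hτ
  refine coord_comp_eq_sum (sideMap j r₁ p₀) (fun p hp b => ?_) ?_
  · simp only [Function.comp_apply]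
    rcases sideMap_cases j p with ⟨w, rfl⟩ | ⟨a, ha, rfl⟩
    · rw [windowPerm_inr, windowPerm_inr, actLeft_emb ψ j (k b) k']
      intro i h
      rw [Subsingleton.elim i 0, ← hp₀] at h
      exact hp (congrArg _ (Sum.inr_injective (τ.injective h)))
    · rw [windowPerm_of_notMem _ _ _ (inr_notMem_range _ _ ha),
        windowPerm_of_notMem _ _ _ (inr_notMem_range _ _ ha), actLeft_inr]
  · simp only [Function.comp_apply, windowPerm_inr, hp₀]
    have h1 : ∀ b, windowEmb j (k b) r₁ r₂ (Sum.inl (Sum.inl (Sum.inl 0))) =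
        Sum.inl (Sum.inl (Sum.inl b)) := fun b => by
      conv_rhs => rw [← hk b]
      rfl
    simp only [h1]
    exact actLeft_slot ψ (k' 0)

end

theorem exists_windowPerm [Finite A] [Finite B] (σ : Equiv.Perm (Side B r₂ ⊕ Side A r₁))
    (j : Fin β ↪ A) (k : Fin α ↪ B)
    (hσ : ∀ i ∉ Set.range (windowEmb j k r₁ r₂), σ i = i) : ∃ τ, windowPerm τ j k = σ := by
  have h : ∀ w, ∃ w', windowEmb j k r₁ r₂ w' = σ (windowEmb j k r₁ r₂ w) := by
    intro w
    by_contra h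
    have h1 := hσ _ h
    have h2 := σ.injective h1
    exact h ⟨w, h2.symm⟩
  choose g hg using h
  have hginj : Function.Injective g := fun w w' hww => by
    have h1 := hg w
    rw [hww, hg w'] at h1
    exact (windowEmb j k r₁ r₂).injective (σ.injective h1.symm)
  refine ⟨Equiv.ofBijective g (Finite.injective_iff_bijective.1 hginj), ?_⟩
  ext1 i
  by_cases hi : i ∈ Set.range (windowEmb j k r₁ r₂)
  · obtain ⟨w, rfl⟩ := hi
    rw [windowPerm_emb]
    exact hg w
  · rw [windowPerm_of_notMem _ _ _ hi, hσ i hi]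

/-- Every permutation agrees with the extension of a permutation of a window, up to reordering. -/
theorem exists_windowPerm_comp [Finite A] [Finite B] (σ : Equiv.Perm (Side B r₂ ⊕ Side A r₁))
    (j : Fin β ↪ A) (k : Fin α ↪ B)
    (hj : ∀ a, a ∈ Set.range j ↔ ∃ p, σ (Sum.inl p) = Sum.inr (Sum.inl (Sum.inl a)))
    (hk : ∀ b, b ∈ Set.range k ↔ ∃ n, σ (Sum.inr n) = Sum.inl (Sum.inl (Sum.inl b))) :
    ∃ (τ : Equiv.Perm (Side (Fin α) r₂ ⊕ Side (Fin β) r₁)) (ρ : Equiv.Perm (Side B r₂)),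
      (∀ i, ∃ p, τ (Sum.inl p) = Sum.inr (Sum.inl (Sum.inl i))) ∧
      (∀ i, ∃ n, τ (Sum.inr n) = Sum.inl (Sum.inl (Sum.inl i))) ∧
      windowPerm τ j k ∘ Sum.inl = (σ ∘ Sum.inl) ∘ ρ := by
  obtain ⟨ρ, hρ⟩ : ∃ ρ : Equiv.Perm (Side B r₂), ∀ b ∉ Set.range k,
      σ (Sum.inl (ρ (Sum.inl (Sum.inl b)))) = Sum.inl (Sum.inl (Sum.inl b)) := by
    have h : ∀ i : Side B r₂, ∃ p, ∀ b ∉ Set.range k, i = Sum.inl (Sum.inl b) →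
        σ (Sum.inl p) = Sum.inl i := by
      intro i
      rcases h : σ.symm (Sum.inl i) with p | n
      · exact ⟨p, fun b hb hi => by rw [← h, σ.apply_symm_apply]⟩
      · refine ⟨i, fun b hb hi => absurd ((hk b).2 ⟨n, ?_⟩) hb⟩
        rw [← h, σ.apply_symm_apply, hi]
    choose f hf using h
    obtain ⟨ρ, hρ⟩ := exists_perm_eqOn (f := f)
      (S := {i | ∃ b, b ∉ Set.range k ∧ i = Sum.inl (Sum.inl b)}) (by
        rintro i ⟨b, hb, hi⟩ i' ⟨b', hb', hi'⟩ h
        have h1 := hf i b hb hi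
        rw [h, hf i' b' hb' hi'] at h1
        exact (Sum.inl_injective h1).symm)
    exact ⟨ρ, fun b hb => by rw [hρ _ ⟨b, hb, rfl⟩]; exact hf _ b hb rfl⟩
  obtain ⟨ρ', hρ'⟩ : ∃ ρ : Equiv.Perm (Side A r₁), ∀ b ∉ Set.range j,
      σ (Sum.inr (ρ (Sum.inl (Sum.inl b)))) = Sum.inr (Sum.inl (Sum.inl b)) := by
    have h : ∀ i : Side A r₁, ∃ p, ∀ b ∉ Set.range j, i = Sum.inl (Sum.inl b) →
        σ (Sum.inr p) = Sum.inr i := by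
      intro i
      rcases h : σ.symm (Sum.inr i) with p | n
      · refine ⟨i, fun b hb hi => absurd ((hj b).2 ⟨p, ?_⟩) hb⟩
        rw [← h, σ.apply_symm_apply, hi]
      · exact ⟨n, fun b hb hi => by rw [← h, σ.apply_symm_apply]⟩
    choose f hf using h
    obtain ⟨ρ, hρ⟩ := exists_perm_eqOn (f := f)
      (S := {i | ∃ b, b ∉ Set.range j ∧ i = Sum.inl (Sum.inl b)}) (by
        rintro i ⟨b, hb, hi⟩ i' ⟨b', hb', hi'⟩ h
        have h1 := hf i b hb hi
        rw [h, hf i' b' hb' hi'] at h1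
        exact (Sum.inr_injective h1).symm)
    exact ⟨ρ, fun b hb => by rw [hρ _ ⟨b, hb, rfl⟩]; exact hf _ b hb rfl⟩
  let σ' : Equiv.Perm (Side B r₂ ⊕ Side A r₁) := (Equiv.sumCongr ρ ρ').trans σ
  have hfix : ∀ i ∉ Set.range (windowEmb j k r₁ r₂), σ' i = i := by
    rintro (p | p) hi
    · rcases sideMap_cases k p with ⟨w, rfl⟩ | ⟨b, hb, rfl⟩
      · exact absurd ⟨Sum.inl w, rfl⟩ hi
      · exact hρ b hb
    · rcases sideMap_cases j p with ⟨w, rfl⟩ | ⟨b, hb, rfl⟩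
      · exact absurd ⟨Sum.inr w, rfl⟩ hi
      · exact hρ' b hb
  obtain ⟨τ, hτ⟩ := exists_windowPerm σ' j k hfix
  refine ⟨τ, ρ, fun i => ?_, fun i => ?_, ?_⟩
  · obtain ⟨p, hp⟩ := (hj (j i)).1 ⟨i, rfl⟩
    have h1 : σ' (Sum.inl (ρ.symm p)) = Sum.inr (Sum.inl (Sum.inl (j i))) := by
      simpa [σ'] using hp
    by_cases hr : (Sum.inl (ρ.symm p) : Side B r₂ ⊕ Side A r₁) ∈ Set.range (windowEmb j k r₁ r₂)
    · obtain ⟨w | w, hw⟩ := hr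
      · refine ⟨w, (windowEmb j k r₁ r₂).injective ?_⟩
        rw [← windowPerm_emb, hτ, hw, h1]
        rfl
      · simp at hw
    · rw [hfix _ hr] at h1
      simp at h1
  · obtain ⟨p, hp⟩ := (hk (k i)).1 ⟨i, rfl⟩
    have h1 : σ' (Sum.inr (ρ'.symm p)) = Sum.inl (Sum.inl (Sum.inl (k i))) := by
      simpa [σ'] using hp
    by_cases hr : (Sum.inr (ρ'.symm p) : Side B r₂ ⊕ Side A r₁) ∈ Set.range (windowEmb j k r₁ r₂)
    · obtain ⟨w | w, hw⟩ := hr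
      · simp at hw
      · refine ⟨w, (windowEmb j k r₁ r₂).injective ?_⟩
        rw [← windowPerm_emb, hτ, hw, h1]
        rfl
    · rw [hfix _ hr] at h1
      simp at h1
  · rw [hτ]
    rfl

end Form

/-! ### Window coordinates and normal forms. -/

namespace Form

variable {K : Type*} [Field K] {A B A' B' : Type} {r₁ r₂ α β : ℕ}

/-- Permutations of the index set of a window that move the variable indices across. -/
def SlotPerm (r₁ r₂ β α : ℕ) : Type :=
  {τ : Equiv.Perm (Side (Fin α) r₂ ⊕ Side (Fin β) r₁) //
    (∀ i, ∃ p, τ (Sum.inl p) = Sum.inr (Sum.inl (Sum.inl i))) ∧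
      ∀ i, ∃ n, τ (Sum.inr n) = Sum.inl (Sum.inl (Sum.inl i))}

noncomputable instance : Fintype (SlotPerm r₁ r₂ β α) :=
  @Fintype.ofFinite _ Subtype.finite

/-- The embedding of a one-element type with a given value. -/
def point (a : A) : Fin 1 ↪ A := ⟨fun _ => a, Function.injective_of_subsingleton _⟩

@[simp] theorem point_apply (a : A) (i : Fin 1) : point a i = a := rfl

/-- The index set of the coordinates that involve at most one variable index on either side. -/
abbrev WindowIdx (r₁ r₂ : ℕ) (A B : Type) : Type :=
  MIdx (SlotPerm r₁ r₂ 0 0) (SlotPerm r₁ r₂ 1 0) (SlotPerm r₁ r₂ 0 1)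
    (Fin (Fintype.card (SlotPerm r₁ r₂ 1 1))) A B

/-- The permutation describing such a coordinate. -/
noncomputable def idxPerm : WindowIdx r₁ r₂ A B → Equiv.Perm (Side B r₂ ⊕ Side A r₁)
  | .s e => windowPerm e.1 Function.Embedding.ofIsEmpty Function.Embedding.ofIsEmpty
  | .u e a => windowPerm e.1 (point a) Function.Embedding.ofIsEmpty
  | .w e b => windowPerm e.1 Function.Embedding.ofIsEmpty (point b)
  | .m e a b => windowPerm ((Fintype.equivFin _).symm e).1 (point a) (point b)

/-- The coordinates of a form that involve at most one variable index on either side. -/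
noncomputable def windowCoord (x : Form K (Side B r₂ ⊕ Side A r₁) (Side B r₂))
    (m : WindowIdx r₁ r₂ A B) : K := x.coord (idxPerm m ∘ Sum.inl)

theorem windowCoord_actRight [Fintype A] [Fintype A'] [Fintype B] [DecidableEq B]
    (φ : Matrix A' A K) (x : Form K (Side B r₂ ⊕ Side A r₁) (Side B r₂)) :
    windowCoord (x.compLinearMap (actRight φ r₁ r₂)) = MIdx.act φ 1 (windowCoord x) := by
  ext (e | ⟨e, a⟩ | ⟨e, b⟩ | ⟨e, a, b⟩)
  · exact coord_actRight_zero φ x _ _ _ _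
  · exact coord_actRight_one φ x _ (e.2.1 0) point (fun _ => rfl) _ _
  · simp only [MIdx.act, Matrix.one_apply, ite_mul, one_mul, zero_mul, Finset.sum_ite_eq,
      Finset.mem_univ, if_true]
    exact coord_actRight_zero φ x _ _ _ _
  · simp only [MIdx.act, Matrix.one_apply, mul_ite, mul_one, mul_zero, ite_mul, zero_mul,
      Finset.sum_ite_eq, Finset.mem_univ, if_true]
    exact coord_actRight_one φ x _ (((Fintype.equivFin _).symm e).2.1 0) point (fun _ => rfl) _ _

theorem IsStar.coord_windowPerm [Fintype A] [Fintype B]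
    {x : Form K (Side B r₂ ⊕ Side A r₁) (Side B r₂)} {y : Form K (Side B r₂ ⊕ Side A r₁) (Side A r₁)}
    (h : IsStar (vol (Equiv.refl _)) x y)
    (τ : Equiv.Perm (Side (Fin α) r₂ ⊕ Side (Fin β) r₁)) (j : Fin β ↪ A) (k : Fin α ↪ B) :
    x.coord (windowPerm τ j k ∘ Sum.inl) =
      ((Equiv.Perm.sign τ : ℤ) : K) * y.coord (windowPerm τ j k ∘ Sum.inr) := by
  classical
  rw [h.coord_perm', sign_windowPerm]

/-- The map acts on the dual form. Window coordinates of a form and of its dual differ by the sign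
of `τ`, which depends neither on `B` nor on the position of the window, so the action carries over
to `x`. -/
theorem windowCoord_actLeft [Fintype A] [Fintype B] [Fintype B'] [DecidableEq A]
    (ψ : Matrix B' B K) {x : Form K (Side B r₂ ⊕ Side A r₁) (Side B r₂)}
    {y : Form K (Side B r₂ ⊕ Side A r₁) (Side A r₁)} (h : IsStar (vol (Equiv.refl _)) x y)
    {x' : Form K (Side B' r₂ ⊕ Side A r₁) (Side B' r₂)}
    (h' : IsStar (vol (Equiv.refl _)) x' (y.compLinearMap (actLeft ψ r₁ r₂))) :
    windowCoord x' = MIdx.act 1 ψ (windowCoord x) := by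
  have h0 : ∀ {β : ℕ} (τ : Equiv.Perm (Side (Fin 0) r₂ ⊕ Side (Fin β) r₁)) (j : Fin β ↪ A)
      (k : Fin 0 ↪ B) (k' : Fin 0 ↪ B'),
      x'.coord (windowPerm τ j k' ∘ Sum.inl) = x.coord (windowPerm τ j k ∘ Sum.inl) := by
    intro β τ j k k'
    rw [h'.coord_windowPerm, h.coord_windowPerm, coord_actLeft_zero ψ y τ j k k']
  have h1 : ∀ {β : ℕ} (τ : Equiv.Perm (Side (Fin 1) r₂ ⊕ Side (Fin β) r₁))
      (_ : ∃ p, τ (Sum.inr p) = Sum.inl (Sum.inl (Sum.inl 0))) (j : Fin β ↪ A) (b : B'),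
      x'.coord (windowPerm τ j (point b) ∘ Sum.inl) =
        ∑ b', ψ b b' * x.coord (windowPerm τ j (point b') ∘ Sum.inl) := by
    intro β τ hτ j b
    rw [h'.coord_windowPerm, coord_actLeft_one ψ y τ hτ j point (fun _ => rfl), Finset.mul_sum]
    refine Finset.sum_congr rfl fun b' _ => ?_
    rw [h.coord_windowPerm, mul_left_comm]
    rfl
  ext (e | ⟨e, a⟩ | ⟨e, b⟩ | ⟨e, a, b⟩)
  · exact h0 _ _ _ _
  · simp only [MIdx.act, Matrix.one_apply, ite_mul, one_mul, zero_mul, Finset.sum_ite_eq,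
      Finset.mem_univ, if_true]
    exact h0 _ _ _ _
  · exact h1 _ (e.2.2 0) _ _
  · simp only [MIdx.act, Matrix.one_apply, ite_mul, one_mul, zero_mul]
    rw [Finset.sum_eq_single a]
    · simp only [if_true]
      exact h1 _ (((Fintype.equivFin _).symm e).2.2 0) _ _
    · intro a' _ ha'
      simp [Ne.symm ha']
    · simp

/-- The permutation exchanging the slots on the left with two of the listed indices. -/
def swapLeft (i j : Fin r₁) : SlotPerm r₁ r₂ 0 0 :=
  ⟨Equiv.swap (Sum.inl (Sum.inr 0)) (Sum.inr (Sum.inl (Sum.inr (Sum.inl i)))) *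
    Equiv.swap (Sum.inl (Sum.inr 1)) (Sum.inr (Sum.inl (Sum.inr (Sum.inr j)))),
    fun i => i.elim0, fun i => i.elim0⟩

/-- The permutation exchanging the slots on the right with two of the listed indices. -/
def swapRight (i j : Fin r₂) : SlotPerm r₁ r₂ 0 0 :=
  ⟨Equiv.swap (Sum.inr (Sum.inr 0)) (Sum.inl (Sum.inl (Sum.inr (Sum.inl i)))) *
    Equiv.swap (Sum.inr (Sum.inr 1)) (Sum.inl (Sum.inl (Sum.inr (Sum.inr j)))),
    fun i => i.elim0, fun i => i.elim0⟩

theorem windowPerm_swapLeft (i j : Fin r₁) :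
    (idxPerm (.s (swapLeft i j)) : Equiv.Perm (Side B r₂ ⊕ Side A r₁)) ∘ Sum.inl =
      Sum.elim (fun p => Sum.inl (Sum.inl p)) ![Sum.inr (Sum.inl (Sum.inr (Sum.inl i))),
        Sum.inr (Sum.inl (Sum.inr (Sum.inr j)))] := by
  ext1 p
  simp only [Function.comp_apply, idxPerm]
  rcases sideMap_cases (Function.Embedding.ofIsEmpty : Fin 0 ↪ B) p with ⟨w, rfl⟩ | ⟨b, hb, rfl⟩
  · rw [windowPerm_inl]
    rcases w with (e | w) | c
    · exact e.elim0
    · simp [swapLeft, Equiv.swap_apply_def, sideMap]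
    · fin_cases c <;> simp [swapLeft, Equiv.swap_apply_def, sideMap]
  · rw [windowPerm_of_notMem _ _ _ (inl_notMem_range _ _ hb)]
    rfl

theorem windowPerm_swapRight (i j : Fin r₂) :
    (idxPerm (.s (swapRight i j)) : Equiv.Perm (Side B r₂ ⊕ Side A r₁)) ∘ Sum.inr =
      Sum.elim (fun p => Sum.inr (Sum.inl p)) ![Sum.inl (Sum.inl (Sum.inr (Sum.inl i))),
        Sum.inl (Sum.inl (Sum.inr (Sum.inr j)))] := by
  ext1 p
  simp only [Function.comp_apply, idxPerm]
  rcases sideMap_cases (Function.Embedding.ofIsEmpty : Fin 0 ↪ A) p with ⟨w, rfl⟩ | ⟨b, hb, rfl⟩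
  · rw [windowPerm_inr]
    rcases w with (e | w) | c
    · exact e.elim0
    · simp [swapRight, Equiv.swap_apply_def, sideMap]
    · fin_cases c <;> simp [swapRight, Equiv.swap_apply_def, sideMap]
  · rw [windowPerm_of_notMem _ _ _ (inr_notMem_range _ _ hb)]
    rfl

/-- The determinant of a contraction of a form, in terms of its window coordinates. -/
noncomputable def detLeft (m : WindowIdx r₁ r₂ A B → K) : K :=
  (Matrix.of fun i j : Fin r₁ => m (.s (swapLeft i j))).det

/-- The determinant of a contraction of the dual form, in terms of the window coordinates. -/
noncomputable def detRight (m : WindowIdx r₁ r₂ A B → K) : K :=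
  (Matrix.of fun i j : Fin r₂ => m (.s (swapRight i j))).det

theorem detLeft_polyFun : (detLeft : (WindowIdx r₁ r₂ A B → K) → K) ∈ polyFun K _ :=
  det_mem_subalgebra _ fun _ _ => polyFun_coord _

theorem detRight_polyFun : (detRight : (WindowIdx r₁ r₂ A B → K) → K) ∈ polyFun K _ :=
  det_mem_subalgebra _ fun _ _ => polyFun_coord _

theorem detLeft_windowCoord (x : Form K (Side B r₂ ⊕ Side A r₁) (Side B r₂)) :
    detLeft (windowCoord x) = (Matrix.of fun i j : Fin r₁ => x.coord
      (Sum.elim (fun p => Sum.inl (Sum.inl p)) ![Sum.inr (Sum.inl (Sum.inr (Sum.inl i))),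
        Sum.inr (Sum.inl (Sum.inr (Sum.inr j)))])).det := by
  simp only [detLeft, windowCoord, windowPerm_swapLeft]

theorem IsStar.detRight_windowCoord [Fintype A] [Fintype B]
    {x : Form K (Side B r₂ ⊕ Side A r₁) (Side B r₂)} {y : Form K (Side B r₂ ⊕ Side A r₁) (Side A r₁)}
    (h : IsStar (vol (Equiv.refl _)) x y) :
    detRight (windowCoord x) = (Matrix.of fun i j : Fin r₂ => y.coord
      (Sum.elim (fun p => Sum.inr (Sum.inl p)) ![Sum.inl (Sum.inl (Sum.inr (Sum.inl i))),
        Sum.inl (Sum.inl (Sum.inr (Sum.inr j)))])).det := by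
  unfold detRight
  congr 1
  ext i j
  simp only [Matrix.of_apply]
  rw [← windowPerm_swapRight (A := A) (B := B), windowCoord, idxPerm, h.coord_windowPerm]
  -- A product of two transpositions is even, so the minor of the dual form appears without signs.
  have : Equiv.Perm.sign (swapRight i j : SlotPerm r₁ r₂ 0 0).1 = 1 := by
    simp only [swapRight, map_mul]
    rw [Equiv.Perm.sign_swap (by simp), Equiv.Perm.sign_swap (by simp)]
    simp
  rw [this]
  simp

/-- Pairs of dual forms of prescribed rank in a normal position. -/
structure IsNormal [Fintype A] [Fintype B] (x : Form K (Side B r₂ ⊕ Side A r₁) (Side B r₂))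
    (y : Form K (Side B r₂ ⊕ Side A r₁) (Side A r₁)) : Prop where
  isStar : IsStar (vol (Equiv.refl _)) x y
  not_left : ¬ HasRank (r₁ + 1) x
  not_right : ¬ HasRank (r₂ + 1) y
  left : detLeft (windowCoord x) ≠ 0
  right : detRight (windowCoord x) ≠ 0

/-- The coordinates of normal forms are rational functions of the window coordinates. -/
theorem coord_mem_localize [Infinite K] [Fintype A] [Fintype B] {Z : Type*}
    {x : Z → Form K (Side B r₂ ⊕ Side A r₁) (Side B r₂)}
    {y : Z → Form K (Side B r₂ ⊕ Side A r₁) (Side A r₁)} (h : ∀ z, IsNormal (x z) (y z))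
    (hw : (fun z => detLeft (windowCoord (x z)) * detRight (windowCoord (x z))) ∈
      pullbackAlg fun z => windowCoord (x z)) (s : Side B r₂ → Side B r₂ ⊕ Side A r₁) :
    (fun z => (x z).coord s) ∈ (pullbackAlg fun z => windowCoord (x z)).localize hw := by
  classical
  refine coord_mem_of_base _ (fun z => (h z).isStar) (fun z => (h z).not_left)
    (fun z => (h z).not_right) (fun f hf => ?_) (fun f hf => ?_) (fun σ hA hB => ?_) s
  · simp only [← detLeft_windowCoord] at hf
    exact Subalgebra.mem_localize_of_mul (g := fun z => detRight (windowCoord (x z)))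
      ⟨detRight, detRight_polyFun, fun _ => rfl⟩ (by ext z; simp [mul_comm]) hf
  · simp only [← (h _).isStar.detRight_windowCoord] at hf
    exact Subalgebra.mem_localize_of_mul (g := fun z => detLeft (windowCoord (x z)))
      ⟨detLeft, detLeft_polyFun, fun _ => rfl⟩ (by ext z; simp) hf
  -- A base coordinate has at most one variable index crossing from each side; the four
  -- possibilities are the scalars, the two kinds of vectors and the matrices.
  · obtain ⟨m, ρ, hm⟩ : ∃ (m : WindowIdx r₁ r₂ A B) (ρ : Equiv.Perm (Side B r₂)),
        idxPerm m ∘ Sum.inl = (σ ∘ Sum.inl) ∘ ρ := by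
      have hA0 : (∀ a, ¬ ∃ p, σ (Sum.inl p) = Sum.inr (Sum.inl (Sum.inl a))) →
          ∀ a, a ∈ Set.range (Function.Embedding.ofIsEmpty : Fin 0 ↪ A) ↔
            ∃ p, σ (Sum.inl p) = Sum.inr (Sum.inl (Sum.inl a)) := fun h a =>
        ⟨fun ⟨i, _⟩ => i.elim0, fun h' => absurd h' (h a)⟩
      have hB0 : (∀ b, ¬ ∃ n, σ (Sum.inr n) = Sum.inl (Sum.inl (Sum.inl b))) →
          ∀ b, b ∈ Set.range (Function.Embedding.ofIsEmpty : Fin 0 ↪ B) ↔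
            ∃ n, σ (Sum.inr n) = Sum.inl (Sum.inl (Sum.inl b)) := fun h a =>
        ⟨fun ⟨i, _⟩ => i.elim0, fun h' => absurd h' (h a)⟩
      have hA1 : ∀ a, (∃ p, σ (Sum.inl p) = Sum.inr (Sum.inl (Sum.inl a))) →
          ∀ a', a' ∈ Set.range (point a) ↔
            ∃ p, σ (Sum.inl p) = Sum.inr (Sum.inl (Sum.inl a')) := by
        rintro a ⟨p, hp⟩ a'
        refine ⟨?_, ?_⟩
        · rintro ⟨i, rfl⟩
          exact ⟨p, hp⟩
        · rintro ⟨p', hp'⟩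
          exact ⟨0, hA a a' p p' hp hp'⟩
      have hB1 : ∀ b, (∃ n, σ (Sum.inr n) = Sum.inl (Sum.inl (Sum.inl b))) →
          ∀ b', b' ∈ Set.range (point b) ↔
            ∃ n, σ (Sum.inr n) = Sum.inl (Sum.inl (Sum.inl b')) := by
        rintro a ⟨p, hp⟩ a'
        refine ⟨?_, ?_⟩
        · rintro ⟨i, rfl⟩
          exact ⟨p, hp⟩
        · rintro ⟨p', hp'⟩
          exact ⟨0, hB a a' p p' hp hp'⟩
      by_cases ha : ∃ a p, σ (Sum.inl p) = Sum.inr (Sum.inl (Sum.inl a)) <;>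
      by_cases hb : ∃ b n, σ (Sum.inr n) = Sum.inl (Sum.inl (Sum.inl b))
      · obtain ⟨a, ha⟩ := ha
        obtain ⟨b, hb⟩ := hb
        obtain ⟨τ, ρ, h1, h2, h3⟩ := exists_windowPerm_comp σ _ _ (hA1 a ha) (hB1 b hb)
        obtain ⟨e, rfl⟩ : ∃ e : SlotPerm r₁ r₂ 1 1, e.1 = τ := ⟨⟨τ, h1, h2⟩, rfl⟩
        exact ⟨.m (Fintype.equivFin _ e) a b, ρ, by
          simp only [idxPerm]
          rw [Equiv.symm_apply_apply]
          exact h3⟩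
      · obtain ⟨a, ha⟩ := ha
        obtain ⟨τ, ρ, h1, h2, h3⟩ := exists_windowPerm_comp σ _ _ (hA1 a ha)
          (hB0 fun b hb' => hb ⟨b, hb'⟩)
        exact ⟨.u ⟨τ, h1, h2⟩ a, ρ, h3⟩
      · obtain ⟨b, hb⟩ := hb
        obtain ⟨τ, ρ, h1, h2, h3⟩ := exists_windowPerm_comp σ _ _
          (hA0 fun a ha' => ha ⟨a, ha'⟩) (hB1 b hb)
        exact ⟨.w ⟨τ, h1, h2⟩ b, ρ, h3⟩
      · obtain ⟨τ, ρ, h1, h2, h3⟩ := exists_windowPerm_comp σ _ _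
          (hA0 fun a ha' => ha ⟨a, ha'⟩) (hB0 fun b hb' => hb ⟨b, hb'⟩)
        exact ⟨.s ⟨τ, h1, h2⟩, ρ, h3⟩
    refine coord_mem_of_comp_perm _ ρ ?_
    rw [← hm]
    refine ⟨0, ?_⟩
    rw [pow_zero, one_mul]
    exact ⟨fun v => v m, polyFun_coord m, fun z => rfl⟩

end Form

/-! ### Stabilisation of the normal forms in a chain of systems. -/

namespace FormSystem

open Form

variable {K : Type*} [Field K] {A B A' B' : Type} {r₁ r₂ : ℕ}

/-- The two determinants involve only scalar window coordinates, which the action fixes. The rank of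
`x` cannot grow under substitution, nor that of its dual, by `hasRank_star_of_comp`. -/
theorem isNormal_actRight [Infinite K] [Fintype A] [Fintype A'] [Fintype B] (X : FormSystem K)
    {x : Form K (Side B r₂ ⊕ Side A r₁) (Side B r₂)} {y : Form K (Side B r₂ ⊕ Side A r₁) (Side A r₁)}
    (h : IsNormal x y) (hx : x ∈ X.mem _ _) (φ : Matrix A' A K) :
    ∃ y', IsNormal (x.compLinearMap (actRight φ r₁ r₂)) y' := by
  classical
  have hx' := X.comp hx (actRight φ r₁ r₂)
  obtain ⟨y', -, hy'⟩ := X.star hx' (Equiv.refl _) _ (vol_ne_zero (Equiv.refl _))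
  refine ⟨y', hy', fun hr => h.not_left hr.of_compLinearMap, fun hr => h.not_right ?_, ?_, ?_⟩
  · exact X.hasRank_star_of_comp hx (actRight φ r₁ r₂) (Equiv.refl _) (Equiv.refl _)
      (by simp) (vol_ne_zero _) h.isStar hy' hr
  · rw [windowCoord_actRight]
    exact h.left
  · rw [windowCoord_actRight]
    exact h.right

/-- The mirror image of `isNormal_actRight`, with the substitution made in the dual form. -/
theorem isNormal_actLeft [Infinite K] [Fintype A] [Fintype B] [Fintype B'] (X : FormSystem K)
    {x : Form K (Side B r₂ ⊕ Side A r₁) (Side B r₂)} {y : Form K (Side B r₂ ⊕ Side A r₁) (Side A r₁)}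
    (h : IsNormal x y) (hx : x ∈ X.mem _ _) (ψ : Matrix B' B K) :
    ∃ x' ∈ X.mem _ _, IsNormal x' (y.compLinearMap (actLeft ψ r₁ r₂)) ∧
      IsStar (vol (Equiv.refl _)) x' (y.compLinearMap (actLeft ψ r₁ r₂)) := by
  classical
  have hy : y ∈ X.mem _ _ := X.star_mem (Equiv.refl _) (vol_ne_zero _) h.isStar hx
  have hy' := X.comp hy (actLeft ψ r₁ r₂)
  obtain ⟨x', hx', hs⟩ := X.star hy' (Equiv.sumComm _ _) _ (vol_ne_zero (Equiv.sumComm _ _))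
  have hs' : IsStar (vol (Equiv.refl _)) x' (y.compLinearMap (actLeft ψ r₁ r₂)) := by
    intro G G' hG
    have h1 := hs _ _ (hG.symm.comp (Equiv.sumComm _ _))
    have e1 : (G' ∘ Equiv.sumComm (Side A r₁) (Side B' r₂)) ∘ Sum.inr = G' ∘ Sum.inl := by
      ext i; simp
    have e2 : (G ∘ Equiv.sumComm (Side A r₁) (Side B' r₂)) ∘ Sum.inl = G ∘ Sum.inr := by
      ext i; simp
    have h3 := vol_mul_vol (Equiv.refl _) hG
    have h4 : vol (Equiv.sumComm _ _) (G' ∘ Equiv.sumComm (Side A r₁) (Side B' r₂)) =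
        vol (Equiv.refl _) G' := by
      rw [vol_apply, vol_apply]
      congr 1
      ext i j
      simp
    rw [e1, e2, h4] at h1
    rw [h1, ← mul_assoc, h3, one_mul]
  refine ⟨x', hx', ⟨hs', fun hr => h.not_left ?_, fun hr => h.not_right hr.of_compLinearMap,
    ?_, ?_⟩, hs'⟩
  · exact X.hasRank_star_of_comp hy (actLeft ψ r₁ r₂) (Equiv.sumComm _ _) (Equiv.sumComm _ _)
      (by simp) (vol_ne_zero _) (isStar_vol_swap h.isStar) hs hr
  · rw [windowCoord_actLeft ψ h.isStar hs']
    exact h.left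
  · rw [windowCoord_actLeft ψ h.isStar hs']
    exact h.right

theorem act_mem_coordClosure {σ τ : Type*} {F : (σ → K) → τ → K}
    (hF : ∀ i, (fun x => F x i) ∈ polyFun K σ) {S : Set (σ → K)} {T : Set (τ → K)}
    (h : ∀ x ∈ S, F x ∈ T) {x : σ → K} (hx : x ∈ coordClosure S) : F x ∈ coordClosure T :=
  fun _ hf hT => hx _ (polyFun_comp hF hf) fun z hz => hT _ (h z hz)

/-- The window coordinates of the normal forms in a system. -/
noncomputable def windowFam [Infinite K] (X : FormSystem K) (r₁ r₂ : ℕ) :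
    MatFam K (SlotPerm r₁ r₂ 0 0) (SlotPerm r₁ r₂ 1 0) (SlotPerm r₁ r₂ 0 1)
      (Fin (Fintype.card (SlotPerm r₁ r₂ 1 1))) where
  carrier A B _ _ := coordClosure (windowCoord ''
    {x : Form K (Side B r₂ ⊕ Side A r₁) (Side B r₂) | x ∈ X.mem _ _ ∧ ∃ y, IsNormal x y})
  closed _ _ _ _ := coordClosed_coordClosure _
  stable A B A' B' _ _ _ _ φ ψ x hx := by
    classical
    -- The action of a pair is split, as `φ` comes from substitution in the form and `ψ` from
    -- substitution in its dual.
    have h1 : MIdx.act φ (1 : Matrix B B K) x ∈ coordClosure (windowCoord ''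
        {x : Form K (Side B r₂ ⊕ Side A' r₁) (Side B r₂) | x ∈ X.mem _ _ ∧ ∃ y, IsNormal x y}) := by
      refine act_mem_coordClosure (MIdx.act_polyFun φ 1) ?_ hx
      rintro _ ⟨x, ⟨hx, y, hxy⟩, rfl⟩
      exact ⟨_, ⟨X.comp hx _, X.isNormal_actRight hxy hx φ⟩, windowCoord_actRight φ x⟩
    have h2 : MIdx.act (1 : Matrix A' A' K) ψ (MIdx.act φ (1 : Matrix B B K) x) ∈
        coordClosure (windowCoord '' {x : Form K (Side B' r₂ ⊕ Side A' r₁) (Side B' r₂) |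
          x ∈ X.mem _ _ ∧ ∃ y, IsNormal x y}) := by
      refine act_mem_coordClosure (MIdx.act_polyFun 1 ψ) ?_ h1
      rintro _ ⟨x, ⟨hx, y, hxy⟩, rfl⟩
      obtain ⟨x', hx', hn, hs⟩ := X.isNormal_actLeft hxy hx ψ
      exact ⟨_, ⟨hx', _, hn⟩, windowCoord_actLeft ψ hxy.isStar hs⟩
    rwa [MIdx.act_act, Matrix.one_mul, Matrix.mul_one] at h2

/-- In a descending chain of systems, the sets of normal forms with given ranks stabilise. -/
theorem exists_normal_stable [Infinite K] (X : ℕ → FormSystem K) (hX : Antitone X) (r₁ r₂ : ℕ) :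
    ∃ i₀, ∀ i ≥ i₀, ∀ (A B : Type) [Fintype A] [Fintype B]
      (x : Form K (Side B r₂ ⊕ Side A r₁) (Side B r₂))
      (y : Form K (Side B r₂ ⊕ Side A r₁) (Side A r₁)), IsNormal x y →
      x ∈ (X i₀).mem _ _ → x ∈ (X i).mem _ _ := by
  obtain ⟨i₀, hi₀⟩ := MatFam.chain_stabilizes _ _ _ _ (fun i => (X i).windowFam r₁ r₂)
    (fun i j hij A B _ _ => coordClosure_mono (Set.image_mono fun x hx =>
      ⟨hX hij _ _ hx.1, hx.2⟩))
  refine ⟨i₀, fun i hi A B _ _ x y hxy hx => ?_⟩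
  have hmem : windowCoord x ∈ coordClosure (windowCoord ''
      {x : Form K (Side B r₂ ⊕ Side A r₁) (Side B r₂) | x ∈ (X i).mem _ _ ∧ ∃ y, IsNormal x y}) :=
    hi₀ i hi A B (fun f _ hT => hT _ ⟨x, ⟨hx, y, hxy⟩, rfl⟩)
  obtain ⟨W, ⟨S, hS, rfl⟩, hW⟩ := (X i).closed (Side B r₂ ⊕ Side A r₁) (Side B r₂)
  rw [hW]
  intro g hg
  let Z := {z : Form K (Side B r₂ ⊕ Side A r₁) (Side B r₂) ×
    Form K (Side B r₂ ⊕ Side A r₁) (Side A r₁) // IsNormal z.1 z.2}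
  have hw : (fun z : Z => detLeft (windowCoord z.1.1) * detRight (windowCoord z.1.1)) ∈
      pullbackAlg fun z : Z => windowCoord z.1.1 :=
    Subalgebra.mul_mem _ ⟨detLeft, detLeft_polyFun, fun _ => rfl⟩
      ⟨detRight, detRight_polyFun, fun _ => rfl⟩
  -- Uniformly over all normal pairs, an equation `g` of the smaller system becomes a polynomial `G`
  -- in the window coordinates after multiplication by a power of the two minors. `G` vanishes on
  -- the closure containing the window coordinates of `x`, and the minors of `x` are nonzero, so `g`
  -- vanishes at `x`.
  obtain ⟨k, G, hG, hGz⟩ := comp_mem_of_polyFun _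
    (coord_mem_localize (fun z : Z => z.2) hw) (hS hg)
  have h1 : G (windowCoord x) = 0 := by
    refine hmem G hG ?_
    rintro _ ⟨x', ⟨hx', y', hxy'⟩, rfl⟩
    have h2 := hGz ⟨(x', y'), hxy'⟩
    rw [← h2, Pi.mul_apply, (hW x').1 hx' g hg, mul_zero]
  have h3 := hGz ⟨(x, y), hxy⟩
  rw [h1] at h3
  exact (mul_eq_zero.1 h3).resolve_left (pow_ne_zero _ (mul_ne_zero hxy.left hxy.right))

end FormSystem

/-! ### Moving a form and its dual into normal position. -/

namespace Form

variable {K : Type*} [Field K] {ι ι' P P' N N' κ Q : Type}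

/-- A minor of a form, evaluated at columns of a matrix. -/
def detVal {r : ℕ} (x : Form K ι Q) (t : Fin r → Fin r → Q → ι) (M : Matrix ι ι K) : K :=
  (Matrix.of fun i j => x fun q => M.transpose (t i j q)).det

theorem detVal_smul [Fintype Q] {r : ℕ} (x : Form K ι Q) (t : Fin r → Fin r → Q → ι)
    (c : K) (M : Matrix ι ι K) :
    detVal x t (c • M) = (c ^ Fintype.card Q) ^ r * detVal x t M := by
  classical
  have : (Matrix.of fun i j => x fun q => (c • M).transpose (t i j q)) =
      c ^ Fintype.card Q • Matrix.of fun i j => x fun q => M.transpose (t i j q) := by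
    ext i j
    have h := x.toMultilinearMap.map_smul_univ (fun _ => c) fun q => M.transpose (t i j q)
    rw [AlternatingMap.coe_multilinearMap] at h
    simp only [Matrix.of_apply, Matrix.smul_apply, Matrix.transpose_smul]
    refine h.trans ?_
    simp
  rw [detVal, this, Matrix.det_smul, Fintype.card_fin]
  rfl

theorem detVal_mem [Finite ι] [Finite Q] {T : Type*} (S : Subalgebra K (T → K)) {r : ℕ}
    (x : Form K ι Q) (t : Fin r → Fin r → Q → ι) {M : T → Matrix ι ι K}
    (hM : ∀ i j, (fun s => M s i j) ∈ S) : (fun s => detVal x t (M s)) ∈ S :=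
  det_mem_subalgebra S fun i j => by
    simp only [Matrix.of_apply]
    exact apply_mem S x fun p k => hM _ _

theorem mulVecLin_unit [Fintype ι] (M : Matrix ι ι K) (i : ι) :
    M.mulVecLin (unit K i) = M.transpose i := by
  ext k
  rw [Matrix.mulVecLin_apply, Matrix.mulVec, dotProduct_comm, unit_dotProduct]
  rfl

theorem detVal_eq_coord [Fintype ι] {r : ℕ} (x : Form K ι Q) (t : Fin r → Fin r → Q → ι)
    (M : Matrix ι ι K) : detVal x t M =
      (Matrix.of fun i j => Form.coord (x.compLinearMap M.mulVecLin) (t i j)).det := by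
  simp only [detVal, coord, AlternatingMap.compLinearMap_apply, mulVecLin_unit]

/-- The vectors witnessing the rank are placed in the columns indexed by `o`, `a` and `a'`, which
are distinct; the order of the arguments matters only up to sign. -/
theorem HasRank.exists_detVal_ne_zero [Finite P] {r : ℕ} {x : Form K ι (P ⊕ Fin 2)}
    (h : HasRank r x) {o : P → ι} {a a' : Fin r → ι}
    (hinj : Function.Injective (Sum.elim o (Sum.elim a a'))) :
    ∃ M : Matrix ι ι K, detVal x (fun i j => Sum.elim o ![a i, a' j]) M ≠ 0 := by
  classical
  have := Fintype.ofFinite P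
  obtain ⟨m, e, ζ, b, b', h⟩ := h
  have ε : P ≃ Fin m := Fintype.equivOfCardEq (by
    have := Fintype.card_congr e
    simpa using this)
  let ρ : Equiv.Perm (P ⊕ Fin 2) := e.trans (Equiv.sumCongr ε (Equiv.refl _)).symm
  let c : ι → ι → K := Function.extend (Sum.elim o (Sum.elim a a'))
    (Sum.elim (fun p => ζ (ε p)) (Sum.elim b b')) 0
  have hc : ∀ q, c (Sum.elim o (Sum.elim a a') q) =
      Sum.elim (fun p => ζ (ε p)) (Sum.elim b b') q := fun q => hinj.extend_apply _ _ q
  refine ⟨(Matrix.of c).transpose, fun h0 => h ?_⟩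
  have : gram (x.domDomCongr e) ζ b b' = ((Equiv.Perm.sign ρ : ℤ) : K) •
      Matrix.of fun i j => x fun q => c (Sum.elim o ![a i, a' j] q) := by
    ext i j
    simp only [gram, Matrix.of_apply, AlternatingMap.domDomCongr_apply, Matrix.smul_apply,
      smul_eq_mul]
    have h1 : (Sum.elim ζ ![b i, b' j] ∘ e) =
        (fun q => c (Sum.elim o ![a i, a' j] q)) ∘ ρ := by
      ext1 q
      obtain ⟨q, rfl⟩ := ρ.symm.surjective q
      simp only [Function.comp_apply, Equiv.apply_symm_apply]
      have h2 : e (ρ.symm q) = Equiv.sumCongr ε (Equiv.refl _) q := by simp [ρ]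
      rw [h2]
      rcases q with p | q
      · exact (hc (Sum.inl p)).symm
      · fin_cases q
        · exact (hc (Sum.inr (Sum.inl i))).symm
        · exact (hc (Sum.inr (Sum.inr j))).symm
    rw [h1, x.map_perm, Units.smul_def]
    simp
  rw [this, Matrix.det_smul]
  have h3 : (Matrix.of fun i j => x fun q => c (Sum.elim o ![a i, a' j] q)).det = 0 := h0
  rw [h3, mul_zero]

theorem exists_det_ne_zero [Infinite K] [Fintype ι] [DecidableEq ι] [Finite Q] {r : ℕ}
    {x : Form K ι Q} {t : Fin r → Fin r → Q → ι} {M : Matrix ι ι K} (h : detVal x t M ≠ 0) :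
    ∃ M : Matrix ι ι K, detVal x t M ≠ 0 ∧ M.det ≠ 0 := by
  have hM : ∀ i j, (fun s : K => (M + s • (1 - M)) i j) ∈ linePoly K := fun i j =>
    linePoly_affine _ _
  obtain ⟨s, hs, hs'⟩ := exists_common_ne_zero (detVal_mem _ x t hM) (det_mem_subalgebra _ hM)
    (s := 0) (t := 1) (by simpa using h) (by simp)
  exact ⟨_, hs, hs'⟩

theorem detVal_inv [Fintype ι] [DecidableEq ι] [Fintype Q] {r : ℕ} (x : Form K ι Q)
    (t : Fin r → Fin r → Q → ι) (M : Matrix ι ι K) : detVal x t M⁻¹.transpose =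
      (M.det⁻¹ ^ Fintype.card Q) ^ r * detVal x t M.adjugate.transpose := by
  rw [Matrix.inv_def, Ring.inverse_eq_inv', Matrix.transpose_smul, detVal_smul]

/-- Two open conditions, one on a matrix and one on its inverse transpose, can be satisfied
simultaneously. -/
theorem exists_detVal_ne_zero_and [Infinite K] [Fintype ι] [DecidableEq ι] [Fintype P] [Fintype N]
    {r r' : ℕ} {x : Form K ι P} {y : Form K ι N} {t : Fin r → Fin r → P → ι}
    {t' : Fin r' → Fin r' → N → ι} {M M' : Matrix ι ι K} (h : detVal x t M ≠ 0)
    (h' : detVal y t' M' ≠ 0) : ∃ M : Matrix ι ι K, M.det ≠ 0 ∧ detVal x t M ≠ 0 ∧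
      detVal y t' M⁻¹.transpose ≠ 0 := by
  obtain ⟨M₀, h₀, hd₀⟩ := exists_det_ne_zero h
  obtain ⟨L, hL, hdL⟩ := exists_det_ne_zero h'
  let M₁ : Matrix ι ι K := L⁻¹.transpose
  have hM₁ : M₁⁻¹.transpose = L := by
    rw [Matrix.transpose_nonsing_inv, Matrix.transpose_transpose,
      Matrix.nonsing_inv_nonsing_inv _ (isUnit_iff_ne_zero.2 hdL)]
  have hd₁ : M₁.det ≠ 0 := by
    rw [Matrix.det_transpose, Matrix.det_nonsing_inv, Ring.inverse_eq_inv']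
    exact inv_ne_zero hdL
  have h₁ : detVal y t' M₁.adjugate.transpose ≠ 0 := by
    have := detVal_inv y t' M₁
    rw [hM₁] at this
    exact right_ne_zero_of_mul (this ▸ hL)
  have hM : ∀ i j, (fun s : K => (M₀ + s • (M₁ - M₀)) i j) ∈ linePoly K := fun i j =>
    linePoly_affine _ _
  -- The inverse is not polynomial along the line, so it is replaced by the adjugate, which differs
  -- by a power of the determinant in `detVal`.
  have hadj : ∀ i j, (fun s : K => (M₀ + s • (M₁ - M₀)).adjugate.transpose i j) ∈ linePoly K := by
    intro i j
    simp only [Matrix.transpose_apply, Matrix.adjugate_apply]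
    refine det_mem_subalgebra _ fun i' j' => ?_
    simp only [Matrix.updateRow_apply]
    split_ifs
    · exact (linePoly K).algebraMap_mem _
    · exact hM _ _
  have hdet := det_mem_subalgebra _ hM
  obtain ⟨s, hs, hs'⟩ := exists_common_ne_zero
    ((linePoly K).mul_mem hdet (detVal_mem _ x t hM))
    ((linePoly K).mul_mem hdet (detVal_mem _ y t' hadj)) (s := 0) (t := 1)
    (by simpa using ⟨hd₀, h₀⟩) (by simpa using ⟨hd₁, h₁⟩)
  rw [Pi.mul_apply] at hs hs'
  have hd := left_ne_zero_of_mul hs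
  refine ⟨_, hd, right_ne_zero_of_mul hs, ?_⟩
  rw [detVal_inv]
  exact mul_ne_zero (pow_ne_zero _ (pow_ne_zero _ (inv_ne_zero hd))) (right_ne_zero_of_mul hs')

theorem IsStar.exists_vol [Fintype ι] (e : P ⊕ N ≃ ι) {d : Form K ι (P ⊕ N)} (hd : d ≠ 0)
    {x : Form K ι P} {y : Form K ι N} (h : IsStar d x y) : ∃ c : K, c ≠ 0 ∧
      IsStar (vol e) x (c • y) := by
  have h0 := apply_unit_ne_zero e hd
  refine ⟨_, inv_ne_zero h0, ?_⟩
  have h1 := h.smul (d fun i => unit K (e i))⁻¹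
  have h2 : (d fun i => unit K (e i))⁻¹ • d = vol e := by
    nth_rw 2 [eq_smul_vol e d]
    rw [smul_smul, inv_mul_cancel₀ h0, one_smul]
  rwa [h2] at h1

theorem hasRank_smul_iff {r : ℕ} {x : Form K ι P} {c : K} (hc : c ≠ 0) :
    HasRank r (c • x) ↔ HasRank r x :=
  ⟨HasRank.of_smul, fun h => HasRank.of_smul (c := c⁻¹) (by rwa [smul_smul, inv_mul_cancel₀ hc,
    one_smul])⟩

theorem hasRank_zero [Fintype P] (h : 2 ≤ Fintype.card P) (x : Form K ι P) : HasRank 0 x :=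
  ⟨Fintype.card P - 2, Fintype.equivOfCardEq (by simp; omega), 0, 0, 0, by simp⟩

theorem exists_hasRank_not_succ [Fintype P] (h : 2 ≤ Fintype.card P) (x : Form K ι P) {R : ℕ}
    (hR : ¬ HasRank R x) : ∃ r < R, HasRank r x ∧ ¬ HasRank (r + 1) x := by
  classical
  have hex : ∃ R, ¬ HasRank R x := ⟨R, hR⟩
  obtain ⟨r, hr⟩ : ∃ r, Nat.find hex = r + 1 :=
    Nat.exists_eq_succ_of_ne_zero fun h0 => Nat.find_spec hex (h0 ▸ hasRank_zero h x)
  refine ⟨r, ?_, ?_, hr ▸ Nat.find_spec hex⟩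
  · have := Nat.find_min' hex hR
    omega
  · by_contra h'
    have := Nat.find_min' hex h'
    omega

theorem exists_isNormal [Infinite K] {A B : Type} [Fintype A] [Fintype B] {r₁ r₂ : ℕ}
    {x : Form K (Side B r₂ ⊕ Side A r₁) (Side B r₂)} {y : Form K (Side B r₂ ⊕ Side A r₁) (Side A r₁)}
    (h : IsStar (vol (Equiv.refl _)) x y) (hx : HasRank r₁ x) (hx' : ¬ HasRank (r₁ + 1) x)
    (hy : HasRank r₂ y) (hy' : ¬ HasRank (r₂ + 1) y) :
    ∃ (f g : (Side B r₂ ⊕ Side A r₁ → K) →ₗ[K] (Side B r₂ ⊕ Side A r₁ → K))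
      (y' : Form K (Side B r₂ ⊕ Side A r₁) (Side A r₁)),
      f ∘ₗ g = LinearMap.id ∧ IsNormal (x.compLinearMap f) y' := by
  classical
  obtain ⟨M, hM⟩ := hx.exists_detVal_ne_zero (o := fun p => Sum.inl (Sum.inl p))
    (a := fun i => Sum.inr (Sum.inl (Sum.inr (Sum.inl i))))
    (a' := fun i => Sum.inr (Sum.inl (Sum.inr (Sum.inr i))))
    (by rintro (p | i | i) (p' | i' | i') h <;> simp at h <;> rw [h])
  obtain ⟨M', hM'⟩ := hy.exists_detVal_ne_zero (o := fun p => Sum.inr (Sum.inl p))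
    (a := fun i => Sum.inl (Sum.inl (Sum.inr (Sum.inl i))))
    (a' := fun i => Sum.inl (Sum.inl (Sum.inr (Sum.inr i))))
    (by rintro (p | i | i) (p' | i' | i') h <;> simp at h <;> rw [h])
  obtain ⟨M, hd, hM, hM'⟩ := exists_detVal_ne_zero_and hM hM'
  have hu : IsUnit M.det := isUnit_iff_ne_zero.2 hd
  have hs := h.comp M⁻¹.transpose.mulVecLin M.mulVecLin (fun v w => by
    simp only [Matrix.mulVecLin_apply]
    rw [Matrix.dotProduct_mulVec, Matrix.vecMul_mulVec, Matrix.transpose_transpose,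
      Matrix.nonsing_inv_mul _ hu, Matrix.vecMul_one])
  have hsurj : Function.Surjective M⁻¹.transpose.mulVecLin := fun v => ⟨M.transpose.mulVec v, by
    rw [Matrix.mulVecLin_apply, Matrix.mulVec_mulVec, ← Matrix.transpose_mul,
      Matrix.mul_nonsing_inv _ hu, Matrix.transpose_one, Matrix.one_mulVec]⟩
  obtain ⟨c, hc, hs⟩ := hs.exists_vol (Equiv.refl _)
    (FormSystem.comp_ne_zero (FormSystem.vol_ne_zero _) _ hsurj)
  refine ⟨M.mulVecLin, M⁻¹.mulVecLin, _, ?_, hs, fun hr => hx' hr.of_compLinearMap,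
    fun hr => hy' hr.of_smul.of_compLinearMap, ?_, ?_⟩
  · rw [← Matrix.mulVecLin_mul, Matrix.mul_nonsing_inv _ hu, Matrix.mulVecLin_one]
  · rw [detLeft_windowCoord]
    rwa [detVal_eq_coord] at hM
  · rw [hs.detRight_windowCoord]
    rw [detVal_eq_coord] at hM'
    have e : ∀ s, Form.coord (c • y.compLinearMap M⁻¹.transpose.mulVecLin) s =
        c * Form.coord (y.compLinearMap M⁻¹.transpose.mulVecLin) s := fun s => rfl
    simp only [e]
    intro h0
    refine hM' ?_
    have h1 := Matrix.det_smul (Matrix.of fun i j : Fin r₂ =>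
      Form.coord (y.compLinearMap M⁻¹.transpose.mulVecLin)
      (Sum.elim (fun p => Sum.inr (Sum.inl p)) ![Sum.inl (Sum.inl (Sum.inr (Sum.inl i))),
        Sum.inl (Sum.inl (Sum.inr (Sum.inr j)))])) c
    have h2 := h1.symm.trans h0
    exact (mul_eq_zero.1 h2).resolve_left (pow_ne_zero _ hc)

end Form

/-! ### The descending chain condition for bounded systems of forms. -/

namespace FormSystem

open Form

variable {K : Type*} [Field K] {ι ι' P P' N N' κ : Type} [Fintype ι] [Fintype ι'] [Fintype P]
  [Fintype P'] [Fintype N] [Fintype N'] [Fintype κ] (X : FormSystem K)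

theorem mem_of_comp {x : Form K ι P} (f : (ι' → K) →ₗ[K] (ι → K)) (g : (ι → K) →ₗ[K] (ι' → K))
    (hfg : f ∘ₗ g = LinearMap.id) (h : x.compLinearMap f ∈ X.mem ι' P) : x ∈ X.mem ι P := by
  have h1 := X.comp h g
  have : (x.compLinearMap f).compLinearMap g = x := by
    ext v
    simp only [AlternatingMap.compLinearMap_apply]
    congr 1
    ext1 p
    exact LinearMap.congr_fun hfg (v p)
  rwa [this] at h1

theorem mem_of_reindex {x : Form K ι P} (e : P ≃ P') (h : x.domDomCongr e ∈ X.mem ι P') :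
    x ∈ X.mem ι P := by
  have h1 := X.reindex h e.symm
  have : (x.domDomCongr e).domDomCongr e.symm = x := by
    ext v
    simp [Function.comp_def]
  rwa [this] at h1

theorem mem_of_restrict {x : Form K ι P}
    (h : x.compLinearMap (restrict K ι κ) ∈ X.mem (ι ⊕ κ) P) : x ∈ X.mem ι P :=
  X.mem_of_comp (restrict K ι κ) (extend K ι κ) (by ext; simp) h

/-- Descending chains of bounded systems of forms stabilise. -/
theorem chain_stabilizes [Infinite K] (X : ℕ → FormSystem K) (hX : Antitone X) {ι₀ : Type}
    [Fintype ι₀] (h : (X 0).mem ι₀ (Fin 2) ≠ Set.univ) : ∃ i₀, ∀ i ≥ i₀, X i₀ ≤ X i := by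
  obtain ⟨R, -, hR⟩ := (X 0).exists_not_hasRank h
  choose I hI using fun r : Fin R × Fin R => exists_normal_stable X hX r.1 r.2
  refine ⟨Finset.univ.sup I, fun i hi => ?_⟩
  have hI' : ∀ (r₁ r₂ : ℕ) (_ : r₁ < R) (_ : r₂ < R) (A B : Type) [Fintype A] [Fintype B]
      (x : Form K (Side B r₂ ⊕ Side A r₁) (Side B r₂))
      (y : Form K (Side B r₂ ⊕ Side A r₁) (Side A r₁)), IsNormal x y →
      x ∈ (X (Finset.univ.sup I)).mem _ _ → x ∈ (X i).mem _ _ := by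
    intro r₁ r₂ h₁ h₂ A B _ _ x y hxy hx
    have hle : I (⟨r₁, h₁⟩, ⟨r₂, h₂⟩) ≤ Finset.univ.sup I := Finset.le_sup (Finset.mem_univ _)
    exact hI (⟨r₁, h₁⟩, ⟨r₂, h₂⟩) i (hle.trans hi) A B x y hxy (hX hle _ _ hx)
  generalize Finset.univ.sup I = i₀ at hi hI'
  -- The bound `2 * R + 2` leaves room for two lists of fewer than `R` indices and two slots on each
  -- side, so every such form can be brought into normal position with its own ranks.
  have hlarge : ∀ (ι P N : Type) [Fintype ι] [Fintype P] [Fintype N] (_ : P ⊕ N ≃ ι)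
      (_ : 2 * R + 2 ≤ Fintype.card P) (_ : 2 * R + 2 ≤ Fintype.card N),
      (X i₀).mem ι P ⊆ (X i).mem ι P := by
    intro ι P N _ _ _ e hP hN x hx
    obtain ⟨y, hy, hxy⟩ := (X i₀).star hx e _ (vol_ne_zero e)
    obtain ⟨r₁, hr₁, h1, h1'⟩ := exists_hasRank_not_succ (by omega) x
      (hR _ _ x (hX (Nat.zero_le i₀) _ _ hx))
    obtain ⟨r₂, hr₂, h2, h2'⟩ := exists_hasRank_not_succ (by omega) y
      (hR _ _ y (hX (Nat.zero_le i₀) _ _ hy))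
    have eP : P ≃ Side (Fin (Fintype.card P - 2 * r₂ - 2)) r₂ :=
      Fintype.equivOfCardEq (by simp; omega)
    have eN : N ≃ Side (Fin (Fintype.card N - 2 * r₁ - 2)) r₁ :=
      Fintype.equivOfCardEq (by simp; omega)
    let E : ι ≃ Side (Fin (Fintype.card P - 2 * r₂ - 2)) r₂ ⊕
      Side (Fin (Fintype.card N - 2 * r₁ - 2)) r₁ := e.symm.trans (Equiv.sumCongr eP eN)
    have hs := (hxy.comp (permute K E.symm) (permute K E.symm) (permute_dotProduct _)).reindex eP eN
    obtain ⟨c, hc, hs⟩ := hs.exists_vol (Equiv.refl _) (domDomCongr_ne_zero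
      (comp_ne_zero (vol_ne_zero e) _ (permute_surjective _)) _)
    obtain ⟨f, g, y', hfg, hn⟩ := exists_isNormal hs
      ((hasRank_comp_permute h1 E.symm).domDomCongr eP)
      (fun hr => h1' hr.of_domDomCongr.of_compLinearMap)
      ((hasRank_smul_iff hc).2 ((hasRank_comp_permute h2 E.symm).domDomCongr eN))
      (fun hr => h2' hr.of_smul.of_domDomCongr.of_compLinearMap)
    have hx1 := (X i₀).comp ((X i₀).reindex ((X i₀).comp hx (permute K E.symm)) eP) f
    have hx2 := hI' r₁ r₂ hr₁ hr₂ _ _ _ y' hn hx1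
    refine (X i).mem_of_comp (permute K E.symm) (permute K E) ?_
      ((X i).mem_of_reindex eP ((X i).mem_of_comp f g hfg hx2))
    ext
    simp
  intro ι P _ _ x hx
  -- A general form gets room in two moves: inflating it enlarges the number of arguments of its
  -- dual, and inflating that dual enlarges the number of arguments of the form. Both moves can be
  -- undone inside a system.
  let κ := Fin (Fintype.card P + 2 * R + 2)
  let κ' := Fin (2 * R + 2)
  let N := Fin (Fintype.card ι + 2 * R + 2)
  have e₁ : P ⊕ N ≃ ι ⊕ κ := Fintype.equivOfCardEq (by simp [N, κ]; omega)
  have e₂ : N ⊕ (P ⊕ κ') ≃ (ι ⊕ κ) ⊕ κ' :=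
    Fintype.equivOfCardEq (by simp [N, κ, κ']; omega)
  have hx₁ := (X i₀).comp hx (restrict K ι κ)
  obtain ⟨y₁, hy₁, hs₁⟩ := (X i₀).star hx₁ e₁ _ (vol_ne_zero e₁)
  have hy₂ := (X i₀).comp hy₁ (restrict K (ι ⊕ κ) κ')
  obtain ⟨x₂, hx₂, hs₂⟩ := (X i₀).star hy₂ e₂ _ (vol_ne_zero e₂)
  have hx₂' := hlarge _ _ N ((Equiv.sumComm _ _).trans e₂) (by simp [κ']) (by simp [N]) hx₂
  exact (X i).mem_of_restrict ((X i).mem_of_star_mem e₁ (vol_ne_zero e₁) hs₁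
    ((X i).mem_of_restrict ((X i).mem_of_star_mem e₂ (vol_ne_zero e₂) hs₂ hx₂')))

end FormSystem

/-! ### Hodge duals in exterior powers. -/

section Hodge

variable {K : Type u} [Field K] {V : Type u} [AddCommGroup V] [Module K V]
  {W : Type u} [AddCommGroup W] [Module K W]

open exteriorPower

theorem wedge_ιMulti {p n : ℕ} (v : Fin p → V) (w : Fin n → V) :
    wedge (ιMulti K p v) (ιMulti K n w) = ιMulti K (p + n) (Fin.append v w) := by
  apply Subtype.ext
  simp only [wedge, ιMulti_apply_coe, ExteriorAlgebra.ιMulti_apply]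
  rw [← List.prod_append, ← List.ofFn_fin_append]
  congr 2
  ext1 i
  induction i using Fin.addCases <;> simp

/-- The wedge product as a bilinear map. -/
def wedgeHom (K : Type u) [Field K] (V : Type u) [AddCommGroup V] [Module K V] (p n : ℕ) :
    ⋀[K]^p V →ₗ[K] ⋀[K]^n V →ₗ[K] ⋀[K]^(p + n) V :=
  LinearMap.mk₂ K wedge (fun _ _ _ => Subtype.ext (add_mul _ _ _))
    (fun _ _ _ => Subtype.ext (smul_mul_assoc _ _ _)) (fun _ _ _ => Subtype.ext (mul_add _ _ _))
    (fun _ _ _ => Subtype.ext (mul_smul_comm _ _ _))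

@[simp] theorem wedgeHom_apply {p n : ℕ} (ω : ⋀[K]^p V) (ω' : ⋀[K]^n V) :
    wedgeHom K V p n ω ω' = wedge ω ω' := rfl

/-- The volume form given by a functional on the top exterior power. -/
def topForm {p n : ℕ} (ψ : ⋀[K]^(p + n) V →ₗ[K] K) : V [⋀^(Fin p ⊕ Fin n)]→ₗ[K] K :=
  (ψ.compAlternatingMap (ιMulti K (p + n))).domDomCongr finSumFinEquiv.symm

theorem topForm_apply {p n : ℕ} (ψ : ⋀[K]^(p + n) V →ₗ[K] K) (v : Fin p ⊕ Fin n → V) :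
    topForm ψ v = ψ (wedge (ιMulti K p (v ∘ Sum.inl)) (ιMulti K n (v ∘ Sum.inr))) := by
  rw [wedge_ιMulti]
  simp only [topForm, AlternatingMap.domDomCongr_apply, LinearMap.compAlternatingMap_apply]
  congr 2
  ext1 i
  induction i using Fin.addCases <;> simp

/-- Wedging with the last `n` basis vectors kills every basis element of the `p`-th power except
that of the first `p` vectors, so it reads off one coordinate. -/
theorem wedge_basis {p n : ℕ} (ψ : ⋀[K]^(p + n) V →ₗ[K] K) (e : Basis (Fin p ⊕ Fin n) K V)
    (ω : ⋀[K]^p V) : ψ (wedge ω (ιMulti K n (e ∘ Sum.inr))) =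
      pairingDual K V p (ιMulti K p (e.coord ∘ Sum.inl)) ω * topForm ψ e := by
  have h : ψ ∘ₗ (wedgeHom K V p n).flip (ιMulti K n (e ∘ Sum.inr)) =
      topForm ψ e • pairingDual K V p (ιMulti K p (e.coord ∘ Sum.inl)) := by
    apply exteriorPower.linearMap_ext
    refine e.ext_alternating fun s hs => ?_
    simp only [LinearMap.compAlternatingMap_apply, LinearMap.comp_apply, LinearMap.flip_apply,
      wedgeHom_apply, LinearMap.smul_apply, smul_eq_mul]
    by_cases hN : ∃ i j, s i = Sum.inr j
    · obtain ⟨i, j, hij⟩ := hN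
      rw [wedge_ιMulti, pairingDual_ιMulti_ιMulti, Matrix.det_eq_zero_of_row_eq_zero i,
        mul_zero]
      · rw [AlternatingMap.map_eq_zero_of_eq (i := Fin.castAdd n i) (j := Fin.natAdd p j), map_zero]
        · simp [hij]
        · intro h
          have := congrArg Fin.val h
          simp at this
          omega
      · intro k
        simp [hij]
    · push Not at hN
      have h1 : ∀ i, ∃ j, s i = Sum.inl j := fun i => by
        rcases h : s i with j | j
        · exact ⟨j, rfl⟩
        · exact absurd h (hN i j)
      choose t ht using h1
      have htinj : Function.Injective t := fun i j hij => hs (by rw [ht, ht, hij])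
      let σ : Equiv.Perm (Fin p) := Equiv.ofBijective t (Finite.injective_iff_bijective.1 htinj)
      have hv : (fun i => e (s i)) = (e ∘ Sum.inl) ∘ σ := by
        ext1 i
        simp [ht, σ]
      rw [hv, AlternatingMap.map_perm]
      have h2 : wedge (Equiv.Perm.sign σ • ιMulti K p (e ∘ Sum.inl)) (ιMulti K n (e ∘ Sum.inr)) =
          Equiv.Perm.sign σ • wedge (ιMulti K p (e ∘ Sum.inl)) (ιMulti K n (e ∘ Sum.inr)) := by
        rw [← wedgeHom_apply, ← wedgeHom_apply, Units.smul_def, map_zsmul]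
        rfl
      have h3 : pairingDual K V p (ιMulti K p (e.coord ∘ Sum.inl)) (ιMulti K p (e ∘ Sum.inl)) =
          1 := by
        rw [pairingDual_ιMulti_ιMulti]
        have : (Matrix.of fun i j => (e.coord ∘ Sum.inl) j ((e ∘ Sum.inl) i)) =
            (1 : Matrix (Fin p) (Fin p) K) := by
          ext i j
          simp [Matrix.one_apply, Finsupp.single_apply]
        rw [this, Matrix.det_one]
      rw [h2, topForm_apply]
      simp only [Units.smul_def, map_zsmul, h3]
      simp [mul_comm]
  have := LinearMap.congr_fun h ω
  simpa [mul_comm] using this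

variable [FiniteDimensional K V] [FiniteDimensional K W]

theorem pairingDual_bijective (p : ℕ) : Function.Bijective (pairingDual K V p) := by
  have hs : Function.Surjective (pairingDual K V p) := by
    let b := finBasis K V
    rw [← LinearMap.range_eq_top, eq_top_iff, ← (b.exteriorPower p).dualBasis.span_eq,
      Submodule.span_le]
    rintro _ ⟨s, rfl⟩
    rw [Basis.coe_dualBasis, basis_coord]
    exact ⟨_, rfl⟩
  refine ⟨(LinearMap.injective_iff_surjective_of_finrank_eq_finrank ?_).2 hs, hs⟩
  rw [finrank_eq, Subspace.dual_finrank_eq, Subspace.dual_finrank_eq, finrank_eq]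

/-- The identification of the exterior power of the dual with the dual of the exterior power. -/
noncomputable def pairingEquiv (K : Type u) [Field K] (V : Type u) [AddCommGroup V] [Module K V]
    [FiniteDimensional K V] (p : ℕ) : ⋀[K]^p (Dual K V) ≃ₗ[K] Dual K (⋀[K]^p V) :=
  LinearEquiv.ofBijective (pairingDual K V p) (pairingDual_bijective p)

@[simp] theorem pairingEquiv_apply (p : ℕ) (η : ⋀[K]^p (Dual K V)) :
    pairingEquiv K V p η = pairingDual K V p η := rfl

omit [FiniteDimensional K V] [FiniteDimensional K W] in
theorem pairingDual_map (p : ℕ) (f : V →ₗ[K] W) (η : ⋀[K]^p (Dual K W)) (θ : ⋀[K]^p V) :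
    pairingDual K V p (exteriorPower.map p f.dualMap η) θ =
      pairingDual K W p η (exteriorPower.map p f θ) := by
  have h : (pairingDual K V p ∘ₗ exteriorPower.map p f.dualMap) =
      (exteriorPower.map p f).dualMap ∘ₗ pairingDual K W p := by
    apply exteriorPower.linearMap_ext
    ext g : 1
    apply exteriorPower.linearMap_ext
    ext v
    simp
  exact LinearMap.congr_fun (LinearMap.congr_fun h η) θ

omit [FiniteDimensional K V] in
theorem pairingDual_eval (p : ℕ) (η : ⋀[K]^p (Dual K V)) (θ : ⋀[K]^p V) :
    pairingDual K (Dual K V) p (exteriorPower.map p (Dual.eval K V) θ) η =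
      pairingDual K V p η θ := by
  have h : (pairingDual K (Dual K V) p ∘ₗ exteriorPower.map p (Dual.eval K V)) =
      (pairingDual K V p).flip := by
    apply exteriorPower.linearMap_ext
    ext g : 1
    apply exteriorPower.linearMap_ext
    ext v
    simp only [LinearMap.compAlternatingMap_apply, LinearMap.comp_apply, map_apply_ιMulti,
      pairingDual_ιMulti_ιMulti, LinearMap.flip_apply]
    rw [← Matrix.det_transpose]
    rfl
  exact LinearMap.congr_fun (LinearMap.congr_fun h θ) η

theorem exists_hodge {p n : ℕ} (h : finrank K V = p + n) (ψ : ⋀[K]^(p + n) V ≃ₗ[K] K) :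
    ∃ star : ⋀[K]^p V →ₗ[K] ⋀[K]^n (Dual K V), IsHodgeDual star ∧
      ∀ ω ω', pairingDual K V n (star ω) ω' = ψ (wedge ω ω') := by
  let star : ⋀[K]^p V →ₗ[K] ⋀[K]^n (Dual K V) := (pairingEquiv K V n).symm.toLinearMap ∘ₗ
    (wedgeHom K V p n).compr₂ ψ.toLinearMap
  have hs : ∀ ω ω', pairingDual K V n (star ω) ω' = ψ (wedge ω ω') := by
    intro ω ω'
    rw [← pairingEquiv_apply]
    simp [star]
  exact ⟨star, ⟨h, ψ, hs⟩, hs⟩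

theorem exists_topEquiv {m : ℕ} (h : finrank K V = m) : Nonempty (⋀[K]^m V ≃ₗ[K] K) :=
  FiniteDimensional.nonempty_linearEquiv_of_finrank_eq (by rw [finrank_eq, h, Nat.choose_self, finrank_self])

omit [FiniteDimensional K V] in
theorem IsHodgeDual.smul {p n : ℕ} {star : ⋀[K]^p V →ₗ[K] ⋀[K]^n (Dual K V)}
    (h : IsHodgeDual star) {c : K} (hc : c ≠ 0) : IsHodgeDual (c • star) := by
  obtain ⟨h, ψ, hψ⟩ := h
  refine ⟨h, ψ.trans (LinearEquiv.smulOfNeZero K K c hc), fun ω ω' => ?_⟩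
  simp [hψ]

omit [FiniteDimensional K V] in
theorem topForm_ne_zero {p n : ℕ} (ψ : ⋀[K]^(p + n) V ≃ₗ[K] K)
    (e : Basis (Fin p ⊕ Fin n) K V) : topForm ψ.toLinearMap e ≠ 0 := by
  intro h
  have h1 : topForm ψ.toLinearMap = 0 := by
    refine e.ext_alternating fun s hs => ?_
    let σ : Equiv.Perm (Fin p ⊕ Fin n) :=
      Equiv.ofBijective s (Finite.injective_iff_bijective.1 hs)
    have := (topForm ψ.toLinearMap).map_perm e σ
    rw [h, smul_zero] at this
    exact this
  have h2 : ψ.toLinearMap = 0 := by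
    apply exteriorPower.linearMap_ext
    have := congrArg (fun f => f.domDomCongr finSumFinEquiv) h1
    ext v
    have h3 := congrArg (fun f => f (v ∘ finSumFinEquiv)) h1
    simpa [topForm, Function.comp_def] using h3
  have h3 := LinearMap.congr_fun h2 (ψ.symm 1)
  simp at h3

/-- Every Hodge dual has a Hodge dual as its inverse, up to the identification of the double
dual. -/
theorem IsHodgeDual.exists_inverse {p n : ℕ} {star : ⋀[K]^p V →ₗ[K] ⋀[K]^n (Dual K V)}
    (h : IsHodgeDual star) : ∃ star' : ⋀[K]^n (Dual K V) →ₗ[K] ⋀[K]^p (Dual K (Dual K V)),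
      IsHodgeDual star' ∧ star' ∘ₗ star = exteriorPower.map p (Dual.eval K V) := by
  obtain ⟨h, ψ, hψ⟩ := h
  have h' : finrank K (Dual K V) = n + p := by rw [Subspace.dual_finrank_eq, h, add_comm]
  obtain ⟨ψ'⟩ := exists_topEquiv h'
  obtain ⟨star', hs, hs'⟩ := exists_hodge h' ψ'
  let e : Basis (Fin p ⊕ Fin n) K V := (finBasisOfFinrankEq K V h).reindex finSumFinEquiv.symm
  let D' : Dual K V [⋀^(Fin p ⊕ Fin n)]→ₗ[K] K :=
    (topForm ψ'.toLinearMap).domDomCongr (Equiv.sumComm (Fin n) (Fin p))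
  have hD' : ∀ e : Basis (Fin p ⊕ Fin n) K V,
      D' e.coord = topForm ψ'.toLinearMap (e.dualBasis.reindex (Equiv.sumComm (Fin p) (Fin n))) := by
    intro e
    simp only [D', AlternatingMap.domDomCongr_apply]
    congr 1
    ext1 i
    simp
  -- Reordering the basis multiplies both volume factors by the same sign, so their product `c` is
  -- the same for all coordinates and the composite is a scalar multiple of the evaluation map.
  let c : K := topForm ψ.toLinearMap e * D' e.coord
  have hc : c ≠ 0 := mul_ne_zero (topForm_ne_zero ψ e) (by rw [hD']; exact topForm_ne_zero ψ' _)
  have key : star' ∘ₗ star = c • exteriorPower.map p (Dual.eval K V) := by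
    refine LinearMap.ext fun ω => ?_
    apply (pairingDual_bijective p).1
    apply exteriorPower.linearMap_ext
    refine e.dualBasis.ext_alternating fun s hs => ?_
    obtain ⟨σ, hσ⟩ := Form.exists_equiv_extend (Equiv.sumComm (Fin n) (Fin p)) s hs
    let τ : Equiv.Perm (Fin p ⊕ Fin n) := (Equiv.sumComm (Fin p) (Fin n)).trans σ
    let e' := e.reindex τ.symm
    have he' : ∀ i, e' i = e (τ i) := fun i => by simp [e']
    have hec : ∀ i, e'.coord i = e.coord (τ i) := fun i => by
      ext v
      simp [e']
    have hf : (fun i => e.dualBasis (s i)) = e'.coord ∘ Sum.inl := by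
      ext1 i
      rw [Function.comp_apply, hec, ← hσ]
      simp [τ]
    rw [hf]
    simp only [LinearMap.compAlternatingMap_apply, LinearMap.comp_apply, LinearMap.smul_apply,
      map_smul, smul_eq_mul, hs', pairingDual_eval]
    have h1 := wedge_basis ψ'.toLinearMap
      (e'.dualBasis.reindex (Equiv.sumComm (Fin p) (Fin n))) (star ω)
    have h2 : (e'.dualBasis.reindex (Equiv.sumComm (Fin p) (Fin n)) : _ → Dual K V) ∘ Sum.inr =
        e'.coord ∘ Sum.inl := by
      ext1 i
      simp
    have h3 : (e'.dualBasis.reindex (Equiv.sumComm (Fin p) (Fin n))).coord ∘ Sum.inl =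
        Dual.eval K V ∘ (e' ∘ Sum.inr) := by
      ext i f
      simp [Basis.repr_reindex_apply, -Basis.repr_reindex]
    rw [h2, h3, ← map_apply_ιMulti, pairingDual_eval, hψ] at h1
    have h4 := wedge_basis ψ.toLinearMap e' ω
    rw [LinearEquiv.coe_coe] at h1 h4
    rw [h1, h4, ← hD']
    have h5 : topForm ψ.toLinearMap e' * D' e'.coord = c := by
      have e1 : (e' : _ → V) = e ∘ τ := funext he'
      have e2 : e'.coord = e.coord ∘ τ := funext hec
      rw [e1, e2, AlternatingMap.map_perm, AlternatingMap.map_perm, smul_mul_smul_comm,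
        Int.units_mul_self, one_smul]
    rw [← h5]
    ring
  refine ⟨c⁻¹ • star', hs.smul (inv_ne_zero hc), ?_⟩
  rw [LinearMap.smul_comp, key, smul_smul, inv_mul_cancel₀ hc, one_smul]

/-- Applying a Hodge dual rescaled by `c` and then the inverse of the unscaled one multiplies by
`c`. If `p` exceeds the dimension, the exterior power is zero. -/
theorem PluckerVariety.smul_mem (X : PluckerVariety K) {p : ℕ} {ω : ⋀[K]^p V} (h : ω ∈ X.obj p V)
    {c : K} (hc : c ≠ 0) : c • ω ∈ X.obj p V := by
  rcases le_or_gt p (finrank K V) with hp | hp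
  · obtain ⟨n, hn⟩ := Nat.exists_eq_add_of_le hp
    obtain ⟨ψ⟩ := exists_topEquiv hn
    obtain ⟨star, hs, -⟩ := exists_hodge hn ψ
    obtain ⟨star', hs', hinv⟩ := hs.exists_inverse
    have h1 := X.hodge_mem _ _ _ _ hs' _ (X.hodge_mem _ _ _ _ (hs.smul hc) _ h)
    have h2 := X.map_mem _ _ _ (evalEquiv K V).symm.toLinearMap _ h1
    have h3 := LinearMap.congr_fun hinv ω
    rw [LinearMap.comp_apply] at h3
    rw [LinearMap.smul_apply, map_smul, h3, map_smul, ← LinearMap.comp_apply,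
      ← exteriorPower.map_comp] at h2
    have h4 : (evalEquiv K V).symm.toLinearMap ∘ₗ Dual.eval K V = LinearMap.id := by
      ext v
      exact (evalEquiv K V).symm_apply_apply v
    rwa [h4, exteriorPower.map_id, LinearMap.id_apply] at h2
  · have : Subsingleton (⋀[K]^p V) := by
      rw [← finrank_zero_iff (R := K), finrank_eq, Nat.choose_eq_zero_of_lt hp]
    rwa [Subsingleton.elim (c • ω) ω]

end Hodge

/-! ### Exterior powers of dual coordinate spaces as spaces of forms. -/

section FormEquiv

variable {K : Type u} [Field K]

theorem IsZariskiClosed.coordClosed {W : Type u} [AddCommGroup W] [Module K W] {Z : Set W}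
    (hZ : IsZariskiClosed K Z) {σ : Type*} [Finite σ] (L : (σ → K) →ₗ[K] W) :
    CoordClosed (L ⁻¹' Z) := by
  classical
  have := Fintype.ofFinite σ
  obtain ⟨S, rfl⟩ := hZ
  refine ⟨(fun f c => PolyOn.evalAt (L c) f) '' S, ?_, ?_⟩
  · rintro _ ⟨f, -, rfl⟩
    have h : (fun y : Dual K W → K => MvPolynomial.eval y f) ∈ polyFun K (Dual K W) :=
      ⟨f, fun _ => rfl⟩
    have hF : ∀ ℓ : Dual K W, (fun c : σ → K => ℓ (L c)) ∈ polyFun K σ := by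
      intro ℓ
      have : (fun c : σ → K => ℓ (L c)) = fun c => ∑ i, c i * ℓ (L (Pi.single i 1)) := by
        ext c
        conv_lhs => rw [← Finset.univ_sum_single c]
        simp only [map_sum]
        refine Finset.sum_congr rfl fun i _ => ?_
        rw [← smul_eq_mul, ← map_smul, ← map_smul, ← Pi.single_smul, smul_eq_mul, mul_one]
      rw [this]
      exact polyFun_sum _ fun i => polyFun_mul (polyFun_coord i) (polyFun_const _)
    exact polyFun_comp (F := fun (c : σ → K) (ℓ : Dual K W) => ℓ (L c)) hF h
  · ext c
    simp [PolyOn.zeroLocus]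

variable {ι ι' : Type} [Fintype ι] [Fintype ι']

/-- Elements of exterior powers of the dual of a coordinate space, viewed as forms. -/
noncomputable def formEquiv (K : Type u) [Field K] (p : ℕ) (ι : Type) [Fintype ι] :
    ⋀[K]^p (Dual K (ι → K)) ≃ₗ[K] Form K ι (Fin p) :=
  (pairingEquiv K (ι → K) p).trans exteriorPower.alternatingMapLinearEquiv.symm

theorem formEquiv_apply {p : ℕ} (ω : ⋀[K]^p (Dual K (ι → K))) (v : Fin p → ι → K) :
    formEquiv K p ι ω v =
      exteriorPower.pairingDual K (ι → K) p ω (exteriorPower.ιMulti K p v) := by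
  simp [formEquiv]

theorem formEquiv_map {p : ℕ} (f : (ι' → K) →ₗ[K] (ι → K)) (ω : ⋀[K]^p (Dual K (ι → K))) :
    formEquiv K p ι' (exteriorPower.map p f.dualMap ω) =
      (formEquiv K p ι ω).compLinearMap f := by
  ext v
  rw [formEquiv_apply, pairingDual_map, AlternatingMap.compLinearMap_apply, formEquiv_apply,
    exteriorPower.map_apply_ιMulti]
  rfl

/-- The Hodge dual of a form, computed in the exterior powers. -/
theorem isStar_formEquiv {p n : ℕ} (h : Fintype.card ι = p + n)
    (ψ : ⋀[K]^(p + n) (Dual K (ι → K)) ≃ₗ[K] K)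
    {star : ⋀[K]^p (Dual K (ι → K)) →ₗ[K] ⋀[K]^n (Dual K (Dual K (ι → K)))}
    (hs : ∀ ω ω', exteriorPower.pairingDual K (Dual K (ι → K)) n (star ω) ω' = ψ (wedge ω ω'))
    [DecidableEq ι] (ω : ⋀[K]^p (Dual K (ι → K))) :
    Form.IsStar ((topForm ψ.toLinearMap).compLinearMap (dotProductEquiv K ι).toLinearMap)
      (formEquiv K p ι ω) (formEquiv K n ι
        (exteriorPower.map n (dotProductEquiv K ι).toLinearMap.dualMap (star ω))) := by
  intro G G' hG
  -- Through the dot product, `G` becomes a basis of the dual space whose coordinate functionals are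
  -- evaluations at `G'`; then `wedge_basis` is the defining identity of `IsStar`.
  have hli : LinearIndependent K fun i => dotProductEquiv K ι (G i) := by
    rw [Fintype.linearIndependent_iff]
    intro c hc j
    have h1 := LinearMap.congr_fun hc (G' j)
    rw [LinearMap.sum_apply, Finset.sum_eq_single j] at h1
    · simpa [hG.1 j] using h1
    · intro i _ hij
      simp [hG.2 i j hij]
    · simp
  have hfr : finrank K (Dual K (ι → K)) = p + n := by
    rw [Subspace.dual_finrank_eq, finrank_fintype_fun_eq_card, h]
  let e : Basis (Fin p ⊕ Fin n) K (Dual K (ι → K)) := Basis.mk hli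
    (hli.span_eq_top_of_card_eq_finrank' (by simp [hfr])).ge
  have he : ∀ i, e i = dotProductEquiv K ι (G i) := fun i => by simp [e]
  have hec : ∀ i, e.coord i = Dual.eval K (ι → K) (G' i) := by
    intro i
    refine e.ext fun j => ?_
    rw [Basis.coord_apply, Basis.repr_self, he, Dual.eval_apply, dotProductEquiv_apply_apply]
    by_cases hij : j = i
    · subst hij
      rw [hG.1, Finsupp.single_eq_same]
    · rw [hG.2 j i hij, Finsupp.single_eq_of_ne (Ne.symm hij)]
  have h1 := wedge_basis ψ.toLinearMap e ω
  have h2 : e ∘ Sum.inr = (dotProductEquiv K ι).toLinearMap ∘ (G ∘ Sum.inr) := by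
    ext1 i
    exact he _
  have h3 : e.coord ∘ Sum.inl = Dual.eval K (ι → K) ∘ (G' ∘ Sum.inl) := by
    ext1 i
    exact hec _
  have h4 : (e : _ → _) = fun i => (dotProductEquiv K ι).toLinearMap (G i) := funext he
  rw [formEquiv_apply, pairingDual_map, hs, exteriorPower.map_apply_ιMulti, ← h2, formEquiv_apply,
    ← pairingDual_eval, exteriorPower.map_apply_ιMulti, ← h3, AlternatingMap.compLinearMap_apply,
    ← h4, mul_comm]
  exact h1

end FormEquiv

/-! ### From Plücker varieties to systems of forms. -/

namespace PluckerVariety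

variable {K : Type u} [Field K] (X : PluckerVariety K) {ι ι' P : Type} [Fintype ι] [Fintype ι']
  [Fintype P]

theorem smul_mem_iff {V : Type u} [AddCommGroup V] [Module K V] [FiniteDimensional K V] {p : ℕ}
    {ω : ⋀[K]^p V} {c : K} (hc : c ≠ 0) : c • ω ∈ X.obj p V ↔ ω ∈ X.obj p V :=
  ⟨fun h => by simpa [smul_smul, inv_mul_cancel₀ hc] using X.smul_mem h (inv_ne_zero hc),
    fun h => X.smul_mem h hc⟩

/-- The forms belonging to a Plücker variety. -/
def formMem (ι P : Type) [Fintype ι] [Fintype P] : Set (Form K ι P) :=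
  {x | (formEquiv K (Fintype.card P) ι).symm (x.domDomCongr (Fintype.equivFin P)) ∈
    X.obj (Fintype.card P) (Dual K (ι → K))}

/-- Another enumeration of the arguments changes the form by a sign only, and membership is
invariant under nonzero scalars. -/
theorem mem_formMem_iff {p : ℕ} (e : P ≃ Fin p) {x : Form K ι P} :
    x ∈ X.formMem ι P ↔
      (formEquiv K p ι).symm (x.domDomCongr e) ∈ X.obj p (Dual K (ι → K)) := by
  obtain rfl : p = Fintype.card P := by simpa using (Fintype.card_congr e).symm
  have h : x.domDomCongr e = Equiv.Perm.sign ((Fintype.equivFin P).symm.trans e) •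
      x.domDomCongr (Fintype.equivFin P) := by
    rw [← AlternatingMap.domDomCongr_perm, ← AlternatingMap.domDomCongr_trans,
      ← Equiv.trans_assoc, Equiv.self_trans_symm, Equiv.refl_trans]
  rw [h]
  rcases Int.units_eq_one_or (Equiv.Perm.sign ((Fintype.equivFin P).symm.trans e)) with h | h <;>
    rw [h]
  · rw [one_smul]
    rfl
  · have h1 (y : Form K ι (Fin (Fintype.card P))) : (-1 : ℤˣ) • y = (-1 : K) • y := by
      ext v
      simp [Units.smul_def]
    rw [h1, map_smul, smul_mem_iff _ (by simp)]
    rfl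

theorem formEquiv_mem_formMem_iff {p : ℕ} (e : Fin p ≃ P) {ω : ⋀[K]^p (Dual K (ι → K))} :
    (formEquiv K p ι ω).domDomCongr e ∈ X.formMem ι P ↔ ω ∈ X.obj p (Dual K (ι → K)) := by
  rw [mem_formMem_iff X e.symm, ← AlternatingMap.domDomCongr_trans, Equiv.self_trans_symm,
    AlternatingMap.domDomCongr_refl, LinearEquiv.symm_apply_apply]

theorem exists_formEquiv {p : ℕ} (e : Fin p ≃ P) {x : Form K ι P} (hx : x ∈ X.formMem ι P) :
    ∃ ω ∈ X.obj p (Dual K (ι → K)), x = (formEquiv K p ι ω).domDomCongr e := by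
  refine ⟨_, (mem_formMem_iff X e.symm).1 hx, ?_⟩
  rw [LinearEquiv.apply_symm_apply, ← AlternatingMap.domDomCongr_trans, Equiv.symm_trans_self,
    AlternatingMap.domDomCongr_refl]

/-- A Hodge dual takes values over the double dual, which the dot product brings back to the dual.
Volume forms are proportional, so rescaling reaches every nonzero `d`. -/
theorem exists_star_mem_formMem {N : Type} [Fintype N] {x : Form K ι P} (hx : x ∈ X.formMem ι P)
    (e : P ⊕ N ≃ ι) {d : Form K ι (P ⊕ N)} (hd : d ≠ 0) :
    ∃ y ∈ X.formMem ι N, Form.IsStar d x y := by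
  classical
  obtain ⟨p, ⟨eP⟩⟩ := Finite.exists_equiv_fin P
  obtain ⟨n, ⟨eN⟩⟩ := Finite.exists_equiv_fin N
  obtain ⟨ω, hω, rfl⟩ := X.exists_formEquiv eP.symm hx
  have h : Fintype.card ι = p + n := by
    rw [← Fintype.card_congr e, Fintype.card_sum, Fintype.card_congr eP, Fintype.card_congr eN,
      Fintype.card_fin, Fintype.card_fin]
  have hfr : finrank K (Dual K (ι → K)) = p + n := by
    rw [Subspace.dual_finrank_eq, finrank_fintype_fun_eq_card, h]
  obtain ⟨ψ⟩ := exists_topEquiv hfr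
  obtain ⟨star, hs, hs'⟩ := exists_hodge hfr ψ
  have h1 := (isStar_formEquiv h ψ hs' ω).reindex eP.symm eN.symm
  have h2 := X.map_mem _ _ _ (dotProductEquiv K ι).toLinearMap.dualMap _
    (X.hodge_mem _ _ _ _ hs _ hω)
  set d' := ((topForm ψ.toLinearMap).compLinearMap
    (dotProductEquiv K ι).toLinearMap).domDomCongr (Equiv.sumCongr eP.symm eN.symm) with hd'
  have hne : d' ≠ 0 := by
    refine FormSystem.domDomCongr_ne_zero (fun h0 => ?_) _
    let b : Basis (Fin p ⊕ Fin n) K (ι → K) :=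
      (Pi.basisFun K ι).reindex (((Equiv.sumCongr eP.symm eN.symm).trans e).symm)
    refine topForm_ne_zero ψ (b.map (dotProductEquiv K ι)) ?_
    have h1 : topForm ψ.toLinearMap (fun i => dotProductEquiv K ι (b i)) = 0 :=
      congrArg (fun f => f b) h0
    have h2 : ⇑(b.map (dotProductEquiv K ι)) = fun i => dotProductEquiv K ι (b i) := by
      ext1 i
      rw [Basis.map_apply]
    rw [h2, h1]
  have h3 : d = (d (fun i => Form.unit K (e i)) * (d' fun i => Form.unit K (e i))⁻¹) • d' := by
    conv_rhs => rw [Form.eq_smul_vol e d']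
    conv_lhs => rw [Form.eq_smul_vol e d]
    rw [smul_smul]
    congr 1
    rw [AlternatingMap.smul_apply, Form.vol_unit, smul_eq_mul, mul_one,
      inv_mul_cancel_right₀ (Form.apply_unit_ne_zero e hne)]
  have hc := mul_ne_zero (Form.apply_unit_ne_zero e hd)
    (inv_ne_zero (Form.apply_unit_ne_zero e hne))
  generalize d (fun i => Form.unit K (e i)) * (d' fun i => Form.unit K (e i))⁻¹ = c at h3 hc
  have h4 := h1.smul c
  rw [← h3, ← AlternatingMap.domDomCongr_smul, ← map_smul] at h4
  exact ⟨_, (X.formEquiv_mem_formMem_iff eN.symm).2 (X.smul_mem h2 hc), h4⟩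

/-- The system of forms of a Plücker variety. -/
def formSystem : FormSystem K where
  mem ι P _ _ := X.formMem ι P
  closed ι P _ _ := by
    let coordₗ : Form K ι P →ₗ[K] ((P → ι) → K) :=
      { toFun := Form.coord
        map_add' := fun _ _ => rfl
        map_smul' := fun _ _ => rfl }
    obtain ⟨q, hq⟩ := coordₗ.exists_leftInverse_of_injective
      (LinearMap.ker_eq_bot.2 fun x x' h => Form.ext_coord fun s _ => congrFun h s)
    refine ⟨_, (X.isClosed (Fintype.card P) (Dual K (ι → K))).coordClosed
      ((formEquiv K (Fintype.card P) ι).symm.toLinearMap ∘ₗ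
        (AlternatingMap.domDomCongrₗ K (Fintype.equivFin P)).toLinearMap ∘ₗ q), fun x => ?_⟩
    have : q x.coord = x := LinearMap.congr_fun hq x
    simp only [Set.mem_preimage, LinearMap.comp_apply, this]
    rfl
  comp {ι ι' P} _ _ _ x hx f := by
    obtain ⟨ω, hω, rfl⟩ := X.exists_formEquiv (Fintype.equivFin P).symm hx
    have := (X.formEquiv_mem_formMem_iff (Fintype.equivFin P).symm).2
      (X.map_mem _ _ _ f.dualMap _ hω)
    rwa [formEquiv_map] at this
  reindex {ι P P'} _ _ _ x hx e := by
    rw [X.mem_formMem_iff (e.symm.trans (Fintype.equivFin P)), ← AlternatingMap.domDomCongr_trans,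
      ← Equiv.trans_assoc, Equiv.self_trans_symm, Equiv.refl_trans]
    exact hx
  star hx e _ hd := X.exists_star_mem_formMem hx e hd

theorem mem_formSystem_iff {p : ℕ} {ω : ⋀[K]^p (Dual K (ι → K))} :
    formEquiv K p ι ω ∈ X.formSystem.mem ι (Fin p) ↔ ω ∈ X.obj p (Dual K (ι → K)) :=
  X.formEquiv_mem_formMem_iff (Equiv.refl _)

variable {V : Type u} [AddCommGroup V] [Module K V] [FiniteDimensional K V] {W : Type u}
  [AddCommGroup W] [Module K W] [FiniteDimensional K W]

theorem map_mem_iff {p : ℕ} {φ : V →ₗ[K] W} {φ' : W →ₗ[K] V} (h : φ' ∘ₗ φ = LinearMap.id)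
    {ω : ⋀[K]^p V} : exteriorPower.map p φ ω ∈ X.obj p W ↔ ω ∈ X.obj p V := by
  refine ⟨fun hω => ?_, fun hω => X.map_mem _ _ _ _ _ hω⟩
  have := X.map_mem _ _ _ φ' _ hω
  rwa [← LinearMap.comp_apply, ← exteriorPower.map_comp, h, exteriorPower.map_id] at this

/-- Every finite-dimensional space is the dual of a coordinate space. -/
noncomputable def dualCoordEquiv (K : Type u) [Field K] (V : Type u) [AddCommGroup V] [Module K V]
    [FiniteDimensional K V] : V ≃ₗ[K] Dual K (Fin (finrank K V) → K) :=
  (finBasis K V).equivFun.trans (dotProductEquiv K _)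

theorem obj_subset_of_formSystem_le {X Y : PluckerVariety K} (h : X.formSystem ≤ Y.formSystem)
    (p : ℕ) (V : Type u) [AddCommGroup V] [Module K V] [FiniteDimensional K V] :
    X.obj p V ⊆ Y.obj p V := by
  intro ω hω
  have e : (dualCoordEquiv K V).symm.toLinearMap ∘ₗ (dualCoordEquiv K V).toLinearMap =
      LinearMap.id := by ext; simp
  rw [← map_mem_iff _ e, ← mem_formSystem_iff] at hω ⊢
  exact h _ _ hω

theorem formSystem_mono {X Y : PluckerVariety K}
    (h : ∀ (p : ℕ) (V : Type u) [AddCommGroup V] [Module K V] [FiniteDimensional K V],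
      X.obj p V ⊆ Y.obj p V) : X.formSystem ≤ Y.formSystem :=
  fun _ _ _ _ _ hx => h _ _ hx

theorem formSystem_mem_ne_univ (h : X.obj 2 V ≠ Set.univ) :
    X.formSystem.mem (Fin (finrank K V)) (Fin 2) ≠ Set.univ := by
  contrapose! h
  refine Set.eq_univ_of_forall fun ω => ?_
  have e : (dualCoordEquiv K V).symm.toLinearMap ∘ₗ (dualCoordEquiv K V).toLinearMap =
      LinearMap.id := by ext; simp
  rw [← map_mem_iff _ e, ← mem_formSystem_iff, h]
  trivial

end PluckerVariety

/-! ### Compositions of exterior powers of linear maps and Hodge duals. -/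

section PluckerMap

variable {K : Type u} [Field K] {p q r : ℕ} {V : Type u} [AddCommGroup V] [Module K V]
  [FiniteDimensional K V] {W : Type u} [AddCommGroup W] [Module K W] [FiniteDimensional K W]
  {U : Type u} [AddCommGroup U] [Module K U] [FiniteDimensional K U]

theorem IsPluckerMap.comp {L : ⋀[K]^p V →ₗ[K] ⋀[K]^q W} (hL : IsPluckerMap L)
    {L' : ⋀[K]^q W →ₗ[K] ⋀[K]^r U} (hL' : IsPluckerMap L') : IsPluckerMap (L' ∘ₗ L) := by
  induction hL' with
  | refl => exact hL
  | map L' φ _ ih => exact .map _ φ ih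
  | hodge L' star hs _ ih => exact .hodge _ star hs ih

theorem isPluckerMap_map (p : ℕ) (φ : V →ₗ[K] W) : IsPluckerMap (exteriorPower.map p φ) :=
  .map _ φ .refl

theorem IsHodgeDual.isPluckerMap {n : ℕ} {star : ⋀[K]^p V →ₗ[K] ⋀[K]^n (Dual K V)}
    (h : IsHodgeDual star) : IsPluckerMap star :=
  .hodge _ star h .refl

theorem PluckerVariety.mem_of_isPluckerMap (X : PluckerVariety K) {L : ⋀[K]^p V →ₗ[K] ⋀[K]^q W}
    (hL : IsPluckerMap L) {ω : ⋀[K]^p V} (hω : ω ∈ X.obj p V) : L ω ∈ X.obj q W := by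
  induction hL with
  | refl => exact hω
  | map L φ _ ih => exact X.map_mem _ _ _ φ _ ih
  | hodge L star hs _ ih => exact X.hodge_mem _ _ _ star hs _ ih

theorem exists_retraction_of_finrank_le (h : finrank K V ≤ finrank K W) :
    ∃ (φ : V →ₗ[K] W) (φ' : W →ₗ[K] V), φ' ∘ₗ φ = LinearMap.id := by
  obtain ⟨φ, hφ⟩ := finrank_le_iff_exists_linearMap.1 h
  obtain ⟨φ', h⟩ := φ.exists_leftInverse_of_injective (LinearMap.ker_eq_bot.2 hφ)
  exact ⟨φ, φ', h⟩

/-- Exterior powers embed into sufficiently large exterior powers by means of exterior powers of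
linear maps and Hodge duals, and so do their retractions. -/
theorem exists_isPluckerMap_retraction {N : ℕ} (hV : finrank K V ≤ p + N) (hp : p ≤ N)
    (hW : finrank K W = 2 * N) : ∃ (J : ⋀[K]^p V →ₗ[K] ⋀[K]^N W) (R : ⋀[K]^N W →ₗ[K] ⋀[K]^p V),
      IsPluckerMap J ∧ IsPluckerMap R ∧ R ∘ₗ J = LinearMap.id := by
  -- In dimension exactly `p + N` duality exchanges the powers `p` and `N`. The space `V` embeds
  -- there since `finrank K V ≤ p + N`, and the dual embeds into `W` since `p ≤ N`.
  have hE : finrank K (Fin (p + N) → K) = p + N := by simp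
  obtain ⟨ψ⟩ := exists_topEquiv hE
  obtain ⟨star, hs, -⟩ := exists_hodge hE ψ
  obtain ⟨star', hs', hinv⟩ := hs.exists_inverse
  obtain ⟨φ, φ', hφ⟩ := exists_retraction_of_finrank_le (hV.trans_eq hE.symm)
  obtain ⟨χ, χ', hχ⟩ := exists_retraction_of_finrank_le
    (V := Dual K (Fin (p + N) → K)) (W := W) (by rw [Subspace.dual_finrank_eq, hE, hW]; omega)
  have he : (evalEquiv K (Fin (p + N) → K)).symm.toLinearMap ∘ₗ Dual.eval K _ =
      LinearMap.id := LinearMap.ext fun v => (evalEquiv K _).symm_apply_apply v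
  refine ⟨exteriorPower.map N χ ∘ₗ star ∘ₗ exteriorPower.map p φ,
    exteriorPower.map p (φ' ∘ₗ (evalEquiv K (Fin (p + N) → K)).symm.toLinearMap) ∘ₗ star' ∘ₗ
      exteriorPower.map N χ', .map _ χ (.hodge _ star hs (isPluckerMap_map p φ)),
    .map _ _ (.hodge _ star' hs' (isPluckerMap_map N χ')), LinearMap.ext fun ω => ?_⟩
  simp only [LinearMap.comp_apply]
  rw [← LinearMap.comp_apply (exteriorPower.map N χ'), ← exteriorPower.map_comp, hχ,
    exteriorPower.map_id, LinearMap.id_apply, ← LinearMap.comp_apply star', hinv,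
    ← LinearMap.comp_apply, ← LinearMap.comp_apply, ← exteriorPower.map_comp,
    ← exteriorPower.map_comp, LinearMap.comp_assoc, LinearMap.comp_assoc,
    ← LinearMap.comp_assoc φ, he, LinearMap.id_comp, hφ, exteriorPower.map_id]

theorem mem_zeroLocus_pluckerPullbacks {S : Set (PolyOn K (⋀[K]^q W))} {ω : ⋀[K]^p V} :
    ω ∈ PolyOn.zeroLocus (pluckerPullbacks S p V) ↔
      ∀ L : ⋀[K]^p V →ₗ[K] ⋀[K]^q W, IsPluckerMap L → L ω ∈ PolyOn.zeroLocus S := by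
  constructor
  · intro h L hL f hf
    rw [← PolyOn.evalAt_pullback]
    exact h _ ⟨f, hf, L, hL, rfl⟩
  · rintro h _ ⟨f, hf, L, hL, rfl⟩
    rw [PolyOn.evalAt_pullback]
    exact h L hL f hf

end PluckerMap

/-! ### Truncations and their stabilisation. -/

namespace PluckerVariety

variable {K : Type u} [Field K] (X : PluckerVariety K)

/-- The largest Plücker variety which agrees with a given one on the `N`-th exterior power of a
space of dimension `2 * N`. -/
def truncation (N : ℕ) : PluckerVariety K where
  obj p V _ _ _ := {ω | ∀ L : ⋀[K]^p V →ₗ[K] ⋀[K]^N (Fin (2 * N) → K), IsPluckerMap L →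
    L ω ∈ X.obj N (Fin (2 * N) → K)}
  isClosed p V _ _ _ := by
    obtain ⟨S, hS⟩ := X.isClosed N (Fin (2 * N) → K)
    refine ⟨pluckerPullbacks S p V, ?_⟩
    ext ω
    rw [mem_zeroLocus_pluckerPullbacks, hS]
    rfl
  map_mem p V W _ _ _ _ _ _ φ ω hω L hL := hω _ ((isPluckerMap_map p φ).comp hL)
  hodge_mem p n V _ _ _ star hs ω hω L hL := hω _ (hs.isPluckerMap.comp hL)


variable {p N N' : ℕ} {V : Type u} [AddCommGroup V] [Module K V] [FiniteDimensional K V]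

theorem obj_subset_truncation : X.obj p V ⊆ (X.truncation N).obj p V := fun _ hω _ hL =>
  X.mem_of_isPluckerMap hL hω

/-- The test space of level `N` is a retract of that of level `N'` through Plücker maps, so tests at
the higher level imply those at the lower. -/
theorem truncation_subset_of_le (h : N ≤ N') :
    (X.truncation N').obj p V ⊆ (X.truncation N).obj p V := by
  intro ω hω L hL
  obtain ⟨J, R, hJ, hR, hRJ⟩ := exists_isPluckerMap_retraction (K := K)
    (V := Fin (2 * N) → K) (W := Fin (2 * N') → K) (p := N) (N := N') (by simp; omega) h (by simp)
  have := X.mem_of_isPluckerMap hR (hω _ (hL.comp hJ))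
  rwa [← LinearMap.comp_apply, ← LinearMap.comp_assoc, hRJ, LinearMap.id_comp] at this

/-- Within these dimensions the exterior power is itself such a retract, so one test decides
membership. -/
theorem truncation_subset (hV : finrank K V ≤ p + N) (hp : p ≤ N) :
    (X.truncation N).obj p V ⊆ X.obj p V := by
  intro ω hω
  obtain ⟨J, R, hJ, hR, hRJ⟩ := exists_isPluckerMap_retraction (K := K)
    (V := V) (W := Fin (2 * N) → K) hV hp (by simp)
  have := X.mem_of_isPluckerMap hR (hω _ hJ)
  rwa [← LinearMap.comp_apply, hRJ] at this

theorem IsBounded.exists_truncation_subset [Infinite K] {X : PluckerVariety K}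
    (hX : X.IsBounded) : ∃ N, ∀ (p : ℕ) (V : Type u) [AddCommGroup V] [Module K V]
      [FiniteDimensional K V], (X.truncation N).obj p V ⊆ X.obj p V := by
  obtain ⟨V₁, _, _, _, hV₁⟩ := hX
  -- At this level the truncation already agrees with `X` on the second exterior power of `V₁`, so
  -- the chain starts with a bounded member.
  let M := finrank K V₁ + 2
  have hM : (X.truncation M).obj 2 V₁ ≠ Set.univ := fun h => hV₁ (Set.univ_subset_iff.1
    (h ▸ X.truncation_subset (by omega) (by omega)))
  obtain ⟨i₀, hi₀⟩ := FormSystem.chain_stabilizes (fun i => (X.truncation (M + i)).formSystem)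
    (fun i j hij => formSystem_mono fun p V _ _ _ => X.truncation_subset_of_le (by omega))
    (formSystem_mem_ne_univ _ hM)
  refine ⟨M + i₀, fun p V _ _ _ => ?_⟩
  -- The stable truncation is compared with a later one, of level large enough to recover `X` at the
  -- given `p` and `V`.
  refine (obj_subset_of_formSystem_le (hi₀ (i₀ + p + finrank K V) (by omega)) p V).trans ?_
  exact X.truncation_subset (by omega) (by omega)

end PluckerVariety

/-! ### Equations of bounded degree and the main theorem. -/

section Degree

variable {K : Type u} [Field K]

theorem CoordClosed.exists_finset {σ : Type*} [Finite σ] {Z : Set (σ → K)} (hZ : CoordClosed Z) :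
    ∃ s : Finset (MvPolynomial σ K), Z = {x | ∀ f ∈ s, MvPolynomial.eval x f = 0} := by
  obtain ⟨S, hS, rfl⟩ := hZ
  obtain ⟨s, hs⟩ := IsNoetherian.noetherian
    (Ideal.span {f : MvPolynomial σ K | (fun x => MvPolynomial.eval x f) ∈ S})
  refine ⟨s, ?_⟩
  have h (x : σ → K) : (∀ f ∈ s, MvPolynomial.eval x f = 0) ↔
      ∀ f ∈ {f : MvPolynomial σ K | (fun x => MvPolynomial.eval x f) ∈ S},
        MvPolynomial.eval x f = 0 := by
    have h1 : ∀ T : Set (MvPolynomial σ K), (∀ f ∈ T, MvPolynomial.eval x f = 0) ↔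
        Ideal.span T ≤ RingHom.ker (MvPolynomial.eval x) := fun T => by
      rw [Ideal.span_le]
      rfl
    rw [h1, ← hs, ← Ideal.span, ← h1]
    rfl
  ext x
  rw [Set.mem_ofPred_eq, Set.mem_ofPred_eq, h]
  constructor
  · intro hx f hf
    exact hx _ hf
  · intro hx f hf
    obtain ⟨g, hg⟩ := hS hf
    have hfg : f = fun x => MvPolynomial.eval x g := funext hg
    rw [hg]
    exact hx g (by rw [Set.mem_ofPred_eq, ← hfg]; exact hf)

/-- In coordinates the equations generate a finitely generated ideal, so finitely many of them
suffice and their degrees have a maximum. -/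
theorem IsZariskiClosed.exists_totalDegree_le {W : Type u} [AddCommGroup W] [Module K W]
    [FiniteDimensional K W] {Z : Set W} (hZ : IsZariskiClosed K Z) :
    ∃ (d : ℕ) (S : Set (PolyOn K W)), (∀ f ∈ S, f.totalDegree ≤ d) ∧ Z = PolyOn.zeroLocus S := by
  let b := finBasis K W
  obtain ⟨s, hs⟩ := (hZ.coordClosed b.equivFun.symm.toLinearMap).exists_finset
  refine ⟨s.sup MvPolynomial.totalDegree, MvPolynomial.rename b.coord '' s, ?_, ?_⟩
  · rintro _ ⟨f, hf, rfl⟩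
    exact (MvPolynomial.totalDegree_rename_le _ _).trans (Finset.le_sup (by simpa using hf))
  · ext w
    have h := Set.ext_iff.1 hs (b.equivFun w)
    rw [Set.mem_preimage, LinearEquiv.coe_coe, LinearEquiv.symm_apply_apply] at h
    rw [h]
    simp only [PolyOn.zeroLocus, Set.mem_ofPred_eq, Set.forall_mem_image, PolyOn.evalAt,
      MvPolynomial.eval_rename]
    rfl

end Degree

theorem theorem1p1 {K : Type u} [Field K] [Infinite K] (X : PluckerVariety K)
    (hX : X.IsBounded) :
    (∃ (p₀ : ℕ) (V₀ : Type u) (_ : AddCommGroup V₀) (_ : Module K V₀)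
        (_ : FiniteDimensional K V₀),
      ∀ S : Set (PolyOn K (⋀[K]^p₀ V₀)), X.obj p₀ V₀ = PolyOn.zeroLocus S →
        ∀ (p : ℕ) (V : Type u) [AddCommGroup V] [Module K V] [FiniteDimensional K V],
          X.obj p V = PolyOn.zeroLocus (pluckerPullbacks S p V)) ∧
    (∃ d : ℕ, ∀ (p : ℕ) (V : Type u) [AddCommGroup V] [Module K V] [FiniteDimensional K V],
      ∃ S : Set (PolyOn K (⋀[K]^p V)),
        (∀ f ∈ S, f.totalDegree ≤ d) ∧ X.obj p V = PolyOn.zeroLocus S) := by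
  obtain ⟨N, hN⟩ := hX.exists_truncation_subset
  have key : ∀ S : Set (PolyOn K (⋀[K]^N (Fin (2 * N) → K))),
      X.obj N (Fin (2 * N) → K) = PolyOn.zeroLocus S →
        ∀ (p : ℕ) (V : Type u) [AddCommGroup V] [Module K V] [FiniteDimensional K V],
          X.obj p V = PolyOn.zeroLocus (pluckerPullbacks S p V) := by
    intro S hS p V _ _ _
    rw [(X.obj_subset_truncation (N := N)).antisymm (hN p V)]
    ext ω
    rw [mem_zeroLocus_pluckerPullbacks, ← hS]
    rfl
  refine ⟨⟨N, Fin (2 * N) → K, _, _, inferInstance, key⟩, ?_⟩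
  -- The degree comes from one instance of `X`; pullback along a linear map renames linear forms, so
  -- the bound holds for every `p` and `V`.
  obtain ⟨d, S, hd, hS⟩ := (X.isClosed N (Fin (2 * N) → K)).exists_totalDegree_le
  refine ⟨d, fun p V _ _ _ => ⟨pluckerPullbacks S p V, ?_, key S hS p V⟩⟩
  rintro _ ⟨f, hf, L, -, rfl⟩
  exact (MvPolynomial.totalDegree_rename_le _ _).trans (hd f hf)
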